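/- **Setting.** Let $d_x,d_\alpha\in\mathbb N$. $\mathcal P_2(\mathbb R^{d})$ is the set of Borel probability measures on $\mathbb R^{d}$ with finite second moment, with the topology of the 2-Wasserstein distance $W_2$; $\|\mu\|_1=\int|x|\,d\mu(x)$ and $\|\mu\|_2=(\int|x|^2d\mu(x))^{1/2}$; $X\#m$ is the push-forward. Matrices and bilinear maps carry their operator norm. *Derivatives in $\mu$.* "$c$ is bounded on bounded sets" means that $c:\mathcal P_2\to[0,\infty)$ is bounded on $\{\mu:\|\mu\|_2\le R\}$ for every $R$. A jointly continuous $\frac{\delta F}{\delta\mu}(\mu)(\tilde x)$ is the *linear functional derivative* of $F$ on $\mathcal P_2(\mathbb R^{d_x})$ if $|\frac{\delta F}{\delta\mu}(\mu)(\tilde x)|\le c(\mu)(1+|\tilde x|^2)$ with $c$ bounded on bounded sets, $\int\frac{\delta F}{\delta\mu}(\mu)\,d\mu=0$ for all $\mu$, and $$F(\nu_1)-F(\nu_2)=\int_0^1\!\int\frac{\delta F}{\delta\mu}(\theta\nu_1+(1-\theta)\nu_2)(\tilde x)\,d(\nu_1-\nu_2)(\tilde x)\,d\theta .$$ A jointly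 continuous $\frac{\delta^2F}{\delta\mu^2}(\mu)(\tilde x,\hat x)$ is a *second order* one if its norm is at most $c(\mu)(1+|\tilde x|^2+|\hat x|^2)$ with $c$ bounded on bounded sets, its integral against $\mu$ in either of its two arguments vanishes, and $$F(\nu_1)-F(\nu_2)=\int\frac{\delta F}{\delta\mu}(\nu_2)\,d(\nu_1-\nu_2)+\int_0^1\!\int_0^1\theta\int\!\!\int\frac{\delta^2F}{\delta\mu^2}(l\theta\nu_1+(1-l\theta)\nu_2)(\tilde x,\hat x)\,d(\nu_1-\nu_2)(\tilde x)\,d(\nu_1-\nu_2)(\hat x)\,dl\,d\theta .$$ Put $\partial_\mu F(\mu)(\tilde x)=\partial_{\tilde x}\frac{\delta F}{\delta\mu}(\mu)(\tilde x)$ and $\partial_\mu\partial_\mu F(\mu)(\tilde x,\hat x)=\partial_{\tilde x}\partial_{\hat x}\frac{\delta^2F}{\delta\mu^2}(\mu)(\tilde x,\hat x)$. $F$ is *second-order regularly differentiable* if these and $\partial_{\tilde x}\partial_\mu F$ exist, are jointly continuous, and $|\partial_{\tilde x}\partial_\mu F(\mu)(\tilde x)|+|\partial_\mu\partial_\mu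 F(\mu)(\tilde x,\hat x)|\le c(\mu)$ with $c$ bounded on bounded sets. $F$ is *$L$-differentiable* with $L$-derivative $\partial_\mu F$ if its lift $Y\mapsto F(\mathcal L_Y)$ to $L^2([0,1],\text{Lebesgue};\mathbb R^{d_x})$ is Fréchet differentiable at every $Y$ with derivative $H\mapsto\mathbb E[\partial_\mu F(\mathcal L_Y)(Y)H]$. *"Second-order differentiable"* for $\Phi(x,\mu,\alpha)$ means: $\Phi$ is twice differentiable in $x$ and in $\alpha$ and second-order regularly differentiable in $\mu$, the mixed derivatives $\partial_\alpha\partial_x\Phi,\partial_x\partial_\mu\Phi,\partial_\alpha\partial_\mu\Phi$ exist, and all first and second order derivatives are jointly continuous. The *second order derivatives* of $\Phi$ are $$\partial_x\partial_x\Phi,\quad\partial_\alpha\partial_x\Phi,\quad\partial_\alpha\partial_\alpha\Phi,\quad\partial_x\partial_\mu\Phi(\tilde x),\quad\partial_\alpha\partial_\mu\Phi(\tilde x),\quad\partial_{\tilde x}\partial_\mu\Phi(\tilde x),\quad\partial_\mu\partial_\mu\Phi(\tilde x,\hat x).$$ **Assumption (a1).** $f:\mathbb R^{d_x}\times\mathcal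 P_2(\mathbb R^{d_x})\times\mathbb R^{d_\alpha}\to\mathbb R^{d_x}$ is second-order differentiable and there are positive constants $\lambda_f,\Lambda_f,\bar l_f,\mathrm{Lip}_f$ such that everywhere: $|(\partial_\alpha f)^{\top}\xi|^2\ge\lambda_f|\xi|^2$ for $\xi\in\mathbb R^{d_x}$; $|\partial_\alpha f|,|\partial_\mu f|,|\partial_xf|\le\Lambda_f$; each second order derivative $D$ of $f$ satisfies $|D|\,(1+|x|+\|\mu\|_1)\le\bar l_f$; and each of them is jointly Lipschitz in its arguments (in $W_2$ for $\mu$), in the sense that the difference of its values at two points, with space and measure arguments $(x,\mu)$ and $(x',\mu')$, is at most $\frac{\mathrm{Lip}_f}{1+\max\{|x|,|x'|\}+\max\{\|\mu\|_1,\|\mu'\|_1\}}$ times the sum of the distances of all arguments. **Assumption (a2).** $g:\mathbb R^{d_x}\times\mathcal P_2(\mathbb R^{d_x})\times\mathbb R^{d_\alpha}\to\mathbb R$ is second-order differentiable, its second order derivatives are jointly Lipschitz in their arguments, and there are constants $\lambda_g,\Lambda_g,\bar l_g>0$ and $0\le l_g\le\lambda_g/2$ such that: $\partial_\alpha\partial_\alpha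 g\ge\lambda_gI$; with $G(x,\mu,\alpha)=g(x,\mu,\alpha)+\int\frac{\delta g}{\delta\mu}(\tilde x,\mu,\alpha)(x)\,d\mu(\tilde x)$, $\partial_x\partial_xG\ge\lambda_gI$ and $$\int\big(G(x,\mu',\alpha)-G(x,\mu,\alpha)\big)\,d(\mu'-\mu)(x)\ge-l_g\Big|\int x\,d(\mu-\mu')(x)\Big|^2 ;$$ $|\partial_\mu\partial_\mu g|,|\partial_\alpha\partial_\alpha g|,|\partial_x\partial_\mu g|,|\partial_x\partial_xg|,|\partial_{\tilde x}\partial_\mu g|\le\Lambda_g$; and $|\partial_\alpha\partial_xg|,|\partial_\alpha\partial_\mu g|\le\bar l_g$. **Assumption (P).** $p:\mathbb R^{d_x}\times\mathcal P_2(\mathbb R^{d_x})\to\mathbb R^{d_x}$ is differentiable in $x$ and $L$-differentiable in $\mu$, $\partial_xp(x,\mu)$ and $\partial_\mu p(x,\mu)(\tilde x)$ are jointly Lipschitz in their arguments, and there are constants $L_p,\overline L_p>0$ such that $|\partial_xp|\le L_p$, $|\partial_\mu p|\le L_p$ and $|p(x,\mu)|\le\overline L_p(1+|x|+\|\mu\|_1)$.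 **Relation (p\_aa\_f).** $|\partial_\alpha\partial_\alpha f(x,\mu,\alpha)|\,(1+|x|+\|\mu\|_1)\le\frac{1}{40\,\overline L_p}\lambda_g$ for all $(x,\mu,\alpha)$. **Optimal control.** $\hat\alpha:\mathbb R^{d_x}\times\mathcal P_2(\mathbb R^{d_x})\times\mathbb R^{d_x}\to\mathbb R^{d_\alpha}$ is a map that satisfies the first order condition $$\partial_\alpha f(x,\mu,\hat\alpha)\cdot z+\partial_\alpha g(x,\mu,\hat\alpha)=0,\qquad\hat\alpha=\hat\alpha(x,\mu,z),$$ at every $(x,\mu,z)$ of the cone $c_{k_0}=\{|z|\le\frac{k_0}2(1+|x|+\|\mu\|_1)\}$, $k_0=4\overline L_p$. **Constants.** $L_f=\max\{\Lambda_f,|f(0,\delta_0,0)|\}$, $\;L_g=\max\{|\partial_\mu g(0,\delta_0,0)(0)|,|\partial_xg(0,\delta_0,0)|,|\partial_\alpha g(0,\delta_0,0)|,\Lambda_g,\bar l_g\}$, $\;L_\alpha=\max\big\{\tfrac{20\Lambda_f}{19\lambda_g},\tfrac{20(\bar l_g+\frac12k_0\bar l_f)}{19\lambda_g},|\hat\alpha(0,\delta_0,0)|\big\}$.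 **The FBODE system.** For $t\le\widetilde T$ and $m\in\mathcal P_2(\mathbb R^{d_x})$, a solution pair on $[t,\widetilde T]$ is a pair $(X_s(x),Z_s(x))_{s\in[t,\widetilde T],\,x\in\mathbb R^{d_x}}$ with $X_s\in L^2_m$ and $Z_s\in L^1_m$ for every $s$, such that, with $\mu_s=X_s\#m$ and $\alpha_s(x)=\hat\alpha(X_s(x),\mu_s,Z_s(x))$, the first order condition holds at $(X_s(x),\mu_s,Z_s(x))$, the integrand below is $m$-integrable in $y$, and for all $s\in[t,\widetilde T]$ and all $x$ $$\frac{d}{ds}X_s(x)=f(X_s(x),\mu_s,\alpha_s(x)),\qquad X_t(x)=x,$$ $$-\frac{d}{ds}Z_s(x)=\partial_xf(X_s(x),\mu_s,\alpha_s(x))\cdot Z_s(x)+\partial_xg(X_s(x),\mu_s,\alpha_s(x))$$ $$\qquad+\int\Big(\partial_\mu f(X_s(y),\mu_s,\alpha_s(y))(X_s(x))\cdot Z_s(y)+\partial_\mu g(X_s(y),\mu_s,\alpha_s(y))(X_s(x))\Big)dm(y),$$ $$Z_{\widetilde T}(x)=p(X_{\widetilde T}(x),\mu_{\widetilde T}).$$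 **Theorem (Local uniqueness of solutions to the FBODE system).** There is a constant $\epsilon_7=\epsilon_7(\overline L_p;L_f,\Lambda_f,\bar l_f,L_g,\Lambda_g,\bar l_g,L_\alpha)>0$, depending only on the listed constants, with the following property. Let $f$, $g$, $p$ satisfy (a1), (a2), (P) with $L_p\le\overline L_p$ and with (p\_aa\_f), and let $\hat\alpha$ be an optimal control map as above, all with these values of the constants. Then, for any $0\le t\le\widetilde T\le T$ with $\widetilde T-t\le\epsilon_7$ and any $m\in\mathcal P_2(\mathbb R^{d_x})$, any two solution pairs $(X,Z)$ and $(\widetilde X,\widetilde Z)$ of the FBODE system on $[t,\widetilde T]$ that are continuously differentiable in $s\in[t,\widetilde T]$ for each $x$ are equal: $X_s(x)=\widetilde X_s(x)$ and $Z_s(x)=\widetilde Z_s(x)$ for all $s\in[t,\widetilde T]$ and $x\in\mathbb R^{d_x}$. -/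

import Mathlib

open MeasureTheory Set Filter Topology

noncomputable section

namespace MFTC

/-- `ℝ^d` with its Euclidean norm. -/
abbrev Euc (d : ℕ) := EuclideanSpace ℝ (Fin d)

/-! ### The Wasserstein space `𝒫₂(ℝ^d)` -/

/-- Borel probability measures on `ℝ^d` with finite second moment. -/
def P2 (d : ℕ) : Type :=
  {μ : Measure (Euc d) // IsProbabilityMeasure μ ∧ MemLp (fun x : Euc d => x) 2 μ}

variable {d a : ℕ}

/-- The underlying measure. -/
def P2.meas (μ : P2 d) : Measure (Euc d) := μ.1

instance (μ : P2 d) : IsProbabilityMeasure μ.meas := μ.2.1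

/-- The Dirac mass at the point `x`. -/
def P2.dirac (x : Euc d) : P2 d :=
  ⟨Measure.dirac x, inferInstance, by
    refine (memLp_two_iff_integrable_sq_norm (by fun_prop)).2 ?_
    exact integrable_dirac (by simp)⟩

/-- `‖μ‖₁ = ∫ |x| dμ(x)`. -/
def P2.norm1 (μ : P2 d) : ℝ := ∫ x, ‖x‖ ∂μ.meas

/-- `‖μ‖₂ = (∫ |x|² dμ(x))^{1/2}`. -/
def P2.norm2 (μ : P2 d) : ℝ := Real.sqrt (∫ x, ‖x‖ ^ 2 ∂μ.meas)

/-- The couplings of `μ` and `ν`. -/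
def couplings (μ ν : P2 d) : Set (Measure (Euc d × Euc d)) :=
  {π | π.map Prod.fst = μ.meas ∧ π.map Prod.snd = ν.meas}

/-- The 2-Wasserstein distance. -/
def W2 (μ ν : P2 d) : ℝ :=
  Real.sqrt (⨅ π ∈ couplings μ ν, ∫⁻ q, ‖q.1 - q.2‖ₑ ^ 2 ∂π).toReal

/-- The topology of the 2-Wasserstein metric: `U` is open iff it contains a `W₂`-ball around each of
its points. -/
instance : TopologicalSpace (P2 d) where
  IsOpen U := ∀ μ ∈ U, ∃ r > 0, ∀ ν, W2 ν μ < r → ν ∈ U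
  isOpen_univ := fun _ _ => ⟨1, one_pos, fun _ _ => mem_univ _⟩
  isOpen_inter := by
    rintro s t hs ht μ ⟨h1, h2⟩
    obtain ⟨r, hr, h⟩ := hs μ h1
    obtain ⟨r', hr', h'⟩ := ht μ h2
    exact ⟨min r r', lt_min hr hr', fun ν hν =>
      ⟨h ν (hν.trans_le (min_le_left _ _)), h' ν (hν.trans_le (min_le_right _ _))⟩⟩
  isOpen_sUnion := by
    rintro s hs μ ⟨u, hu, hμ⟩
    obtain ⟨r, hr, h⟩ := hs u hu μ hμ
    exact ⟨r, hr, fun ν hν => ⟨u, hu, h ν hν⟩⟩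

/-- The mixture `θ ν₁ + (1 - θ) ν₂`; only `θ ∈ [0,1]` is used, other values are projected to
`[0,1]`. -/
def P2.mix (θ : ℝ) (ν₁ ν₂ : P2 d) : P2 d :=
  ⟨ENNReal.ofReal (projIcc (0 : ℝ) 1 zero_le_one θ) • ν₁.meas +
    ENNReal.ofReal (1 - projIcc (0 : ℝ) 1 zero_le_one θ) • ν₂.meas, by
    constructor
    · constructor
      have h0 := (projIcc (0 : ℝ) 1 zero_le_one θ).2.1
      have h1 := (projIcc (0 : ℝ) 1 zero_le_one θ).2.2
      simp only [Measure.add_apply, Measure.smul_apply, measure_univ, smul_eq_mul, mul_one]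
      rw [← ENNReal.ofReal_add h0 (by linarith)]
      simp
    · refine (memLp_two_iff_integrable_sq_norm (by fun_prop)).2 ?_
      exact (((memLp_two_iff_integrable_sq_norm (by fun_prop)).1 ν₁.2.2).smul_measure
        ENNReal.ofReal_ne_top).add_measure
        (((memLp_two_iff_integrable_sq_norm (by fun_prop)).1 ν₂.2.2).smul_measure
        ENNReal.ofReal_ne_top)⟩

open Classical in
/-- The law of a square integrable random vector `Y` (the Dirac mass at `0` if `Y` is not square
integrable). -/
def P2.law {Ω : Type*} [MeasurableSpace Ω] (P : Measure Ω) [hP : IsProbabilityMeasure P]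
    (Y : Ω → Euc d) : P2 d :=
  if h : MemLp Y 2 P then
    ⟨P.map Y, Measure.isProbabilityMeasure_map h.1.aemeasurable,
      (memLp_map_measure_iff aestronglyMeasurable_id h.1.aemeasurable).2 h⟩
  else P2.dirac 0

/-- The push-forward `X # m` of `m` by a map `X ∈ L²_m`. -/
def P2.push (m : P2 d) (X : Euc d → Euc d) : P2 d := P2.law m.meas X

/-! ### Derivatives with respect to the measure argument -/

section MeasureDerivatives

variable {V : Type*} [NormedAddCommGroup V] [NormedSpace ℝ V]

/-- `∫ h d(ν₁ - ν₂)`. -/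
def intDiff (ν₁ ν₂ : P2 d) (h : Euc d → V) : V := ∫ x, h x ∂ν₁.meas - ∫ x, h x ∂ν₂.meas

/-- `c : 𝒫₂ → [0,∞)` is bounded on bounded subsets of `𝒫₂`. -/
def BddOnBdd (c : P2 d → ℝ) : Prop :=
  (∀ μ, 0 ≤ c μ) ∧ ∀ R : ℝ, ∃ C : ℝ, ∀ μ, μ.norm2 ≤ R → c μ ≤ C

/-- `δF` is the (normalized) linear functional derivative of `F`. -/
structure IsLinFunDeriv (F : P2 d → V) (δF : P2 d → Euc d → V) : Prop where
  cont : Continuous fun q : P2 d × Euc d => δF q.1 q.2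
  growth : ∃ c, BddOnBdd c ∧ ∀ μ x, ‖δF μ x‖ ≤ c μ * (1 + ‖x‖ ^ 2)
  formula : ∀ ν₁ ν₂ : P2 d,
    F ν₁ - F ν₂ = ∫ θ in (0 : ℝ)..1, intDiff ν₁ ν₂ (δF (P2.mix θ ν₁ ν₂))
  normalized : ∀ μ : P2 d, ∫ x, δF μ x ∂μ.meas = 0

/-- `δ2F` is a (normalized) second order linear functional derivative of `F`, whose first order one
is `δF`. -/
structure IsSecondLinFunDeriv (F : P2 d → V) (δF : P2 d → Euc d → V)
    (δ2F : P2 d → Euc d → Euc d → V) : Prop where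
  first : IsLinFunDeriv F δF
  cont : Continuous fun q : P2 d × Euc d × Euc d => δ2F q.1 q.2.1 q.2.2
  growth : ∃ c, BddOnBdd c ∧ ∀ μ x y, ‖δ2F μ x y‖ ≤ c μ * (1 + ‖x‖ ^ 2 + ‖y‖ ^ 2)
  formula : ∀ ν₁ ν₂ : P2 d,
    F ν₁ - F ν₂ = intDiff ν₁ ν₂ (δF ν₂) +
      ∫ θ in (0 : ℝ)..1, ∫ l in (0 : ℝ)..1,
        θ • intDiff ν₁ ν₂ fun y => intDiff ν₁ ν₂ fun x => δ2F (P2.mix (l * θ) ν₁ ν₂) x y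
  normalized_right : ∀ (μ : P2 d) x, ∫ y, δ2F μ x y ∂μ.meas = 0
  normalized_left : ∀ (μ : P2 d) y, ∫ x, δ2F μ x y ∂μ.meas = 0

/-- `F` is `L`-differentiable on `𝒫₂` with `L`-derivative `dF`: the lift `Y ↦ F (law Y)` to the
Hilbert space `L²(Ω; ℝ^d)`, with `Ω = [0,1]` carrying Lebesgue measure, is Fréchet differentiable
at every `Y`, and its derivative at `Y` is `H ↦ 𝔼[dF (law Y) (Y) H]`. -/
def IsLDeriv (F : P2 d → V) (dF : P2 d → Euc d → Euc d →L[ℝ] V) : Prop :=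
  ∀ Y : Lp (Euc d) 2 (volume : Measure unitInterval),
    ∃ D : Lp (Euc d) 2 (volume : Measure unitInterval) →L[ℝ] V,
      HasFDerivAt (fun Y' : Lp (Euc d) 2 (volume : Measure unitInterval) =>
        F (P2.law (volume : Measure unitInterval) Y')) D Y ∧
      ∀ H : Lp (Euc d) 2 (volume : Measure unitInterval),
        D H = ∫ ω, dF (P2.law (volume : Measure unitInterval) Y) (Y ω) (H ω)

end MeasureDerivatives

/-! ### First and second order derivatives of a coefficient `Φ(x, μ, α)` -/

/-- Candidates for the derivatives of a function `Φ : ℝ^d × 𝒫₂(ℝ^d) × ℝ^a → V`. Second derivatives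
are curried: `∂₁∂₂Φ` takes the increment of the variable of `∂₁` first. The (jointly continuous) mixed
derivatives do not depend on the order of differentiation. -/
structure Derivs (d a : ℕ) (V : Type*) [NormedAddCommGroup V] [NormedSpace ℝ V] where
  /-- `∂_x Φ (x, μ, α)` -/
  dx : Euc d → P2 d → Euc a → Euc d →L[ℝ] V
  /-- `∂_α Φ (x, μ, α)` -/
  da : Euc d → P2 d → Euc a → Euc a →L[ℝ] V
  /-- `(δ/δμ) Φ (x, μ, α) (x̃)` -/
  lin : Euc d → P2 d → Euc a → Euc d → V
  /-- `∂_μ Φ (x, μ, α) (x̃) = ∂_x̃ (δ/δμ) Φ (x, μ, α) (x̃)` -/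
  dm : Euc d → P2 d → Euc a → Euc d → Euc d →L[ℝ] V
  /-- `(δ²/δμ²) Φ (x, μ, α) (x̃, x̂)` -/
  lin2 : Euc d → P2 d → Euc a → Euc d → Euc d → V
  /-- `∂_x̂ (δ²/δμ²) Φ (x, μ, α) (x̃, x̂)` -/
  dlin2 : Euc d → P2 d → Euc a → Euc d → Euc d → Euc d →L[ℝ] V
  /-- `∂_x ∂_x Φ (x, μ, α)` -/
  dxx : Euc d → P2 d → Euc a → Euc d →L[ℝ] Euc d →L[ℝ] V
  /-- `∂_α ∂_x Φ (x, μ, α)` -/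
  dax : Euc d → P2 d → Euc a → Euc a →L[ℝ] Euc d →L[ℝ] V
  /-- `∂_α ∂_α Φ (x, μ, α)` -/
  daa : Euc d → P2 d → Euc a → Euc a →L[ℝ] Euc a →L[ℝ] V
  /-- `∂_x ∂_μ Φ (x, μ, α) (x̃)` -/
  dxm : Euc d → P2 d → Euc a → Euc d → Euc d →L[ℝ] Euc d →L[ℝ] V
  /-- `∂_α ∂_μ Φ (x, μ, α) (x̃)` -/
  dam : Euc d → P2 d → Euc a → Euc d → Euc a →L[ℝ] Euc d →L[ℝ] V
  /-- `∂_x̃ ∂_μ Φ (x, μ, α) (x̃)` -/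
  dym : Euc d → P2 d → Euc a → Euc d → Euc d →L[ℝ] Euc d →L[ℝ] V
  /-- `∂_μ ∂_μ Φ (x, μ, α) (x̃, x̂) = ∂_x̃ ∂_x̂ (δ²/δμ²) Φ (x, μ, α) (x̃, x̂)` -/
  dmm : Euc d → P2 d → Euc a → Euc d → Euc d → Euc d →L[ℝ] Euc d →L[ℝ] V

section Coefficients

variable {V : Type*} [NormedAddCommGroup V] [NormedSpace ℝ V]

/-- `Φ` is second order differentiable in `x` and `α` and second order regularly differentiable in
`μ`, with derivatives `D`, all first and second order derivatives being jointly continuous. -/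
structure HasDerivs (Φ : Euc d → P2 d → Euc a → V) (D : Derivs d a V) : Prop where
  dx : ∀ x μ α, HasFDerivAt (fun x' => Φ x' μ α) (D.dx x μ α) x
  da : ∀ x μ α, HasFDerivAt (fun α' => Φ x μ α') (D.da x μ α) α
  lin : ∀ x α, IsSecondLinFunDeriv (fun μ => Φ x μ α) (fun μ => D.lin x μ α)
    (fun μ => D.lin2 x μ α)
  dm : ∀ x μ α y, HasFDerivAt (D.lin x μ α) (D.dm x μ α y) y
  dlin2 : ∀ x μ α y z, HasFDerivAt (fun z' => D.lin2 x μ α y z') (D.dlin2 x μ α y z) z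
  dxx : ∀ x μ α, HasFDerivAt (fun x' => D.dx x' μ α) (D.dxx x μ α) x
  dax : ∀ x μ α, HasFDerivAt (fun α' => D.dx x μ α') (D.dax x μ α) α
  daa : ∀ x μ α, HasFDerivAt (fun α' => D.da x μ α') (D.daa x μ α) α
  dxm : ∀ x μ α y, HasFDerivAt (fun x' => D.dm x' μ α y) (D.dxm x μ α y) x
  dam : ∀ x μ α y, HasFDerivAt (fun α' => D.dm x μ α' y) (D.dam x μ α y) α
  dym : ∀ x μ α y, HasFDerivAt (fun y' => D.dm x μ α y') (D.dym x μ α y) y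
  dmm : ∀ x μ α y z, HasFDerivAt (fun y' => D.dlin2 x μ α y' z) (D.dmm x μ α y z) y
  regular : ∀ x α, ∃ c, BddOnBdd c ∧
    ∀ μ y z, ‖D.dym x μ α y‖ + ‖D.dmm x μ α y z‖ ≤ c μ
  cont_dx : Continuous fun q : Euc d × P2 d × Euc a => D.dx q.1 q.2.1 q.2.2
  cont_da : Continuous fun q : Euc d × P2 d × Euc a => D.da q.1 q.2.1 q.2.2
  cont_dm : Continuous fun q : Euc d × P2 d × Euc a × Euc d => D.dm q.1 q.2.1 q.2.2.1 q.2.2.2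
  cont_dxx : Continuous fun q : Euc d × P2 d × Euc a => D.dxx q.1 q.2.1 q.2.2
  cont_dax : Continuous fun q : Euc d × P2 d × Euc a => D.dax q.1 q.2.1 q.2.2
  cont_daa : Continuous fun q : Euc d × P2 d × Euc a => D.daa q.1 q.2.1 q.2.2
  cont_dxm : Continuous fun q : Euc d × P2 d × Euc a × Euc d => D.dxm q.1 q.2.1 q.2.2.1 q.2.2.2
  cont_dam : Continuous fun q : Euc d × P2 d × Euc a × Euc d => D.dam q.1 q.2.1 q.2.2.1 q.2.2.2
  cont_dym : Continuous fun q : Euc d × P2 d × Euc a × Euc d => D.dym q.1 q.2.1 q.2.2.1 q.2.2.2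
  cont_dmm : Continuous fun q : Euc d × P2 d × Euc a × Euc d × Euc d =>
    D.dmm q.1 q.2.1 q.2.2.1 q.2.2.2.1 q.2.2.2.2

/-- Joint Lipschitz continuity of the second order derivatives, with a Lipschitz factor
`κ x x' μ μ'` that may depend on the location. -/
structure SecondDerivsLip (D : Derivs d a V) (κ : Euc d → Euc d → P2 d → P2 d → ℝ) : Prop where
  dxx : ∀ x x' μ μ' α α', ‖D.dxx x μ α - D.dxx x' μ' α'‖ ≤
    κ x x' μ μ' * (‖x - x'‖ + W2 μ μ' + ‖α - α'‖)
  dax : ∀ x x' μ μ' α α', ‖D.dax x μ α - D.dax x' μ' α'‖ ≤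
    κ x x' μ μ' * (‖x - x'‖ + W2 μ μ' + ‖α - α'‖)
  daa : ∀ x x' μ μ' α α', ‖D.daa x μ α - D.daa x' μ' α'‖ ≤
    κ x x' μ μ' * (‖x - x'‖ + W2 μ μ' + ‖α - α'‖)
  dxm : ∀ x x' μ μ' α α' y y', ‖D.dxm x μ α y - D.dxm x' μ' α' y'‖ ≤
    κ x x' μ μ' * (‖x - x'‖ + W2 μ μ' + ‖α - α'‖ + ‖y - y'‖)
  dam : ∀ x x' μ μ' α α' y y', ‖D.dam x μ α y - D.dam x' μ' α' y'‖ ≤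
    κ x x' μ μ' * (‖x - x'‖ + W2 μ μ' + ‖α - α'‖ + ‖y - y'‖)
  dym : ∀ x x' μ μ' α α' y y', ‖D.dym x μ α y - D.dym x' μ' α' y'‖ ≤
    κ x x' μ μ' * (‖x - x'‖ + W2 μ μ' + ‖α - α'‖ + ‖y - y'‖)
  dmm : ∀ x x' μ μ' α α' y y' z z', ‖D.dmm x μ α y z - D.dmm x' μ' α' y' z'‖ ≤
    κ x x' μ μ' * (‖x - x'‖ + W2 μ μ' + ‖α - α'‖ + ‖y - y'‖ + ‖z - z'‖)

end Coefficients

/-! ### The standing assumptions -/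

/-- Assumption (a1) on the drift `f` with derivatives `D` and constants
`λ_f, Λ_f, l̄_f, Lip_f`. -/
structure AssumptionA1 (f : Euc d → P2 d → Euc a → Euc d) (D : Derivs d a (Euc d))
    (lamf Lamf lbarf Lipf : ℝ) : Prop where
  lamf_pos : 0 < lamf
  Lamf_pos : 0 < Lamf
  lbarf_pos : 0 < lbarf
  Lipf_pos : 0 < Lipf
  derivs : HasDerivs f D
  /-- `∑ i, ∑ j, (ξ_i ∂_α f_i) · (ξ_j ∂_α f_j) = |(∂_α f)ᵀ ξ|²` -/
  nondegenerate : ∀ x μ α (ξ : Euc d),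
    lamf * ‖ξ‖ ^ 2 ≤ ‖ContinuousLinearMap.adjoint (D.da x μ α) ξ‖ ^ 2
  bdd_da : ∀ x μ α, ‖D.da x μ α‖ ≤ Lamf
  bdd_dm : ∀ x μ α y, ‖D.dm x μ α y‖ ≤ Lamf
  bdd_dx : ∀ x μ α, ‖D.dx x μ α‖ ≤ Lamf
  bdd_dmm : ∀ x μ α y z, ‖D.dmm x μ α y z‖ * (1 + ‖x‖ + μ.norm1) ≤ lbarf
  bdd_daa : ∀ x μ α, ‖D.daa x μ α‖ * (1 + ‖x‖ + μ.norm1) ≤ lbarf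
  bdd_dam : ∀ x μ α y, ‖D.dam x μ α y‖ * (1 + ‖x‖ + μ.norm1) ≤ lbarf
  bdd_dax : ∀ x μ α, ‖D.dax x μ α‖ * (1 + ‖x‖ + μ.norm1) ≤ lbarf
  bdd_dxx : ∀ x μ α, ‖D.dxx x μ α‖ * (1 + ‖x‖ + μ.norm1) ≤ lbarf
  bdd_dym : ∀ x μ α y, ‖D.dym x μ α y‖ * (1 + ‖x‖ + μ.norm1) ≤ lbarf
  bdd_dxm : ∀ x μ α y, ‖D.dxm x μ α y‖ * (1 + ‖x‖ + μ.norm1) ≤ lbarf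
  lip : SecondDerivsLip D fun x x' μ μ' =>
    Lipf / (1 + max ‖x‖ ‖x'‖ + max μ.norm1 μ'.norm1)

/-- `G(x, μ, α) = g(x, μ, α) + ∫ (δ/δμ) g(x̃, μ, α)(x) dμ(x̃)`. -/
def bigG (g : Euc d → P2 d → Euc a → ℝ) (D : Derivs d a ℝ) (x : Euc d) (μ : P2 d) (α : Euc a) : ℝ :=
  g x μ α + ∫ y, D.lin y μ α x ∂μ.meas

/-- Assumption (a2) on the running cost `g` with derivatives `D` and constants
`λ_g, Λ_g, l̄_g, l_g`. -/
structure AssumptionA2 (g : Euc d → P2 d → Euc a → ℝ) (D : Derivs d a ℝ)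
    (lamg Lamg lbarg lg : ℝ) : Prop where
  lamg_pos : 0 < lamg
  Lamg_pos : 0 < Lamg
  lbarg_pos : 0 < lbarg
  lg_nonneg : 0 ≤ lg
  lg_le : lg ≤ lamg / 2
  derivs : HasDerivs g D
  lip : ∃ Lipg : ℝ, SecondDerivsLip D fun _ _ _ _ => Lipg
  convex_alpha : ∀ x μ α (ξ : Euc a), lamg * ‖ξ‖ ^ 2 ≤ D.daa x μ α ξ ξ
  convex_G : ∀ x μ α (ξ : Euc d),
    lamg * ‖ξ‖ ^ 2 ≤ fderiv ℝ (fderiv ℝ fun x' => bigG g D x' μ α) x ξ ξ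
  monotone_G : ∀ (μ μ' : P2 d) (α : Euc a),
    -lg * ‖intDiff μ μ' fun y => y‖ ^ 2 ≤
      intDiff μ' μ fun x => bigG g D x μ' α - bigG g D x μ α
  bdd_dmm : ∀ x μ α y z, ‖D.dmm x μ α y z‖ ≤ Lamg
  bdd_daa : ∀ x μ α, ‖D.daa x μ α‖ ≤ Lamg
  bdd_dxm : ∀ x μ α y, ‖D.dxm x μ α y‖ ≤ Lamg
  bdd_dxx : ∀ x μ α, ‖D.dxx x μ α‖ ≤ Lamg
  bdd_dym : ∀ x μ α y, ‖D.dym x μ α y‖ ≤ Lamg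
  bdd_dax : ∀ x μ α, ‖D.dax x μ α‖ ≤ lbarg
  bdd_dam : ∀ x μ α y, ‖D.dam x μ α y‖ ≤ lbarg

/-- Assumption (P) on the terminal function `p`, with derivatives `px = ∂_x p`, `pm = ∂_μ p` and
constants `L_p` and `L̄_p`. -/
structure AssumptionP (p : Euc d → P2 d → Euc d) (px : Euc d → P2 d → Euc d →L[ℝ] Euc d)
    (pm : Euc d → P2 d → Euc d → Euc d →L[ℝ] Euc d) (Lp Lbarp : ℝ) : Prop where
  Lp_pos : 0 < Lp
  Lbarp_pos : 0 < Lbarp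
  dx : ∀ x μ, HasFDerivAt (fun x' => p x' μ) (px x μ) x
  dm : ∀ x, IsLDeriv (fun μ => p x μ) (pm x)
  lip_dx : ∃ C : ℝ, ∀ x x' μ μ', ‖px x μ - px x' μ'‖ ≤ C * (‖x - x'‖ + W2 μ μ')
  lip_dm : ∃ C : ℝ, ∀ x x' μ μ' y y',
    ‖pm x μ y - pm x' μ' y'‖ ≤ C * (‖x - x'‖ + W2 μ μ' + ‖y - y'‖)
  bdd_dx : ∀ x μ, ‖px x μ‖ ≤ Lp
  bdd_dm : ∀ x μ y, ‖pm x μ y‖ ≤ Lp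
  growth : ∀ x μ, ‖p x μ‖ ≤ Lbarp * (1 + ‖x‖ + μ.norm1)

/-! ### The optimal control and the forward-backward system -/

/-- The vector (gradient) representing a linear functional on `ℝ^n`. -/
def grad {n : ℕ} (l : Euc n →L[ℝ] ℝ) : Euc n := (InnerProductSpace.toDual ℝ (Euc n)).symm l

/-- The first order condition `∂_α f(x, μ, α) · z + ∂_α g(x, μ, α) = 0`. -/
def FirstOrderCondition (Df : Derivs d a (Euc d)) (Dg : Derivs d a ℝ)
    (x : Euc d) (μ : P2 d) (z : Euc d) (α : Euc a) : Prop :=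
  ContinuousLinearMap.adjoint (Df.da x μ α) z + grad (Dg.da x μ α) = 0

/-- The cone `c_k = {(x, μ, z) : |z| ≤ (k/2) (1 + |x| + ‖μ‖₁)}`. -/
def cone (d : ℕ) (k : ℝ) : Set (Euc d × P2 d × Euc d) :=
  {q | ‖q.2.2‖ ≤ k / 2 * (1 + ‖q.1‖ + q.2.1.norm1)}

/-- `(X, Z)` is a solution pair, continuously differentiable in time, of the FBODE system on `[t, T]`
with initial distribution `m`, drift `f`, running cost derivatives `Dg`, terminal function `p`, and
with the optimal control `α(x, μ, z)` solving the first order condition along the solution. The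
integrability requirements are those needed for `X_s # m ∈ 𝒫₂` and for the integral in the
backward equation to be meaningful. -/
structure IsFBODESolution (f : Euc d → P2 d → Euc a → Euc d) (Df : Derivs d a (Euc d))
    (Dg : Derivs d a ℝ) (p : Euc d → P2 d → Euc d) (α : Euc d → P2 d → Euc d → Euc a)
    (t T : ℝ) (m : P2 d) (X Z : ℝ → Euc d → Euc d) : Prop where
  memLp_X : ∀ s ∈ Icc t T, MemLp (X s) 2 m.meas
  integrable_Z : ∀ s ∈ Icc t T, Integrable (Z s) m.meas
  contDiff_X : ∀ x, ContDiffOn ℝ 1 (fun s => X s x) (Icc t T)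
  contDiff_Z : ∀ x, ContDiffOn ℝ 1 (fun s => Z s x) (Icc t T)
  optimal : ∀ s ∈ Icc t T, ∀ x, FirstOrderCondition Df Dg (X s x) (m.push (X s)) (Z s x)
    (α (X s x) (m.push (X s)) (Z s x))
  forward : ∀ s ∈ Icc t T, ∀ x, HasDerivWithinAt (fun r => X r x)
    (f (X s x) (m.push (X s)) (α (X s x) (m.push (X s)) (Z s x))) (Icc t T) s
  initial : ∀ x, X t x = x
  integrable : ∀ s ∈ Icc t T, ∀ x, Integrable (fun y =>
    ContinuousLinearMap.adjoint
      (Df.dm (X s y) (m.push (X s)) (α (X s y) (m.push (X s)) (Z s y)) (X s x)) (Z s y)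
    + grad (Dg.dm (X s y) (m.push (X s)) (α (X s y) (m.push (X s)) (Z s y)) (X s x))) m.meas
  backward : ∀ s ∈ Icc t T, ∀ x, HasDerivWithinAt (fun r => Z r x)
    (- ContinuousLinearMap.adjoint
        (Df.dx (X s x) (m.push (X s)) (α (X s x) (m.push (X s)) (Z s x))) (Z s x)
      - grad (Dg.dx (X s x) (m.push (X s)) (α (X s x) (m.push (X s)) (Z s x)))
      - ∫ y, (ContinuousLinearMap.adjoint
          (Df.dm (X s y) (m.push (X s)) (α (X s y) (m.push (X s)) (Z s y)) (X s x)) (Z s y)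
        + grad (Dg.dm (X s y) (m.push (X s)) (α (X s y) (m.push (X s)) (Z s y)) (X s x)))
        ∂m.meas) (Icc t T) s
  terminal : ∀ x, Z T x = p (X T x) (m.push (X T))

end MFTC

end

/-! Think of `U = (X, Z)` as a family of curves in time indexed by `x`, driven by a vector field
that couples different `x` only through the law of `X` and an `m`-integral. Sizes are measured by
`|U_s(x)| + ∫ |U_s| dm`, so the distance of two laws always enters as the `L¹(m)` distance of the
maps that produce them.

The analytic core is `norm_sub_le_of_nonlocal_bound`: if `|U'| ≤ C (κ + |U(x)| + ∫ |U| dm)`, then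
over an interval of length at most `1 / (8 C)` the curve moves by at most a small multiple of `κ +
|U(x)| + ∫ |U| dm` taken at any chosen time. Regularity in time is only pointwise in `x`, so a
uniform bound on `s ↦ ∫ |U_s| dm` is not given; `exists_bound_of_closed_sublevel` produces it from
lower semicontinuity (Fatou) and Baire's theorem.

The estimate is used twice. For one solution, with the linear growth from
`ControlledBy.rate_growth`, it propagates the terminal bound `|Z_T| ≤ L̄_p (1 + |X_T| + ‖μ_T‖₁)`
backwards, so that `Z` stays in the cone with twice this aperture (`IsFBODESolution.mem_cone`). For
the difference of two solutions, with the Lipschitz bound `ControlledBy.rate_lip`, it closes a loop: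
the `X`-difference vanishes at `t`, hence is small at `T`; as `p` is Lipschitz, the `Z`-difference
is small at `T`, hence at `t`. Thus `|U_t|` is at most one seventh of `|U_t| + ∫ |U_t| dm`, which
forces `U = 0`.

The Lipschitz bound has two difficulties. Derivatives of `f` are multiplied by the unbounded `Z`;
the decay of the second derivatives of `f` in `1 + |x| + ‖μ‖₁` compensates exactly the growth
allowed by the cone, and the smallness of `∂_α∂_α f` lets the convexity of `g` dominate in the
comparison of controls (`ControlledBy.alpha_lip`). Moreover, `∂_μ Φ` has to be Lipschitz in `μ`,
while the second order functional derivative is only known through a Taylor formula for `F`;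
polarizing this formula (`IsSecondLinFunDeriv.tendsto_slope_dirac`) recovers the derivative of `δF`
along segments of measures, and `IsSecondLinFunDeriv.norm_increment_le` integrates it. -/

open MeasureTheory Set Filter Topology

noncomputable section

/-! ### Short-time estimates for nonlocal differential inequalities. -/

namespace MFTC

/-- A function on a compact interval with closed sublevel sets, satisfying a Harnack-type
inequality on every subinterval on which it is bounded, is bounded. -/
theorem exists_bound_of_closed_sublevel {n : ℝ → ℝ} {a b κ : ℝ}
    (hcl : ∀ R, IsClosed {s | s ∈ Icc a b ∧ n s ≤ R})
    (hH : ∀ s₁ s₂, a ≤ s₁ → s₂ ≤ b → (∃ R, ∀ s ∈ Icc s₁ s₂, n s ≤ R) →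
      ∀ s ∈ Icc s₁ s₂, ∀ s' ∈ Icc s₁ s₂, n s ≤ 2 * n s' + κ) :
    ∃ R, ∀ s ∈ Icc a b, n s ≤ R := by
  -- points near which `n` is bounded
  let G : Set ℝ := {s | ∃ R, ∀ᶠ r in 𝓝[Icc a b] s, n r ≤ R}
  have hcomp : ∀ c d, Icc c d ⊆ Icc a b → Icc c d ⊆ G → ∃ R, ∀ s ∈ Icc c d, n s ≤ R := by
    intro c d hcd hG
    refine isCompact_Icc.induction_on (p := fun S => ∃ R, ∀ s ∈ S, n s ≤ R) ⟨0, by simp⟩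
      (fun S S' hSS ⟨R, hR⟩ => ⟨R, fun s hs => hR s (hSS hs)⟩) ?_ ?_
    · rintro S S' ⟨R, hR⟩ ⟨R', hR'⟩
      refine ⟨max R R', ?_⟩
      rintro s (hs | hs)
      · exact (hR s hs).trans (le_max_left _ _)
      · exact (hR' s hs).trans (le_max_right _ _)
    · intro s hs
      obtain ⟨R, hR⟩ := hG hs
      exact ⟨{r | n r ≤ R}, nhdsWithin_mono _ hcd hR, R, fun r hr => hr⟩
  let F : Set ℝ := Icc a b \ G
  have hFcl : IsClosed F := by
    rw [← isOpen_compl_iff, isOpen_iff_mem_nhds]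
    intro s hs
    by_cases hsI : s ∈ Icc a b
    · have hsG : s ∈ G := by by_contra h; exact hs ⟨hsI, h⟩
      obtain ⟨R, hR⟩ := hsG
      rw [← eventually_eventually_nhdsWithin, eventually_nhdsWithin_iff] at hR
      filter_upwards [hR] with r hr hrF
      exact hrF.2 ⟨R, hr hrF.1⟩
    · filter_upwards [isClosed_Icc.isOpen_compl.mem_nhds hsI] with r hr hrF
      exact hr hrF.1
  have hFe : F = ∅ := by
    by_contra hne
    have hne' : F.Nonempty := nonempty_iff_ne_empty.2 hne
    have : Nonempty F := hne'.to_subtype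
    have : CompleteSpace F := hFcl.completeSpace_coe
    -- Baire's theorem on the closed set `F` of bad points: one of the closed sublevel sets `{n ≤
    -- k}` contains a relative neighbourhood of some `s₀` in `F`. It remains to bound `n` near `s₀`
    -- off `F`, which contradicts the choice of `s₀`.
    obtain ⟨k, ⟨s₀, hs₀⟩⟩ := nonempty_interior_of_iUnion_of_closed (X := F)
      (f := fun k : ℕ => {s : F | n s ≤ k})
      (fun k => by
        have := (hcl k).preimage (continuous_subtype_val (p := (· ∈ F)))
        convert this using 1
        ext s
        exact ⟨fun h => ⟨s.2.1, h⟩, fun h => h.2⟩)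
      (eq_univ_of_forall fun s => mem_iUnion.2 (exists_nat_ge (n s)))
    rw [mem_interior_iff_mem_nhds, Metric.mem_nhds_iff] at hs₀
    obtain ⟨r, hr, hball⟩ := hs₀
    have hk : ∀ s ∈ F, |s - s₀| < r → n s ≤ k := fun s hs hsr =>
      hball (show (⟨s, hs⟩ : F) ∈ Metric.ball s₀ r by
        rw [Metric.mem_ball, Subtype.dist_eq, Real.dist_eq]; exact hsr)
    refine s₀.2.2 ⟨max (k : ℝ) (2 * k + κ), ?_⟩
    rw [eventually_nhdsWithin_iff]
    filter_upwards [Metric.ball_mem_nhds (s₀ : ℝ) hr] with s hsr hsI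
    rw [Metric.mem_ball, Real.dist_eq, abs_lt] at hsr
    by_cases hsF : s ∈ F
    · exact (hk s hsF (abs_lt.2 hsr)).trans (le_max_left _ _)
    refine le_trans ?_ (le_max_right _ _)
    -- A good point `s` is compared with the first bad point `c` met on the way to `s₀`, where `n c
    -- ≤ k` is known.
    rcases le_total s (s₀ : ℝ) with hle | hle
    · have hcK : IsCompact (F ∩ Icc s s₀) := isCompact_Icc.inter_left hFcl
      have hcN : (F ∩ Icc s s₀).Nonempty := ⟨s₀, s₀.2, hle, le_rfl⟩
      obtain ⟨c, ⟨hcF, hsc, hcs⟩, hcmin⟩ := hcK.exists_isLeast hcN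
      have hloc : ∀ d, d < c → ∃ R, ∀ r ∈ Icc s d, n r ≤ R := fun d hd =>
        hcomp s d (Icc_subset_Icc hsI.1 (hd.le.trans hcF.1.2)) fun r hr => by
          by_contra h
          exact absurd (hcmin ⟨⟨⟨hsI.1.trans hr.1, hr.2.trans (hd.le.trans hcF.1.2)⟩, h⟩, hr.1,
            hr.2.trans (hd.le.trans hcs)⟩) (not_le.2 (hr.2.trans_lt hd))
      -- Compactness bounds `n` only on intervals that stop before `c`, with no uniformity. The
      -- Harnack inequality against the fixed point `s` makes the bound independent of the endpoint,
      -- so it extends up to `c`.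
      have hbd : ∃ R, ∀ r ∈ Icc s c, n r ≤ R := by
        refine ⟨max (n c) (2 * n s + κ), fun r hr => ?_⟩
        rcases hr.2.eq_or_lt with rfl | hlt
        · exact le_max_left _ _
        · exact (hH s r hsI.1 (hr.2.trans hcF.1.2) (hloc r hlt) r ⟨hr.1, le_rfl⟩ s
            ⟨le_rfl, hr.1⟩).trans (le_max_right _ _)
      have h1 := hH s c hsI.1 hcF.1.2 hbd s ⟨le_rfl, hsc⟩ c ⟨hsc, le_rfl⟩
      have h2 := hk c hcF (abs_lt.2 ⟨by linarith, by linarith⟩)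
      linarith
    · have hcK : IsCompact (F ∩ Icc s₀ s) := isCompact_Icc.inter_left hFcl
      have hcN : (F ∩ Icc (s₀ : ℝ) s).Nonempty := ⟨s₀, s₀.2, le_rfl, hle⟩
      obtain ⟨c, ⟨hcF, hsc, hcs⟩, hcmax⟩ := hcK.exists_isGreatest hcN
      have hloc : ∀ d, c < d → ∃ R, ∀ r ∈ Icc d s, n r ≤ R := fun d hd =>
        hcomp d s (Icc_subset_Icc (hcF.1.1.trans hd.le) hsI.2) fun r hr => by
          by_contra h
          exact absurd (hcmax ⟨⟨⟨(hcF.1.1.trans hd.le).trans hr.1, hr.2.trans hsI.2⟩, h⟩,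
            (hsc.trans hd.le).trans hr.1, hr.2⟩) (not_le.2 (hd.trans_le hr.1))
      have hbd : ∃ R, ∀ r ∈ Icc c s, n r ≤ R := by
        refine ⟨max (n c) (2 * n s + κ), fun r hr => ?_⟩
        rcases hr.1.eq_or_lt with rfl | hlt
        · exact le_max_left _ _
        · exact (hH r s (hcF.1.1.trans hr.1) hsI.2 (hloc r hlt) r ⟨le_rfl, hr.2⟩ s
            ⟨hr.2, le_rfl⟩).trans (le_max_right _ _)
      have h1 := hH c s hcF.1.1 hsI.2 hbd s ⟨hcs, le_rfl⟩ c ⟨le_rfl, hcs⟩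
      have h2 := hk c hcF (abs_lt.2 ⟨by linarith, by linarith⟩)
      linarith
  exact hcomp a b le_rfl fun s hs => by
    by_contra h
    exact (hFe ▸ (⟨hs, h⟩ : s ∈ F) : s ∈ (∅ : Set ℝ))

section NonlocalODE

variable {Ω E : Type*} [MeasurableSpace Ω] [NormedAddCommGroup E]
  {m : Measure Ω}

/-- Fatou: the sublevel sets of `s ↦ ∫ ‖U s‖` are closed if `U` is pointwise continuous. -/
theorem isClosed_sublevel_integral_norm {U : ℝ → Ω → E} {a b : ℝ}
    (hint : ∀ s ∈ Icc a b, Integrable (U s) m)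
    (hcont : ∀ x, ContinuousOn (fun s => U s x) (Icc a b)) (R : ℝ) :
    IsClosed {s | s ∈ Icc a b ∧ ∫ x, ‖U s x‖ ∂m ≤ R} := by
  refine IsSeqClosed.isClosed fun u s hu hus => ?_
  have hs : s ∈ Icc a b := isClosed_Icc.mem_of_tendsto hus (Eventually.of_forall fun k => (hu k).1)
  have hR : 0 ≤ R := (integral_nonneg fun x => norm_nonneg _).trans (hu 0).2
  refine ⟨hs, ?_⟩
  have key : ∫⁻ x, ‖U s x‖ₑ ∂m ≤ ENNReal.ofReal R := by
    have hlim : ∀ x, Tendsto (fun k => ‖U (u k) x‖ₑ) atTop (𝓝 ‖U s x‖ₑ) := fun x =>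
      (((hcont x) s hs).tendsto.comp (tendsto_nhdsWithin_iff.2
        ⟨hus, Eventually.of_forall fun k => (hu k).1⟩)).enorm
    calc ∫⁻ x, ‖U s x‖ₑ ∂m = ∫⁻ x, liminf (fun k => ‖U (u k) x‖ₑ) atTop ∂m :=
          lintegral_congr fun x => (hlim x).liminf_eq.symm
      _ ≤ liminf (fun k => ∫⁻ x, ‖U (u k) x‖ₑ ∂m) atTop :=
          lintegral_liminf_le' fun k => (hint _ (hu k).1).1.enorm
      _ ≤ ENNReal.ofReal R := by
          refine liminf_le_of_frequently_le' (Frequently.of_forall fun k => ?_)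
          rw [← ofReal_integral_norm_eq_lintegral_enorm (hint _ (hu k).1)]
          exact ENNReal.ofReal_le_ofReal (hu k).2
  rw [← ofReal_integral_norm_eq_lintegral_enorm (hint _ hs)] at key
  exact (ENNReal.ofReal_le_ofReal_iff hR).1 key

/-- A priori estimate for nonlocal differential inequalities on short intervals. -/
theorem norm_sub_le_of_nonlocal_bound [NormedSpace ℝ E] [IsProbabilityMeasure m] {U U' : ℝ → Ω → E} {a b C κ : ℝ}
    (hC : 0 ≤ C) (hκ : 0 ≤ κ) (hshort : (b - a) * C ≤ 1 / 8)
    (hint : ∀ s ∈ Icc a b, Integrable (U s) m)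
    (hder : ∀ s ∈ Icc a b, ∀ x, HasDerivWithinAt (fun r => U r x) (U' s x) (Icc a b) s)
    (hbd : ∀ s ∈ Icc a b, ∀ x, ‖U' s x‖ ≤ C * (κ + ‖U s x‖ + ∫ y, ‖U s y‖ ∂m)) :
    ∀ s ∈ Icc a b, ∀ s' ∈ Icc a b, ∀ x,
      ‖U s x - U s' x‖ ≤ 4 * ((b - a) * C) * (κ + ‖U s' x‖ + ∫ y, ‖U s' y‖ ∂m) := by
  set n : ℝ → ℝ := fun s => ∫ y, ‖U s y‖ ∂m with hn
  have hn0 : ∀ s, 0 ≤ n s := fun s => integral_nonneg fun x => norm_nonneg _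
  have hcont : ∀ x, ContinuousOn (fun s => U s x) (Icc a b) := fun x s hs =>
    (hder s hs x).continuousWithinAt
  set δ := (b - a) * C with hδ
  -- With the mean bounded by `R`, the inequality is local in `x`: the mean value inequality bounds
  -- the oscillation by the maximum of `|U(x)|`, which is absorbed since `δ ≤ 1/8`; `8/7 = 1/(1 -
  -- 1/8)`.
  have loc : ∀ s₁ s₂ R, a ≤ s₁ → s₂ ≤ b → (∀ s ∈ Icc s₁ s₂, n s ≤ R) →
      ∀ s ∈ Icc s₁ s₂, ∀ s' ∈ Icc s₁ s₂, ∀ x,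
        ‖U s x - U s' x‖ ≤ 8 / 7 * δ * (κ + ‖U s' x‖ + R) := by
    intro s₁ s₂ R h1 h2 hR s hs s' hs' x
    have hsub : Icc s₁ s₂ ⊆ Icc a b := Icc_subset_Icc h1 h2
    have hab : 0 ≤ b - a := by linarith [hs.1, hs.2]
    have hδ0 : 0 ≤ δ := mul_nonneg hab hC
    have hR0 : 0 ≤ R := (hn0 s).trans (hR s hs)
    obtain ⟨r, hr, hmax⟩ := isCompact_Icc.exists_isMaxOn ⟨s, hs⟩ ((hcont x).mono hsub).norm
    have hS : ∀ q ∈ Icc s₁ s₂, ‖U q x‖ ≤ ‖U r x‖ := fun q hq => hmax hq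
    have mv : ∀ q ∈ Icc s₁ s₂, ‖U q x - U s' x‖ ≤ δ * (κ + ‖U r x‖ + R) := by
      intro q hq
      have := (convex_Icc s₁ s₂).norm_image_sub_le_of_norm_hasDerivWithin_le
        (f := fun q => U q x) (f' := fun q => U' q x) (C := C * (κ + ‖U r x‖ + R))
        (fun q hq => (hder q (hsub hq) x).mono hsub)
        (fun q hq => (hbd q (hsub hq) x).trans (by
          gcongr
          · exact hS q hq
          · exact hR q hq)) hs' hq
      refine this.trans ?_
      have hqs : ‖q - s'‖ ≤ b - a := by
        rw [Real.norm_eq_abs, abs_le]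
        constructor <;> linarith [hq.1, hq.2, hs'.1, hs'.2]
      calc C * (κ + ‖U r x‖ + R) * ‖q - s'‖ ≤ C * (κ + ‖U r x‖ + R) * (b - a) := by gcongr
        _ = δ * (κ + ‖U r x‖ + R) := by rw [hδ]; ring
    have hr' : ‖U r x‖ ≤ 8 / 7 * ‖U s' x‖ + 1 / 7 * (κ + R) := by
      have := mv r hr
      have h3 : ‖U r x‖ ≤ ‖U s' x‖ + ‖U r x - U s' x‖ := by
        simpa using norm_add_le (U s' x) (U r x - U s' x)
      have h4 : δ * (κ + ‖U r x‖ + R) ≤ 1 / 8 * (κ + ‖U r x‖ + R) := by gcongr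
      linarith
    refine (mv s hs).trans ?_
    rw [show 8 / 7 * δ * (κ + ‖U s' x‖ + R) = δ * (8 / 7 * (κ + ‖U s' x‖ + R)) by ring]
    gcongr
    linarith
  have harnack : ∀ s₁ s₂, a ≤ s₁ → s₂ ≤ b → (∃ R, ∀ s ∈ Icc s₁ s₂, n s ≤ R) →
      ∀ s ∈ Icc s₁ s₂, ∀ s' ∈ Icc s₁ s₂, n s ≤ 4 / 3 * n s' + 1 / 6 * κ := by
    intro s₁ s₂ h1 h2 ⟨R₀, hR₀⟩ s hs s' hs'
    have hsub : Icc s₁ s₂ ⊆ Icc a b := Icc_subset_Icc h1 h2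
    have hab : 0 ≤ b - a := by linarith [hs.1, hs.2]
    have hδ0 : 0 ≤ δ := mul_nonneg hab hC
    set R := sSup (n '' Icc s₁ s₂) with hRdef
    have hbdd : BddAbove (n '' Icc s₁ s₂) := ⟨R₀, by rintro _ ⟨q, hq, rfl⟩; exact hR₀ q hq⟩
    have hR : ∀ q ∈ Icc s₁ s₂, n q ≤ R := fun q hq => le_csSup hbdd ⟨q, hq, rfl⟩
    have hR0 : 0 ≤ R := (hn0 s).trans (hR s hs)
    have hstep : ∀ q ∈ Icc s₁ s₂, n q ≤ 8 / 7 * n s' + 1 / 7 * (κ + R) := by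
      intro q hq
      have hpt : ∀ x, ‖U q x‖ ≤ 8 / 7 * ‖U s' x‖ + 1 / 7 * (κ + R) := by
        intro x
        have h3 : ‖U q x‖ ≤ ‖U s' x‖ + ‖U q x - U s' x‖ := by
          simpa using norm_add_le (U s' x) (U q x - U s' x)
        have h4 := loc s₁ s₂ R h1 h2 hR q hq s' hs' x
        have h5 : 8 / 7 * δ * (κ + ‖U s' x‖ + R) ≤ 8 / 7 * (1 / 8) * (κ + ‖U s' x‖ + R) := by
          gcongr
        linarith
      have hi := (hint s' (hsub hs')).norm
      calc n q ≤ ∫ x, (8 / 7 * ‖U s' x‖ + 1 / 7 * (κ + R)) ∂m :=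
            integral_mono (hint q (hsub hq)).norm ((hi.const_mul _).add (integrable_const _)) hpt
        _ = 8 / 7 * n s' + 1 / 7 * (κ + R) := by
            rw [integral_add (hi.const_mul _) (integrable_const _), integral_const_mul]
            simp [hn]
    -- Absorbing `R / 7` on the left is legitimate only because the supremum `R` is finite; hence
    -- the boundedness hypothesis on the subinterval.
    have hRle : R ≤ 8 / 7 * n s' + 1 / 7 * (κ + R) :=
      csSup_le ⟨_, s, hs, rfl⟩ (by rintro _ ⟨q, hq, rfl⟩; exact hstep q hq)
    linarith [hR s hs]
  obtain ⟨R, hR⟩ := exists_bound_of_closed_sublevel (n := n) (a := a) (b := b) (κ := κ)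
    (isClosed_sublevel_integral_norm hint hcont)
    (fun s₁ s₂ h1 h2 hR s hs s' hs' => by
      have := harnack s₁ s₂ h1 h2 hR s hs s' hs'
      linarith [hn0 s'])
  intro s hs s' hs' x
  have hab : 0 ≤ b - a := by linarith [hs.1, hs.2]
  have hδ0 : 0 ≤ δ := mul_nonneg hab hC
  have h := loc a b (4 / 3 * n s' + 1 / 6 * κ) le_rfl le_rfl
    (fun q hq => harnack a b le_rfl le_rfl ⟨R, hR⟩ q hq s' hs') s hs s' hs' x
  refine h.trans ?_
  have h0 := hn0 s'
  rw [show 8 / 7 * δ * (κ + ‖U s' x‖ + (4 / 3 * n s' + 1 / 6 * κ)) =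
    δ * (8 / 7 * (κ + ‖U s' x‖ + (4 / 3 * n s' + 1 / 6 * κ))) by ring,
    show 4 * δ * (κ + ‖U s' x‖ + n s') = δ * (4 * (κ + ‖U s' x‖ + n s')) by ring]
  exact mul_le_mul_of_nonneg_left (by linarith [norm_nonneg (U s' x)]) hδ0

end NonlocalODE

end MFTC

/-! ### Integration against measures in `𝒫₂`: quadratic growth, push-forwards and mixtures. -/

namespace MFTC

variable {d a : ℕ}

section Growth

variable {V : Type*} [NormedAddCommGroup V]

theorem P2.memLp (μ : P2 d) : MemLp (fun x : Euc d => x) 2 μ.meas := μ.2.2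

theorem P2.integrable_sq_norm (μ : P2 d) : Integrable (fun x : Euc d => ‖x‖ ^ 2) μ.meas :=
  (memLp_two_iff_integrable_sq_norm (by fun_prop)).1 μ.memLp

theorem P2.integrable_norm (μ : P2 d) : Integrable (fun x : Euc d => ‖x‖) μ.meas :=
  (μ.memLp.integrable one_le_two).norm

theorem P2.norm1_nonneg (μ : P2 d) : 0 ≤ μ.norm1 := integral_nonneg fun _ => norm_nonneg _

theorem P2.norm2_sq (μ : P2 d) : μ.norm2 ^ 2 = ∫ x, ‖x‖ ^ 2 ∂μ.meas :=
  Real.sq_sqrt (integral_nonneg fun _ => by positivity)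

/-- Strongly measurable functions of at most quadratic growth. -/
def QuadGrowth (φ : Euc d → V) : Prop :=
  StronglyMeasurable φ ∧ ∃ c, ∀ x, ‖φ x‖ ≤ c * (1 + ‖x‖ ^ 2)

theorem P2.integrable_quad (μ : P2 d) (c : ℝ) :
    Integrable (fun x : Euc d => c * (1 + ‖x‖ ^ 2)) μ.meas :=
  ((integrable_const _).add μ.integrable_sq_norm).const_mul c

theorem QuadGrowth.integrable {φ : Euc d → V} (h : QuadGrowth φ) (μ : P2 d) :
    Integrable φ μ.meas := by
  obtain ⟨c, hc⟩ := h.2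
  exact (μ.integrable_quad c).mono' h.1.aestronglyMeasurable (Eventually.of_forall hc)

theorem QuadGrowth.of_continuous {φ : Euc d → V} (hφ : Continuous φ) {c : ℝ}
    (hc : ∀ x, ‖φ x‖ ≤ c * (1 + ‖x‖ ^ 2)) : QuadGrowth φ :=
  ⟨hφ.stronglyMeasurable, c, hc⟩

theorem QuadGrowth.sub {φ ψ : Euc d → V} (hφ : QuadGrowth φ) (hψ : QuadGrowth ψ) :
    QuadGrowth fun x => φ x - ψ x := by
  obtain ⟨hφ, c, hc⟩ := hφ
  obtain ⟨hψ, c', hc'⟩ := hψ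
  refine ⟨hφ.sub hψ, c + c', fun x => ?_⟩
  linarith [norm_sub_le (φ x) (ψ x), hc x, hc' x]

theorem le_one_add_sq (y : ℝ) : y ≤ 1 + y ^ 2 := by nlinarith [sq_nonneg (y - 1)]

theorem QuadGrowth.of_lipschitz {φ : Euc d → V} {K : ℝ} (hφ : ∀ x y, ‖φ x - φ y‖ ≤ K * ‖x - y‖) :
    QuadGrowth φ := by
  have hK : ∀ x y, ‖φ x - φ y‖ ≤ |K| * ‖x - y‖ := fun x y =>
    (hφ x y).trans (by gcongr; exact le_abs_self K)
  have hc : Continuous φ := by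
    have : LipschitzWith (Real.toNNReal |K|) φ := LipschitzWith.of_dist_le_mul fun x y => by
      rw [dist_eq_norm, dist_eq_norm, Real.coe_toNNReal _ (abs_nonneg K)]
      exact hK x y
    exact this.continuous
  refine QuadGrowth.of_continuous hc (c := ‖φ 0‖ + |K|) fun x => ?_
  have h1 : ‖φ x‖ ≤ ‖φ 0‖ + ‖φ x - φ 0‖ := by simpa using norm_add_le (φ 0) (φ x - φ 0)
  have h2 := hK x 0
  rw [sub_zero] at h2
  have h3 := le_one_add_sq ‖x‖
  have h4 : |K| * ‖x‖ ≤ |K| * (1 + ‖x‖ ^ 2) := by gcongr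
  have h5 : 0 ≤ ‖φ 0‖ * ‖x‖ ^ 2 := by positivity
  linarith

variable [NormedSpace ℝ V]

theorem P2.norm_integral_le_quad (μ : P2 d) {φ : Euc d → V} {c : ℝ}
    (hc : ∀ x, ‖φ x‖ ≤ c * (1 + ‖x‖ ^ 2)) :
    ‖∫ x, φ x ∂μ.meas‖ ≤ c * (1 + ∫ x, ‖x‖ ^ 2 ∂μ.meas) := by
  refine (norm_integral_le_of_norm_le (μ.integrable_quad c) (Eventually.of_forall hc)).trans_eq ?_
  rw [integral_const_mul, integral_add (integrable_const _) μ.integrable_sq_norm]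
  simp

theorem intDiff_sub (ν₁ ν₂ : P2 d) {φ ψ : Euc d → V} (hφ : QuadGrowth φ) (hψ : QuadGrowth ψ) :
    intDiff ν₁ ν₂ (fun x => φ x - ψ x) = intDiff ν₁ ν₂ φ - intDiff ν₁ ν₂ ψ := by
  simp only [intDiff]
  rw [integral_sub (hφ.integrable _) (hψ.integrable _),
    integral_sub (hφ.integrable _) (hψ.integrable _)]
  abel

/-- Dominated convergence for functions of uniformly quadratic growth. -/
theorem P2.tendsto_integral {ι : Type*} {l : Filter ι} [l.IsCountablyGenerated] (P : P2 d)
    {φ : ι → Euc d → V} {φ₀ : Euc d → V} {c : ℝ} (hm : ∀ i, StronglyMeasurable (φ i))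
    (hc : ∀ i x, ‖φ i x‖ ≤ c * (1 + ‖x‖ ^ 2)) (hlim : ∀ x, Tendsto (fun i => φ i x) l (𝓝 (φ₀ x))) :
    Tendsto (fun i => ∫ x, φ i x ∂P.meas) l (𝓝 (∫ x, φ₀ x ∂P.meas)) :=
  tendsto_integral_filter_of_dominated_convergence _
    (Eventually.of_forall fun i => (hm i).aestronglyMeasurable)
    (Eventually.of_forall fun i => Eventually.of_forall (hc i)) (P.integrable_quad c)
    (Eventually.of_forall hlim)

theorem tendsto_intDiff {ι : Type*} {l : Filter ι} [l.IsCountablyGenerated] (P A : P2 d)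
    {φ : ι → Euc d → V} {φ₀ : Euc d → V} {c : ℝ} (hm : ∀ i, StronglyMeasurable (φ i))
    (hc : ∀ i x, ‖φ i x‖ ≤ c * (1 + ‖x‖ ^ 2)) (hlim : ∀ x, Tendsto (fun i => φ i x) l (𝓝 (φ₀ x))) :
    Tendsto (fun i => intDiff P A (φ i)) l (𝓝 (intDiff P A φ₀)) :=
  (P.tendsto_integral hm hc hlim).sub (A.tendsto_integral hm hc hlim)

end Growth

section Push

variable {V : Type*} [NormedAddCommGroup V] [NormedSpace ℝ V]

theorem P2.push_meas (m : P2 d) {X : Euc d → Euc d} (hX : MemLp X 2 m.meas) :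
    (m.push X).meas = m.meas.map X := by
  have h : m.push X = _ := dif_pos hX
  rw [h]
  rfl

theorem P2.integral_push (m : P2 d) {X : Euc d → Euc d} (hX : MemLp X 2 m.meas) {φ : Euc d → V}
    (hφ : StronglyMeasurable φ) :
    ∫ x, φ x ∂(m.push X).meas = ∫ y, φ (X y) ∂m.meas := by
  rw [m.push_meas hX, integral_map hX.1.aemeasurable hφ.aestronglyMeasurable]

theorem P2.norm1_push (m : P2 d) {X : Euc d → Euc d} (hX : MemLp X 2 m.meas) :
    (m.push X).norm1 = ∫ y, ‖X y‖ ∂m.meas :=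
  m.integral_push hX continuous_norm.stronglyMeasurable

theorem P2.ext_real {μ ν : P2 d} (h : ∀ s, MeasurableSet s → μ.meas.real s = ν.meas.real s) :
    μ = ν :=
  Subtype.ext (Measure.ext fun s hs => (measureReal_eq_measureReal_iff (measure_ne_top μ.meas s)
    (measure_ne_top ν.meas s)).1 (h s hs))

theorem P2.push_id (m : P2 d) : m.push (fun x => x) = m := by
  refine Subtype.ext ?_
  have := m.push_meas (X := fun x => x) m.memLp
  rw [Measure.map_id'] at this
  exact this

theorem P2.push_zero (m : P2 d) : m.push (fun _ => 0) = P2.dirac 0 := by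
  refine Subtype.ext ?_
  have := m.push_meas (X := fun _ => 0) (memLp_const 0)
  rw [Measure.map_const, measure_univ, one_smul] at this
  exact this

/-- Testing the difference of two push-forwards with a Lipschitz function. -/
theorem norm_intDiff_push_le (m : P2 d) {X X' : Euc d → Euc d} (hX : MemLp X 2 m.meas)
    (hX' : MemLp X' 2 m.meas) {φ : Euc d → V} {K : ℝ} (hφ : ∀ x y, ‖φ x - φ y‖ ≤ K * ‖x - y‖) :
    ‖intDiff (m.push X) (m.push X') φ‖ ≤ K * ∫ y, ‖X y - X' y‖ ∂m.meas := by
  have hq := QuadGrowth.of_lipschitz hφ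
  have hi : ∀ {Y : Euc d → Euc d}, MemLp Y 2 m.meas → Integrable (fun y => φ (Y y)) m.meas := by
    intro Y hY
    have := hq.integrable (m.push Y)
    rw [m.push_meas hY] at this
    exact this.comp_aemeasurable hY.1.aemeasurable
  rw [intDiff, m.integral_push hX hq.1, m.integral_push hX' hq.1, ← integral_sub (hi hX) (hi hX'),
    ← integral_const_mul]
  exact norm_integral_le_of_norm_le (((hX.sub hX').integrable one_le_two).norm.const_mul K)
    (Eventually.of_forall fun y => hφ _ _)

end Push

section Mix

theorem P2.mix_real {θ : ℝ} (hθ : θ ∈ Icc (0 : ℝ) 1) (ν₁ ν₂ : P2 d) (s : Set (Euc d)) :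
    (P2.mix θ ν₁ ν₂).meas.real s = θ * ν₁.meas.real s + (1 - θ) * ν₂.meas.real s := by
  have h1 : 0 ≤ 1 - θ := by linarith [hθ.2]
  simp only [P2.mix, P2.meas, projIcc_of_mem zero_le_one hθ, Measure.real, Measure.add_apply,
    Measure.smul_apply, smul_eq_mul]
  have hn1 : ν₁.1 s ≠ ⊤ := measure_ne_top ν₁.meas s
  have hn2 : ν₂.1 s ≠ ⊤ := measure_ne_top ν₂.meas s
  rw [ENNReal.toReal_add (ENNReal.mul_ne_top ENNReal.ofReal_ne_top hn1)
    (ENNReal.mul_ne_top ENNReal.ofReal_ne_top hn2), ENNReal.toReal_mul, ENNReal.toReal_mul,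
    ENNReal.toReal_ofReal hθ.1, ENNReal.toReal_ofReal h1]

theorem P2.mix_projIcc (θ : ℝ) (ν₁ ν₂ : P2 d) :
    P2.mix (projIcc (0 : ℝ) 1 zero_le_one θ) ν₁ ν₂ = P2.mix θ ν₁ ν₂ := by
  refine Subtype.ext ?_
  simp only [P2.mix, projIcc_val]

variable {V : Type*} [NormedAddCommGroup V] [NormedSpace ℝ V]

theorem P2.integral_mix {θ : ℝ} (hθ : θ ∈ Icc (0 : ℝ) 1) (ν₁ ν₂ : P2 d) {φ : Euc d → V}
    (h1 : Integrable φ ν₁.meas) (h2 : Integrable φ ν₂.meas) :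
    ∫ x, φ x ∂(P2.mix θ ν₁ ν₂).meas = θ • ∫ x, φ x ∂ν₁.meas + (1 - θ) • ∫ x, φ x ∂ν₂.meas := by
  have h0 : 0 ≤ 1 - θ := by linarith [hθ.2]
  have : (P2.mix θ ν₁ ν₂).meas = ENNReal.ofReal θ • ν₁.meas + ENNReal.ofReal (1 - θ) • ν₂.meas := by
    simp only [P2.mix, P2.meas, projIcc_of_mem zero_le_one hθ]
  rw [this, integral_add_measure (h1.smul_measure ENNReal.ofReal_ne_top)
    (h2.smul_measure ENNReal.ofReal_ne_top), integral_smul_measure, integral_smul_measure,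
    ENNReal.toReal_ofReal hθ.1, ENNReal.toReal_ofReal h0]

theorem P2.intDiff_mix_right {θ : ℝ} (hθ : θ ∈ Icc (0 : ℝ) 1) (P A : P2 d) {φ : Euc d → V}
    (hφ : QuadGrowth φ) : intDiff (P2.mix θ P A) A φ = θ • intDiff P A φ := by
  rw [intDiff, intDiff, P2.integral_mix hθ _ _ (hφ.integrable _) (hφ.integrable _)]
  module

theorem P2.intDiff_left_mix {θ : ℝ} (hθ : θ ∈ Icc (0 : ℝ) 1) (P A : P2 d) {φ : Euc d → V}
    (hφ : QuadGrowth φ) : intDiff P (P2.mix θ P A) φ = (1 - θ) • intDiff P A φ := by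
  rw [intDiff, intDiff, P2.integral_mix hθ _ _ (hφ.integrable _) (hφ.integrable _)]
  module

theorem P2.norm1_mix {θ : ℝ} (hθ : θ ∈ Icc (0 : ℝ) 1) (ν₁ ν₂ : P2 d) :
    (P2.mix θ ν₁ ν₂).norm1 = θ * ν₁.norm1 + (1 - θ) * ν₂.norm1 := by
  have := P2.integral_mix hθ ν₁ ν₂ ν₁.integrable_norm ν₂.integrable_norm
  simpa [P2.norm1] using this

theorem P2.norm2_mix_le (θ : ℝ) (ν₁ ν₂ : P2 d) {R : ℝ} (h1 : ν₁.norm2 ≤ R) (h2 : ν₂.norm2 ≤ R) :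
    (P2.mix θ ν₁ ν₂).norm2 ≤ R := by
  rw [← P2.mix_projIcc]
  set k := (projIcc (0 : ℝ) 1 zero_le_one θ : ℝ)
  have hk : k ∈ Icc (0 : ℝ) 1 := (projIcc (0 : ℝ) 1 zero_le_one θ).2
  have hR : 0 ≤ R := (Real.sqrt_nonneg _).trans h1
  have := P2.integral_mix hk ν₁ ν₂ ν₁.integrable_sq_norm ν₂.integrable_sq_norm
  refine Real.sqrt_le_iff.2 ⟨hR, ?_⟩
  rw [this, ← P2.norm2_sq, ← P2.norm2_sq, smul_eq_mul, smul_eq_mul]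
  have e1 : ν₁.norm2 ^ 2 ≤ R ^ 2 := pow_le_pow_left₀ (Real.sqrt_nonneg _) h1 2
  have e2 : ν₂.norm2 ^ 2 ≤ R ^ 2 := pow_le_pow_left₀ (Real.sqrt_nonneg _) h2 2
  nlinarith [hk.1, hk.2]

/-- Two measures that differ by parts of small mass are `W₂`-close. -/
theorem W2_le_of_common_part {μ ν P Q P' Q' : P2 d} {R : Measure (Euc d)}
    {r r' : ℝ} (hr : 0 ≤ r) (hr' : 0 ≤ r')
    (hμ : μ.meas = R + ENNReal.ofReal r • P.meas + ENNReal.ofReal r' • P'.meas)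
    (hν : ν.meas = R + ENNReal.ofReal r • Q.meas + ENNReal.ofReal r' • Q'.meas) :
    W2 μ ν ≤ Real.sqrt (r * (∫⁻ q, ‖q.1 - q.2‖ₑ ^ 2 ∂(P.meas.prod Q.meas)).toReal +
      r' * (∫⁻ q, ‖q.1 - q.2‖ₑ ^ 2 ∂(P'.meas.prod Q'.meas)).toReal) := by
  have hfin : ∀ P Q : P2 d, ∫⁻ q, ‖q.1 - q.2‖ₑ ^ 2 ∂(P.meas.prod Q.meas) ≠ ⊤ := by
    intro P Q
    have h1 : MemLp (fun q : Euc d × Euc d => q.1 - q.2) 2 (P.meas.prod Q.meas) := by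
      refine MemLp.sub ?_ ?_
      · exact P.memLp.comp_measurePreserving measurePreserving_fst
      · exact Q.memLp.comp_measurePreserving measurePreserving_snd
    have h2 := (memLp_two_iff_integrable_sq_norm h1.1).1 h1
    have h3 := h2.2
    rw [hasFiniteIntegral_iff_enorm] at h3
    simpa [enorm_pow] using h3.ne
  -- The common part stays in place at no cost; only the pieces of mass `r` and `r'` are
  -- transported, by product couplings.
  let π : Measure (Euc d × Euc d) := R.map (fun x => (x, x)) +
    ENNReal.ofReal r • P.meas.prod Q.meas + ENNReal.ofReal r' • P'.meas.prod Q'.meas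
  have hdiag : Measurable fun x : Euc d => (x, x) := by fun_prop
  have hπ : π ∈ couplings μ ν := by
    constructor
    · simp only [π]
      rw [hμ, Measure.map_add _ _ measurable_fst, Measure.map_add _ _ measurable_fst,
        Measure.map_smul, Measure.map_smul, Measure.map_map measurable_fst hdiag,
        Measure.map_fst_prod, Measure.map_fst_prod]
      simp [Function.comp_def]
    · simp only [π]
      rw [hν, Measure.map_add _ _ measurable_snd, Measure.map_add _ _ measurable_snd,
        Measure.map_smul, Measure.map_smul, Measure.map_map measurable_snd hdiag,
        Measure.map_snd_prod, Measure.map_snd_prod]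
      simp [Function.comp_def]
  have hcost : ∫⁻ q, ‖q.1 - q.2‖ₑ ^ 2 ∂π =
      ENNReal.ofReal r * ∫⁻ q, ‖q.1 - q.2‖ₑ ^ 2 ∂(P.meas.prod Q.meas) +
      ENNReal.ofReal r' * ∫⁻ q, ‖q.1 - q.2‖ₑ ^ 2 ∂(P'.meas.prod Q'.meas) := by
    have hmeas : Measurable fun q : Euc d × Euc d => ‖q.1 - q.2‖ₑ ^ 2 := by fun_prop
    simp only [π]
    rw [lintegral_add_measure, lintegral_add_measure, lintegral_smul_measure,
      lintegral_smul_measure, lintegral_map hmeas hdiag]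
    simp
  unfold W2
  refine Real.sqrt_le_sqrt ?_
  have hle : (⨅ π ∈ couplings μ ν, ∫⁻ q, ‖q.1 - q.2‖ₑ ^ 2 ∂π) ≤ ∫⁻ q, ‖q.1 - q.2‖ₑ ^ 2 ∂π :=
    iInf₂_le π hπ
  rw [hcost] at hle
  have h1 := ENNReal.mul_ne_top (ENNReal.ofReal_ne_top (r := r)) (hfin P Q)
  have h2 := ENNReal.mul_ne_top (ENNReal.ofReal_ne_top (r := r')) (hfin P' Q')
  refine (ENNReal.toReal_mono (ENNReal.add_ne_top.2 ⟨h1, h2⟩) hle).trans_eq ?_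
  rw [ENNReal.toReal_add h1 h2, ENNReal.toReal_mul, ENNReal.toReal_mul, ENNReal.toReal_ofReal hr,
    ENNReal.toReal_ofReal hr']

theorem P2.tendsto_nhds_of_W2 {ι : Type*} {l : Filter ι} {μ : ι → P2 d} {A : P2 d}
    (h : Tendsto (fun i => W2 (μ i) A) l (𝓝 0)) : Tendsto μ l (𝓝 A) := by
  intro U hU
  obtain ⟨t, htU, ht, hA⟩ := mem_nhds_iff.1 hU
  obtain ⟨r, hr, hball⟩ := ht A hA
  refine (h.eventually (gt_mem_nhds hr)).mono fun i hi => ?_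
  exact htU (hball _ hi)

theorem W2_nonneg (μ ν : P2 d) : 0 ≤ W2 μ ν := Real.sqrt_nonneg _

theorem P2.meas_eq_of_real {μ A P P' : P2 d} {r r' : ℝ} (hr : 0 ≤ r) (hr' : 0 ≤ r')
    (hrr : r + r' ≤ 1)
    (h : ∀ s, MeasurableSet s → μ.meas.real s =
      (1 - r - r') * A.meas.real s + r * P.meas.real s + r' * P'.meas.real s) :
    μ.meas = ENNReal.ofReal (1 - r - r') • A.meas + ENNReal.ofReal r • P.meas +
      ENNReal.ofReal r' • P'.meas := by
  refine Measure.ext fun s hs => ?_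
  have h0 : 0 ≤ 1 - r - r' := by linarith
  rw [← ofReal_measureReal (μ := μ.meas), h s hs, ENNReal.ofReal_add (by positivity) (by positivity),
    ENNReal.ofReal_add (by positivity) (by positivity), ENNReal.ofReal_mul h0,
    ENNReal.ofReal_mul hr, ENNReal.ofReal_mul hr', ofReal_measureReal, ofReal_measureReal,
    ofReal_measureReal]
  rfl

/-- Mixtures `(1 - r - r') A + r P + r' P'` converge to `A` as the weights `r, r'` tend to `0`. -/
theorem P2.tendsto_of_weights {ι : Type*} {l : Filter ι} {μ : ι → P2 d} {A P P' : P2 d}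
    {r r' : ι → ℝ} (hw : ∀ᶠ i in l, 0 ≤ r i ∧ 0 ≤ r' i ∧ r i + r' i ≤ 1 ∧
      ∀ s, MeasurableSet s → (μ i).meas.real s =
        (1 - r i - r' i) * A.meas.real s + r i * P.meas.real s + r' i * P'.meas.real s)
    (hr : Tendsto r l (𝓝 0)) (hr' : Tendsto r' l (𝓝 0)) : Tendsto μ l (𝓝 A) := by
  refine P2.tendsto_nhds_of_W2 ?_
  refine squeeze_zero' (Eventually.of_forall fun i => W2_nonneg _ _) (hw.mono fun i hi => ?_)
    (g := fun i => Real.sqrt (r i * (∫⁻ q, ‖q.1 - q.2‖ₑ ^ 2 ∂(P.meas.prod A.meas)).toReal +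
      r' i * (∫⁻ q, ‖q.1 - q.2‖ₑ ^ 2 ∂(P'.meas.prod A.meas)).toReal)) ?_
  · obtain ⟨h1, h2, h3, h4⟩ := hi
    refine W2_le_of_common_part h1 h2 (P2.meas_eq_of_real h1 h2 h3 h4)
      (P2.meas_eq_of_real h1 h2 h3 fun s _ => by ring)
  · have := ((hr.mul_const (∫⁻ q, ‖q.1 - q.2‖ₑ ^ 2 ∂(P.meas.prod A.meas)).toReal).add
      (hr'.mul_const (∫⁻ q, ‖q.1 - q.2‖ₑ ^ 2 ∂(P'.meas.prod A.meas)).toReal)).sqrt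
    simpa using this

theorem P2.tendsto_mix (ν₁ ν₂ : P2 d) {θ₀ : ℝ} (h0 : θ₀ ∈ Icc (0 : ℝ) 1) :
    Tendsto (fun θ => P2.mix θ ν₁ ν₂) (𝓝[Icc 0 1] θ₀) (𝓝 (P2.mix θ₀ ν₁ ν₂)) := by
  -- Moving `θ` up from `θ₀` mixes in some `ν₁`, moving it down some `ν₂`; at each `θ` at least one
  -- of the two weights vanishes. At the endpoints a denominator is zero, but then the numerator is
  -- zero for all `θ` in `[0,1]`.
  refine P2.tendsto_of_weights (P := ν₁) (P' := ν₂) (r := fun θ => max (θ - θ₀) 0 / (1 - θ₀))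
    (r' := fun θ => max (θ₀ - θ) 0 / θ₀) ?_ ?_ ?_
  · filter_upwards [self_mem_nhdsWithin] with θ hθ
    rcases le_total θ θ₀ with h | h
    · rw [max_eq_right (by linarith), max_eq_left (by linarith)]
      rcases h0.1.eq_or_lt with h00 | h00
      · have : θ = θ₀ := le_antisymm h (h00 ▸ hθ.1)
        subst this
        simp
      refine ⟨by simp, div_nonneg (by linarith) h00.le, ?_, fun s _ => ?_⟩
      · rw [zero_div, zero_add, div_le_one h00]; linarith [hθ.1]
      · rw [P2.mix_real hθ, P2.mix_real h0]
        field_simp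
        ring
    · rw [max_eq_left (by linarith), max_eq_right (by linarith)]
      rcases h0.2.eq_or_lt with h11 | h11
      · have : θ = θ₀ := le_antisymm (h11 ▸ hθ.2) h
        subst this
        simp
      have h11' : 0 < 1 - θ₀ := by linarith
      refine ⟨div_nonneg (by linarith) h11'.le, by simp, ?_, fun s _ => ?_⟩
      · rw [zero_div, add_zero, div_le_one h11']; linarith [hθ.2]
      · rw [P2.mix_real hθ, P2.mix_real h0]
        field_simp
        ring
  · have : Continuous fun θ => max (θ - θ₀) 0 / (1 - θ₀) := by fun_prop
    simpa using (this.tendsto θ₀).mono_left nhdsWithin_le_nhds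
  · have : Continuous fun θ => max (θ₀ - θ) 0 / θ₀ := by fun_prop
    simpa using (this.tendsto θ₀).mono_left nhdsWithin_le_nhds

theorem P2.continuous_mix (ν₁ ν₂ : P2 d) : Continuous fun θ => P2.mix θ ν₁ ν₂ := by
  have h1 : ContinuousOn (fun θ => P2.mix θ ν₁ ν₂) (Icc 0 1) := fun θ hθ => P2.tendsto_mix ν₁ ν₂ hθ
  have h2 := (continuousOn_iff_continuous_domRestrict.1 h1).comp
    (continuous_projIcc (a := (0 : ℝ)) (b := 1) (h := zero_le_one))
  refine h2.congr fun θ => ?_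
  exact P2.mix_projIcc θ ν₁ ν₂

end Mix

end MFTC

/-! ### Linear functional derivatives: first order increments and second order Taylor expansion. -/

namespace MFTC

variable {d a : ℕ} {V : Type*} [NormedAddCommGroup V] [NormedSpace ℝ V]

section FirstOrder

variable {F G : P2 d → V} {δF δG : P2 d → Euc d → V}

theorem BddOnBdd.exists_nonneg {c : P2 d → ℝ} (hc : BddOnBdd c) (R : ℝ) :
    ∃ C, 0 ≤ C ∧ ∀ μ, μ.norm2 ≤ R → c μ ≤ C := by
  obtain ⟨C, hC⟩ := hc.2 R
  exact ⟨max C 0, le_max_right _ _, fun μ hμ => (hC μ hμ).trans (le_max_left _ _)⟩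

theorem IsLinFunDeriv.continuous_right (h : IsLinFunDeriv F δF) (μ : P2 d) : Continuous (δF μ) :=
  h.cont.comp (Continuous.prodMk_right μ)

theorem IsLinFunDeriv.bound (h : IsLinFunDeriv F δF) (R : ℝ) :
    ∃ C, 0 ≤ C ∧ ∀ μ, μ.norm2 ≤ R → ∀ x, ‖δF μ x‖ ≤ C * (1 + ‖x‖ ^ 2) := by
  obtain ⟨c, hc, hb⟩ := h.growth
  obtain ⟨C, hC0, hC⟩ := hc.exists_nonneg R
  refine ⟨C, hC0, fun μ hμ x => (hb μ x).trans ?_⟩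
  gcongr
  exact hC μ hμ

theorem IsLinFunDeriv.quadGrowth (h : IsLinFunDeriv F δF) (μ : P2 d) : QuadGrowth (δF μ) := by
  obtain ⟨C, -, hC⟩ := h.bound μ.norm2
  exact QuadGrowth.of_continuous (h.continuous_right μ) (hC μ le_rfl)

theorem IsLinFunDeriv.continuous_intDiff (h : IsLinFunDeriv F δF) (ν₁ ν₂ : P2 d) :
    Continuous fun θ => intDiff ν₁ ν₂ (δF (P2.mix θ ν₁ ν₂)) := by
  obtain ⟨C, -, hC⟩ := h.bound (max ν₁.norm2 ν₂.norm2)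
  refine continuous_iff_continuousAt.2 fun θ₀ => ?_
  refine tendsto_intDiff ν₁ ν₂ (c := C) (fun θ => (h.continuous_right _).stronglyMeasurable)
    (fun θ => hC _ (P2.norm2_mix_le θ _ _ (le_max_left _ _) (le_max_right _ _))) fun x => ?_
  have : Continuous fun θ => δF (P2.mix θ ν₁ ν₂) x :=
    h.cont.comp ((P2.continuous_mix ν₁ ν₂).prodMk continuous_const)
  exact this.tendsto θ₀

/-- If the difference of the linear functional derivatives of `F` and `G` is Lipschitz in space
along the segment joining two push-forwards, then the increments of `F` and `G` are close. -/
theorem norm_increment_sub_le (hF : IsLinFunDeriv F δF) (hG : IsLinFunDeriv G δG) (m : P2 d)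
    {X X' : Euc d → Euc d} (hX : MemLp X 2 m.meas) (hX' : MemLp X' 2 m.meas) {K : ℝ}
    (hK : ∀ θ ∈ Icc (0 : ℝ) 1, ∀ x y,
      ‖(δF (P2.mix θ (m.push X) (m.push X')) x - δG (P2.mix θ (m.push X) (m.push X')) x) -
        (δF (P2.mix θ (m.push X) (m.push X')) y - δG (P2.mix θ (m.push X) (m.push X')) y)‖
        ≤ K * ‖x - y‖) :
    ‖(F (m.push X) - G (m.push X)) - (F (m.push X') - G (m.push X'))‖ ≤
      K * ∫ y, ‖X y - X' y‖ ∂m.meas := by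
  set ν₁ := m.push X
  set ν₂ := m.push X'
  have e : (F ν₁ - G ν₁) - (F ν₂ - G ν₂) = ∫ θ in (0 : ℝ)..1, intDiff ν₁ ν₂
      (fun x => δF (P2.mix θ ν₁ ν₂) x - δG (P2.mix θ ν₁ ν₂) x) := by
    rw [show (F ν₁ - G ν₁) - (F ν₂ - G ν₂) = (F ν₁ - F ν₂) - (G ν₁ - G ν₂) by abel,
      hF.formula ν₁ ν₂, hG.formula ν₁ ν₂, ← intervalIntegral.integral_sub
        ((hF.continuous_intDiff ν₁ ν₂).intervalIntegrable _ _)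
        ((hG.continuous_intDiff ν₁ ν₂).intervalIntegrable _ _)]
    exact intervalIntegral.integral_congr fun θ _ =>
      (intDiff_sub ν₁ ν₂ (hF.quadGrowth _) (hG.quadGrowth _)).symm
  rw [e]
  refine (intervalIntegral.norm_integral_le_of_norm_le_const
    (C := K * ∫ y, ‖X y - X' y‖ ∂m.meas) fun θ hθ => ?_).trans_eq (by simp)
  rw [uIoc_of_le zero_le_one] at hθ
  exact norm_intDiff_push_le m hX hX' (hK θ ⟨hθ.1.le, hθ.2⟩)

/-- Taking `G = 0` in `norm_increment_sub_le` gives the Lipschitz estimate for a single function. -/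
theorem IsLinFunDeriv.zero : IsLinFunDeriv (fun _ : P2 d => (0 : V)) fun _ _ => 0 where
  cont := continuous_const
  growth := ⟨fun _ => 0, ⟨fun _ => le_rfl, fun _ => ⟨0, fun _ _ => le_rfl⟩⟩, by simp⟩
  formula := by simp [intDiff]
  normalized := by simp

theorem IsLinFunDeriv.norm_sub_le (hF : IsLinFunDeriv F δF) (m : P2 d)
    {X X' : Euc d → Euc d} (hX : MemLp X 2 m.meas) (hX' : MemLp X' 2 m.meas) {K : ℝ}
    (hK : ∀ θ ∈ Icc (0 : ℝ) 1, ∀ x y, ‖δF (P2.mix θ (m.push X) (m.push X')) x -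
      δF (P2.mix θ (m.push X) (m.push X')) y‖ ≤ K * ‖x - y‖) :
    ‖F (m.push X) - F (m.push X')‖ ≤ K * ∫ y, ‖X y - X' y‖ ∂m.meas := by
  have := norm_increment_sub_le hF IsLinFunDeriv.zero m hX hX' (K := K) (by simpa using hK)
  simpa using this

end FirstOrder

theorem intDiff_smul (ν₁ ν₂ : P2 d) (c : ℝ) (φ : Euc d → V) :
    intDiff ν₁ ν₂ (fun x => c • φ x) = c • intDiff ν₁ ν₂ φ := by
  rw [intDiff, intDiff, integral_smul, integral_smul, smul_sub]

section SecondOrder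

variable {F : P2 d → V} {δF : P2 d → Euc d → V} {δ2F : P2 d → Euc d → Euc d → V}

/-- The quadratic form `∫∫ φ d(P - A) d(P' - A)`. -/
def dblDiff (P P' A : P2 d) (φ : Euc d → Euc d → V) : V :=
  intDiff P A fun y => intDiff P' A fun x => φ x y

theorem IsSecondLinFunDeriv.continuous_uncurry (h : IsSecondLinFunDeriv F δF δ2F) (μ : P2 d) :
    Continuous fun q : Euc d × Euc d => δ2F μ q.1 q.2 :=
  h.cont.comp (Continuous.prodMk_right μ)

theorem IsSecondLinFunDeriv.bound (h : IsSecondLinFunDeriv F δF δ2F) (R : ℝ) :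
    ∃ C, 0 ≤ C ∧ ∀ μ, μ.norm2 ≤ R → ∀ x y, ‖δ2F μ x y‖ ≤ C * (1 + ‖x‖ ^ 2 + ‖y‖ ^ 2) := by
  obtain ⟨c, hc, hb⟩ := h.growth
  obtain ⟨C, hC0, hC⟩ := hc.exists_nonneg R
  refine ⟨C, hC0, fun μ hμ x y => (hb μ x y).trans ?_⟩
  gcongr
  exact hC μ hμ

theorem IsSecondLinFunDeriv.quadGrowth_left (h : IsSecondLinFunDeriv F δF δ2F) (μ : P2 d)
    (y : Euc d) : QuadGrowth fun x => δ2F μ x y := by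
  obtain ⟨C, hC0, hC⟩ := h.bound μ.norm2
  refine QuadGrowth.of_continuous (c := C * (1 + ‖y‖ ^ 2))
    ((h.continuous_uncurry μ).comp (Continuous.prodMk_left y)) fun x => (hC μ le_rfl x y).trans ?_
  rw [mul_assoc]
  gcongr
  nlinarith [sq_nonneg ‖x‖, sq_nonneg ‖y‖, mul_nonneg (sq_nonneg ‖x‖) (sq_nonneg ‖y‖)]

theorem IsSecondLinFunDeriv.quadGrowth_right (h : IsSecondLinFunDeriv F δF δ2F) (μ : P2 d)
    (x : Euc d) : QuadGrowth fun y => δ2F μ x y := by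
  obtain ⟨C, hC0, hC⟩ := h.bound μ.norm2
  refine QuadGrowth.of_continuous (c := C * (1 + ‖x‖ ^ 2))
    ((h.continuous_uncurry μ).comp (Continuous.prodMk_right x)) fun y => (hC μ le_rfl x y).trans ?_
  rw [mul_assoc]
  gcongr
  nlinarith [sq_nonneg ‖x‖, sq_nonneg ‖y‖, mul_nonneg (sq_nonneg ‖x‖) (sq_nonneg ‖y‖)]

theorem IsSecondLinFunDeriv.stronglyMeasurable_intDiff (h : IsSecondLinFunDeriv F δF δ2F)
    (μ P A : P2 d) : StronglyMeasurable fun y => intDiff P A fun x => δ2F μ x y :=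
  (StronglyMeasurable.integral_prod_left' (h.continuous_uncurry μ).stronglyMeasurable).sub
    (StronglyMeasurable.integral_prod_left' (h.continuous_uncurry μ).stronglyMeasurable)

theorem IsSecondLinFunDeriv.intDiff_bound (h : IsSecondLinFunDeriv F δF δ2F) (P A : P2 d) (R : ℝ) :
    ∃ C, 0 ≤ C ∧ ∀ μ, μ.norm2 ≤ R → ∀ y,
      ‖intDiff P A fun x => δ2F μ x y‖ ≤ C * (1 + ‖y‖ ^ 2) := by
  obtain ⟨C, hC0, hC⟩ := h.bound R
  set p := ∫ x, ‖x‖ ^ 2 ∂P.meas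
  set q := ∫ x, ‖x‖ ^ 2 ∂A.meas
  have hp : 0 ≤ p := integral_nonneg fun _ => by positivity
  have hq : 0 ≤ q := integral_nonneg fun _ => by positivity
  refine ⟨C * (1 + p) + C * (1 + q), by positivity, fun μ hμ y => ?_⟩
  have hb : ∀ x, ‖δ2F μ x y‖ ≤ C * (1 + ‖y‖ ^ 2) * (1 + ‖x‖ ^ 2) := fun x => by
    refine (hC μ hμ x y).trans ?_
    rw [mul_assoc]
    gcongr
    nlinarith [mul_nonneg (sq_nonneg ‖x‖) (sq_nonneg ‖y‖)]
  have h1 := P.norm_integral_le_quad hb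
  have h2 := A.norm_integral_le_quad hb
  refine (norm_sub_le _ _).trans ?_
  linarith

theorem IsSecondLinFunDeriv.quadGrowth_intDiff (h : IsSecondLinFunDeriv F δF δ2F) (μ P A : P2 d) :
    QuadGrowth fun y => intDiff P A fun x => δ2F μ x y := by
  obtain ⟨C, -, hC⟩ := h.intDiff_bound P A μ.norm2
  exact ⟨h.stronglyMeasurable_intDiff μ P A, C, hC μ le_rfl⟩

/-- Dominated convergence in each variable in turn; the bound on the second moments makes the
quadratic growth constant of the second order derivative uniform along the family. -/
theorem IsSecondLinFunDeriv.tendsto_dblDiff (h : IsSecondLinFunDeriv F δF δ2F) {ι : Type*}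
    {l : Filter ι} [l.IsCountablyGenerated] (P P' A : P2 d) {μ : ι → P2 d} {μ₀ : P2 d} {R : ℝ}
    (hR : ∀ i, (μ i).norm2 ≤ R) (hμ : Tendsto μ l (𝓝 μ₀)) :
    Tendsto (fun i => dblDiff P P' A (δ2F (μ i))) l (𝓝 (dblDiff P P' A (δ2F μ₀))) := by
  obtain ⟨C, hC0, hC⟩ := h.bound R
  obtain ⟨C', -, hC'⟩ := h.intDiff_bound P' A R
  refine tendsto_intDiff P A (fun i => h.stronglyMeasurable_intDiff _ _ _)
    (fun i => hC' _ (hR i)) fun y => ?_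
  refine tendsto_intDiff P' A (c := C * (1 + ‖y‖ ^ 2))
    (fun i => (h.quadGrowth_left (μ i) y).1) (fun i x => (hC _ (hR i) x y).trans ?_) fun x => ?_
  · rw [mul_assoc]
    gcongr
    nlinarith [mul_nonneg (sq_nonneg ‖x‖) (sq_nonneg ‖y‖)]
  · have : Continuous fun ν : P2 d => δ2F ν x y :=
      h.cont.comp (Continuous.prodMk_left (x, y))
    exact (this.tendsto μ₀).comp hμ

theorem IsSecondLinFunDeriv.dblDiff_bound (h : IsSecondLinFunDeriv F δF δ2F) (P P' A : P2 d)
    (R : ℝ) : ∃ C, 0 ≤ C ∧ ∀ μ, μ.norm2 ≤ R → ‖dblDiff P P' A (δ2F μ)‖ ≤ C := by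
  obtain ⟨C, hC0, hC⟩ := h.intDiff_bound P' A R
  refine ⟨C * (1 + ∫ x, ‖x‖ ^ 2 ∂P.meas) + C * (1 + ∫ x, ‖x‖ ^ 2 ∂A.meas), ?_, fun μ hμ => ?_⟩
  · have hp : 0 ≤ ∫ x, ‖x‖ ^ 2 ∂P.meas := integral_nonneg fun _ => by positivity
    have hq : 0 ≤ ∫ x, ‖x‖ ^ 2 ∂A.meas := integral_nonneg fun _ => by positivity
    positivity
  · exact (norm_sub_le _ _).trans (add_le_add (P.norm_integral_le_quad (hC μ hμ))
      (A.norm_integral_le_quad (hC μ hμ)))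

theorem IsSecondLinFunDeriv.continuous_dblDiff_mix (h : IsSecondLinFunDeriv F δF δ2F)
    (P P' A B C : P2 d) : Continuous fun k => dblDiff P P' A (δ2F (P2.mix k C B)) :=
  continuous_iff_continuousAt.2 fun k => h.tendsto_dblDiff P P' A
    (fun k => P2.norm2_mix_le k _ _ (le_max_left _ _) (le_max_right _ _))
    ((P2.continuous_mix C B).tendsto k)

/-- Second order Taylor expansion along shrinking segments `[B h, C h]` that converge to `A` and
have the direction `P - A`. -/
theorem IsSecondLinFunDeriv.tendsto_taylor [CompleteSpace V] (h : IsSecondLinFunDeriv F δF δ2F) {A P : P2 d}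
    {B C : ℝ → P2 d} {κ R : ℝ} (hB : ∀ r, (B r).norm2 ≤ R) (hC : ∀ r, (C r).norm2 ≤ R)
    (hdir : ∀ᶠ r in 𝓝[>] (0 : ℝ), ∀ φ : Euc d → V, QuadGrowth φ →
      intDiff (C r) (B r) φ = (κ * r) • intDiff P A φ)
    (hlim : ∀ k ∈ Icc (0 : ℝ) 1, Tendsto (fun r => P2.mix k (C r) (B r)) (𝓝[>] 0) (𝓝 A)) :
    Tendsto (fun r : ℝ => (r ^ 2)⁻¹ • (F (C r) - F (B r) - intDiff (C r) (B r) (δF (B r))))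
      (𝓝[>] 0) (𝓝 ((κ ^ 2 / 2) • dblDiff P P A (δ2F A))) := by
  set q : P2 d → V := fun μ => dblDiff P P A (δ2F μ) with hq
  have hmix : ∀ k r, (P2.mix k (C r) (B r)).norm2 ≤ R := fun k r =>
    P2.norm2_mix_le _ _ _ (hC r) (hB r)
  obtain ⟨K, hK0, hK⟩ := h.dblDiff_bound P P A R
  have hcont : ∀ r, Continuous fun k => q (P2.mix k (C r) (B r)) := fun r =>
    h.continuous_dblDiff_mix _ _ _ _ _
  have hI : Tendsto (fun r => ∫ θ in (0 : ℝ)..1, ∫ l in (0 : ℝ)..1,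
      θ • q (P2.mix (l * θ) (C r) (B r))) (𝓝[>] 0)
      (𝓝 (∫ θ in (0 : ℝ)..1, ∫ l in (0 : ℝ)..1, θ • q A)) := by
    have hbd : ∀ r θ l : ℝ, θ ∈ Ioc (0 : ℝ) 1 → ‖θ • q (P2.mix (l * θ) (C r) (B r))‖ ≤ K := by
      intro r θ l hθ
      rw [norm_smul, Real.norm_eq_abs, abs_of_pos hθ.1]
      calc θ * ‖q (P2.mix (l * θ) (C r) (B r))‖ ≤ 1 * K :=
            mul_le_mul hθ.2 (hK _ (hmix _ _)) (norm_nonneg _) zero_le_one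
        _ = K := one_mul K
    refine intervalIntegral.tendsto_integral_filter_of_dominated_convergence (fun _ => K)
      (Eventually.of_forall fun r => ?_) (Eventually.of_forall fun r => ?_) (by simp) ?_
    · have : Continuous fun θ : ℝ => ∫ l in (0 : ℝ)..1, θ • q (P2.mix (l * θ) (C r) (B r)) := by
        refine intervalIntegral.continuous_parametric_intervalIntegral_of_continuous' ?_ _ _
        exact continuous_fst.smul ((hcont r).comp (continuous_snd.mul continuous_fst))
      exact this.aestronglyMeasurable
    · refine Eventually.of_forall fun θ hθ => ?_
      rw [uIoc_of_le zero_le_one] at hθ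
      exact (intervalIntegral.norm_integral_le_of_norm_le_const
        fun l _ => hbd r θ l hθ).trans_eq (by simp)
    · refine Eventually.of_forall fun θ hθ => ?_
      rw [uIoc_of_le zero_le_one] at hθ
      refine intervalIntegral.tendsto_integral_filter_of_dominated_convergence (fun _ => K)
        (Eventually.of_forall fun r => ?_)
        (Eventually.of_forall fun r => Eventually.of_forall fun l _ => hbd r θ l hθ) (by simp) ?_
      · exact (((hcont r).comp (continuous_mul_const θ)).const_smul θ).aestronglyMeasurable
      · refine Eventually.of_forall fun l hl => ?_
        rw [uIoc_of_le zero_le_one] at hl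
        refine Tendsto.const_smul ?_ θ
        exact h.tendsto_dblDiff P P A (fun r => hmix _ r)
          (hlim _ ⟨mul_nonneg hl.1.le hθ.1.le, mul_le_one₀ hl.2 hθ.1.le hθ.2⟩)
  -- The Taylor coefficient `1/2` is `∫₀¹ θ dθ`.
  have hval : ∫ θ in (0 : ℝ)..1, ∫ l in (0 : ℝ)..1, θ • q A = (1 / 2 : ℝ) • q A := by
    simp only [intervalIntegral.integral_const, sub_zero, one_smul]
    rw [intervalIntegral.integral_smul_const, integral_id]
    norm_num
  rw [hval] at hI
  have := hI.const_smul (κ ^ 2)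
  rw [smul_smul, mul_one_div] at this
  refine this.congr' ?_
  filter_upwards [hdir, self_mem_nhdsWithin] with r hr hr0
  have hr0' : r ≠ 0 := (mem_Ioi.1 hr0).ne'
  have e : ∀ μ, intDiff (C r) (B r) (fun y => intDiff (C r) (B r) fun x => δ2F μ x y) =
      (κ * r) ^ 2 • q μ := by
    intro μ
    rw [hr _ (h.quadGrowth_intDiff μ _ _)]
    have : (fun y => intDiff (C r) (B r) fun x => δ2F μ x y) =
        fun y => (κ * r) • intDiff P A fun x => δ2F μ x y :=
      funext fun y => hr _ (h.quadGrowth_left μ y)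
    rw [this, intDiff_smul, smul_smul, ← pow_two]
    rfl
  rw [h.formula (C r) (B r), add_sub_cancel_left]
  simp only [e]
  simp only [smul_comm _ ((κ * r) ^ 2), intervalIntegral.integral_smul]
  rw [smul_smul]
  congr 1
  field_simp

end SecondOrder

end MFTC

/-! ### Dependence of `δF` on the measure, by polarization of the Taylor formula. -/

namespace MFTC

variable {d a : ℕ} {V : Type*} [NormedAddCommGroup V] [NormedSpace ℝ V]
  {F : P2 d → V} {δF : P2 d → Euc d → V} {δ2F : P2 d → Euc d → Euc d → V}

theorem P2.integral_dirac [CompleteSpace V] (x : Euc d) {φ : Euc d → V} (hφ : StronglyMeasurable φ) :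
    ∫ y, φ y ∂(P2.dirac x).meas = φ x :=
  integral_dirac' φ x hφ

/-- One-sided derivative of `h ↦ δF (h P + (1 - h) A) x - ∫ δF (h P + (1 - h) A) dA` at `h = 0`. -/
theorem IsSecondLinFunDeriv.tendsto_slope_dirac [CompleteSpace V]
    (h : IsSecondLinFunDeriv F δF δ2F) (A P : P2 d) (x : Euc d) :
    Tendsto (fun r : ℝ => r⁻¹ • (intDiff (P2.dirac x) A (δF (P2.mix r P A)) -
        intDiff (P2.dirac x) A (δF A))) (𝓝[>] 0)
      (𝓝 ((1 / 2 : ℝ) • (dblDiff P (P2.dirac x) A (δ2F A) + dblDiff (P2.dirac x) P A (δ2F A)))) := by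
  set D := P2.dirac x
  -- The three vertices are `A`, `B r = (1 - r) A + r P` and `C r = (1 - 2r) A + r P + r D`. The
  -- sides `A → B` and `B → C` have directions `P - A` and `D - A`, and the side `A → C` their sum.
  set Q := P2.mix (1 / 2) P D
  set B : ℝ → P2 d := fun r => P2.mix r P A
  set C : ℝ → P2 d := fun r => P2.mix (2 * r) Q A
  set R := max (max P.norm2 A.norm2) D.norm2
  have hP : P.norm2 ≤ R := (le_max_left _ _).trans (le_max_left _ _)
  have hA : A.norm2 ≤ R := (le_max_right _ _).trans (le_max_left _ _)
  have hD : D.norm2 ≤ R := le_max_right _ _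
  have hB : ∀ r, (B r).norm2 ≤ R := fun r => P2.norm2_mix_le _ _ _ hP hA
  have hC : ∀ r, (C r).norm2 ≤ R := fun r =>
    P2.norm2_mix_le _ _ _ (P2.norm2_mix_le _ _ _ hP hD) hA
  have hsmall : ∀ᶠ r in 𝓝[>] (0 : ℝ), r ∈ Ioc (0 : ℝ) (1 / 2) := Ioc_mem_nhdsGT (by norm_num)
  have hhalf : (1 / 2 : ℝ) ∈ Icc (0 : ℝ) 1 := by norm_num
  have hBdir : ∀ᶠ r in 𝓝[>] (0 : ℝ), ∀ φ : Euc d → V, QuadGrowth φ →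
      intDiff (B r) A φ = (1 * r) • intDiff P A φ := by
    filter_upwards [hsmall] with r hr φ hφ
    rw [one_mul, P2.intDiff_mix_right ⟨hr.1.le, by linarith [hr.2]⟩ P A hφ]
  have hCdir : ∀ᶠ r in 𝓝[>] (0 : ℝ), ∀ φ : Euc d → V, QuadGrowth φ →
      intDiff (C r) A φ = (2 * r) • intDiff Q A φ := by
    filter_upwards [hsmall] with r hr φ hφ
    rw [P2.intDiff_mix_right ⟨by linarith [hr.1], by linarith [hr.2]⟩ Q A hφ]
  have hQ : ∀ φ : Euc d → V, QuadGrowth φ →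
      intDiff Q A φ = (1 / 2 : ℝ) • (intDiff P A φ + intDiff D A φ) := by
    intro φ hφ
    simp only [intDiff]
    rw [P2.integral_mix hhalf _ _ (hφ.integrable _) (hφ.integrable _)]
    module
  have hBCdir : ∀ᶠ r in 𝓝[>] (0 : ℝ), ∀ φ : Euc d → V, QuadGrowth φ →
      intDiff (C r) (B r) φ = (1 * r) • intDiff D A φ := by
    filter_upwards [hBdir, hCdir] with r h1 h2 φ hφ
    have e : intDiff (C r) (B r) φ = intDiff (C r) A φ - intDiff (B r) A φ := by
      simp only [intDiff]; abel
    rw [e, h1 φ hφ, h2 φ hφ, hQ φ hφ]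
    module
  have hweights : ∀ k ∈ Icc (0 : ℝ) 1, ∀ r ∈ Ioc (0 : ℝ) (1 / 2),
      0 ≤ r ∧ 0 ≤ k * r ∧ r + k * r ≤ 1 := fun k hk r hr =>
    ⟨hr.1.le, mul_nonneg hk.1 hr.1.le, by nlinarith [hk.1, hk.2, hr.1, hr.2]⟩
  have hid : Tendsto (fun r : ℝ => r) (𝓝[>] 0) (𝓝 0) := nhdsWithin_le_nhds
  have hkid : ∀ k : ℝ, Tendsto (fun r : ℝ => k * r) (𝓝[>] 0) (𝓝 0) := fun k => by
    simpa using hid.const_mul k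
  have hCreal : ∀ r ∈ Ioc (0 : ℝ) (1 / 2), ∀ s, (C r).meas.real s =
      r * P.meas.real s + r * D.meas.real s + (1 - 2 * r) * A.meas.real s := by
    intro r hr s
    rw [P2.mix_real ⟨by linarith [hr.1], by linarith [hr.2]⟩, P2.mix_real hhalf]
    ring
  have hBreal : ∀ r ∈ Ioc (0 : ℝ) (1 / 2), ∀ s, (B r).meas.real s =
      r * P.meas.real s + (1 - r) * A.meas.real s := fun r hr s =>
    P2.mix_real ⟨hr.1.le, by linarith [hr.2]⟩ _ _ s
  have limC : ∀ k ∈ Icc (0 : ℝ) 1, Tendsto (fun r => P2.mix k (C r) A) (𝓝[>] 0) (𝓝 A) := by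
    intro k hk
    refine P2.tendsto_of_weights (P := P) (P' := D) ?_ (hkid k) (hkid k)
    filter_upwards [hsmall] with r hr
    obtain ⟨h1, h2, h3⟩ := hweights k hk r hr
    refine ⟨h2, h2, by nlinarith [hk.2], fun s _ => ?_⟩
    rw [P2.mix_real hk, hCreal r hr]
    ring
  have limB : ∀ k ∈ Icc (0 : ℝ) 1, Tendsto (fun r => P2.mix k (B r) A) (𝓝[>] 0) (𝓝 A) := by
    intro k hk
    refine P2.tendsto_of_weights (P := P) (P' := D) (r' := fun _ => 0) ?_ (hkid k)
      tendsto_const_nhds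
    filter_upwards [hsmall] with r hr
    obtain ⟨h1, h2, h3⟩ := hweights k hk r hr
    refine ⟨h2, le_rfl, by linarith, fun s _ => ?_⟩
    rw [P2.mix_real hk, hBreal r hr]
    ring
  have limBC : ∀ k ∈ Icc (0 : ℝ) 1, Tendsto (fun r => P2.mix k (C r) (B r)) (𝓝[>] 0) (𝓝 A) := by
    intro k hk
    refine P2.tendsto_of_weights (P := P) (P' := D) ?_ hid (hkid k)
    filter_upwards [hsmall] with r hr
    obtain ⟨h1, h2, h3⟩ := hweights k hk r hr
    refine ⟨h1, h2, h3, fun s _ => ?_⟩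
    rw [P2.mix_real hk, hBreal r hr, hCreal r hr]
    ring
  have TC := h.tendsto_taylor (fun _ => hA) hC hCdir limC
  have TB := h.tendsto_taylor (fun _ => hA) hB hBdir limB
  have TBC := h.tendsto_taylor hB hC hBCdir limBC
  -- The values of `F` cancel around the triangle. What survives is `r⁻²` times the integral of `δF
  -- (B r) - δF A` against `C r - B r = r (D - A)`, that is, the difference quotient sought.
  have T := (TC.sub TB).sub TBC
  -- Polarization identity. Symmetry of `δ2F` is not part of its definition, so both orders of `P`
  -- and `D` remain.
  have hval : (2 ^ 2 / 2 : ℝ) • dblDiff Q Q A (δ2F A) - (1 ^ 2 / 2 : ℝ) • dblDiff P P A (δ2F A) -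
      (1 ^ 2 / 2 : ℝ) • dblDiff D D A (δ2F A) =
      (1 / 2 : ℝ) • (dblDiff P D A (δ2F A) + dblDiff D P A (δ2F A)) := by
    have e : dblDiff Q Q A (δ2F A) = (1 / 4 : ℝ) • (dblDiff P P A (δ2F A) + dblDiff P D A (δ2F A) +
        dblDiff D P A (δ2F A) + dblDiff D D A (δ2F A)) := by
      have e1 : (fun y => intDiff Q A fun x => δ2F A x y) = fun y => (1 / 2 : ℝ) •
          (intDiff P A (fun x => δ2F A x y) + intDiff D A (fun x => δ2F A x y)) :=
        funext fun y => hQ _ (h.quadGrowth_left A y)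
      have e2 : ∀ S : P2 d, dblDiff S Q A (δ2F A) =
          (1 / 2 : ℝ) • (dblDiff S P A (δ2F A) + dblDiff S D A (δ2F A)) := by
        intro S
        have i1 := fun S => (h.quadGrowth_intDiff A P A).integrable S
        have i2 := fun S => (h.quadGrowth_intDiff A D A).integrable S
        simp only [dblDiff]
        rw [e1, intDiff_smul]
        congr 1
        rw [intDiff, integral_add (i1 _) (i2 _), integral_add (i1 _) (i2 _)]
        simp only [intDiff]
        abel
      have e3 : dblDiff Q Q A (δ2F A) =
          (1 / 2 : ℝ) • (dblDiff P Q A (δ2F A) + dblDiff D Q A (δ2F A)) :=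
        hQ _ (h.quadGrowth_intDiff A Q A)
      rw [e3, e2, e2]
      module
    rw [e]
    module
  rw [hval] at T
  refine T.congr' ?_
  filter_upwards [hBdir, hBCdir, hCdir, self_mem_nhdsWithin] with r h1 h2 h3 hr
  have hr0 : r ≠ 0 := (mem_Ioi.1 hr).ne'
  have hqA := h.first.quadGrowth A
  rw [h1 _ hqA, h3 _ hqA, h2 _ (h.first.quadGrowth (B r)), hQ _ hqA, ← smul_sub, ← smul_sub]
  have e : F (C r) - F A - (2 * r) • (1 / 2 : ℝ) • (intDiff P A (δF A) + intDiff D A (δF A)) -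
      (F (B r) - F A - (1 * r) • intDiff P A (δF A)) -
      (F (C r) - F (B r) - (1 * r) • intDiff D A (δF (B r))) =
      r • (intDiff D A (δF (B r)) - intDiff D A (δF A)) := by module
  rw [e, smul_smul]
  congr 1
  field_simp

/-- The linear functional derivative is Lipschitz in the measure argument, uniformly with respect
to its increments in space, as soon as the mixed increments of the second order one are. -/
theorem IsSecondLinFunDeriv.norm_increment_le [CompleteSpace V]
    (h : IsSecondLinFunDeriv F δF δ2F) (m : P2 d) {X X' : Euc d → Euc d}
    (hX : MemLp X 2 m.meas) (hX' : MemLp X' 2 m.meas) {K : ℝ}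
    (hK : ∀ θ ∈ Icc (0 : ℝ) 1, ∀ x x' y y',
      ‖(δ2F (P2.mix θ (m.push X) (m.push X')) x y - δ2F (P2.mix θ (m.push X) (m.push X')) x' y) -
        (δ2F (P2.mix θ (m.push X) (m.push X')) x y' -
          δ2F (P2.mix θ (m.push X) (m.push X')) x' y')‖ ≤ K * ‖x - x'‖ * ‖y - y'‖) (x x' : Euc d) :
    ‖(δF (m.push X) x - δF (m.push X) x') - (δF (m.push X') x - δF (m.push X') x')‖ ≤
      K * ‖x - x'‖ * ∫ y, ‖X y - X' y‖ ∂m.meas := by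
  set ν₁ := m.push X
  set ν₂ := m.push X'
  set w := ∫ y, ‖X y - X' y‖ ∂m.meas
  set ν : ℝ → P2 d := fun s => P2.mix s ν₁ ν₂
  set g : ℝ → V := fun s => δF (ν s) x - δF (ν s) x'
  have hg : Continuous g :=
    (h.first.cont.comp ((P2.continuous_mix ν₁ ν₂).prodMk continuous_const)).sub
      (h.first.cont.comp ((P2.continuous_mix ν₁ ν₂).prodMk continuous_const))
  set L : ℝ → V := fun s =>
    (1 / 2 : ℝ) • (dblDiff ν₁ (P2.dirac x) (ν s) (δ2F (ν s)) +
      dblDiff (P2.dirac x) ν₁ (ν s) (δ2F (ν s))) -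
    (1 / 2 : ℝ) • (dblDiff ν₁ (P2.dirac x') (ν s) (δ2F (ν s)) +
      dblDiff (P2.dirac x') ν₁ (ν s) (δ2F (ν s)))
  -- Mixing `ν s` with the endpoint `ν₁` moves along the same segment, so the slope lemma at `A = ν
  -- s`, `P = ν₁` gives a right derivative of `g`, up to the time change with factor `1 - s`.
  have hνν : ∀ s ∈ Ico (0 : ℝ) 1, ∀ r ∈ Ioc (0 : ℝ) 1,
      P2.mix r ν₁ (ν s) = ν (s + (1 - s) * r) := by
    intro s hs r hr
    refine P2.ext_real fun S _ => ?_
    have h1 : s + (1 - s) * r ∈ Icc (0 : ℝ) 1 :=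
      ⟨by nlinarith [hs.1, hs.2, hr.1], by nlinarith [hs.1, hs.2, hr.2]⟩
    rw [P2.mix_real ⟨hr.1.le, hr.2⟩, P2.mix_real h1, P2.mix_real ⟨hs.1, hs.2.le⟩]
    ring
  -- Subtracting the slopes for `x` and `x'` removes the integrals of `δF` against the base measure
  -- and leaves the increment `g`.
  have hslope : ∀ s ∈ Ico (0 : ℝ) 1,
      Tendsto (fun r : ℝ => r⁻¹ • (g (s + (1 - s) * r) - g s)) (𝓝[>] 0) (𝓝 (L s)) := by
    intro s hs
    refine ((h.tendsto_slope_dirac (ν s) ν₁ x).sub (h.tendsto_slope_dirac (ν s) ν₁ x')).congr' ?_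
    filter_upwards [Ioc_mem_nhdsGT (show (0 : ℝ) < 1 by norm_num)] with r hr
    rw [hνν s hs r hr, ← smul_sub]
    congr 1
    simp only [intDiff, g]
    rw [P2.integral_dirac x (h.first.quadGrowth _).1, P2.integral_dirac x (h.first.quadGrowth _).1,
      P2.integral_dirac x' (h.first.quadGrowth _).1, P2.integral_dirac x' (h.first.quadGrowth _).1]
    abel
  have hderiv : ∀ s ∈ Ico (0 : ℝ) 1, HasDerivWithinAt g ((1 - s)⁻¹ • L s) (Ici s) s := by
    intro s hs
    have h1s : 0 < 1 - s := by linarith [hs.2]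
    rw [← hasDerivWithinAt_Ioi_iff_Ici, hasDerivWithinAt_iff_tendsto_slope' (by simp)]
    have hsub : Tendsto (fun r => (r - s) / (1 - s)) (𝓝[>] s) (𝓝[>] 0) := by
      refine tendsto_nhdsWithin_iff.2 ⟨?_, ?_⟩
      · have : Continuous fun r => (r - s) / (1 - s) := by fun_prop
        simpa using (this.tendsto s).mono_left nhdsWithin_le_nhds
      · filter_upwards [self_mem_nhdsWithin] with r hr
        exact div_pos (sub_pos.2 hr) h1s
    refine (((hslope s hs).comp hsub).const_smul (1 - s)⁻¹).congr fun r => ?_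
    simp only [Function.comp, slope, vsub_eq_sub]
    rw [mul_div_cancel₀ _ h1s.ne', add_sub_cancel, smul_smul, inv_div]
    congr 1
    field_simp
  -- The singular factor `(1 - s)⁻¹` is harmless because `ν₁ - ν s = (1 - s)(ν₁ - ν₂)`. The two
  -- halves of the symmetrized form are bounded by the same mixed increment, with the roles of the
  -- arguments exchanged.
  have hbound : ∀ s ∈ Ico (0 : ℝ) 1, ‖(1 - s)⁻¹ • L s‖ ≤ K * ‖x - x'‖ * w := by
    intro s hs
    have h1s : 0 < 1 - s := by linarith [hs.2]
    have hsI : s ∈ Icc (0 : ℝ) 1 := ⟨hs.1, hs.2.le⟩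
    have q1 : ∀ z, QuadGrowth fun y => δ2F (ν s) z y := h.quadGrowth_right (ν s)
    have q2 : ∀ z, QuadGrowth fun y => δ2F (ν s) y z := h.quadGrowth_left (ν s)
    have hdir : ∀ z, (fun y => intDiff (P2.dirac z) (ν s) fun x => δ2F (ν s) x y) =
        fun y => δ2F (ν s) z y - ∫ x, δ2F (ν s) x y ∂(ν s).meas := fun z => funext fun y => by
      rw [intDiff, P2.integral_dirac z (q2 y).1]
    have qI : QuadGrowth fun y => ∫ x, δ2F (ν s) x y ∂(ν s).meas := by
      have h3 := h.quadGrowth_intDiff (ν s) (P2.dirac x) (ν s)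
      rw [hdir x] at h3
      simpa using (q1 x).sub h3
    have e1 : dblDiff ν₁ (P2.dirac x) (ν s) (δ2F (ν s)) -
        dblDiff ν₁ (P2.dirac x') (ν s) (δ2F (ν s)) =
        intDiff ν₁ (ν s) fun y => δ2F (ν s) x y - δ2F (ν s) x' y := by
      simp only [dblDiff]
      rw [hdir x, hdir x', intDiff_sub _ _ (q1 x) qI, intDiff_sub _ _ (q1 x') qI,
        intDiff_sub _ _ (q1 x) (q1 x')]
      abel
    have e2 : dblDiff (P2.dirac x) ν₁ (ν s) (δ2F (ν s)) -
        dblDiff (P2.dirac x') ν₁ (ν s) (δ2F (ν s)) =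
        intDiff ν₁ (ν s) fun y => δ2F (ν s) y x - δ2F (ν s) y x' := by
      have hm := (h.quadGrowth_intDiff (ν s) ν₁ (ν s)).1
      rw [intDiff_sub _ _ (q2 x) (q2 x')]
      simp only [dblDiff]
      rw [intDiff, intDiff, P2.integral_dirac x hm, P2.integral_dirac x' hm]
      abel
    have hQ1 := (q1 x).sub (q1 x')
    have hQ2 := (q2 x).sub (q2 x')
    have e : (1 - s)⁻¹ • L s = (1 / 2 : ℝ) •
        (intDiff ν₁ ν₂ (fun y => δ2F (ν s) x y - δ2F (ν s) x' y) +
          intDiff ν₁ ν₂ fun y => δ2F (ν s) y x - δ2F (ν s) y x') := by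
      have : L s = (1 / 2 : ℝ) • ((dblDiff ν₁ (P2.dirac x) (ν s) (δ2F (ν s)) -
        dblDiff ν₁ (P2.dirac x') (ν s) (δ2F (ν s))) + (dblDiff (P2.dirac x) ν₁ (ν s) (δ2F (ν s)) -
        dblDiff (P2.dirac x') ν₁ (ν s) (δ2F (ν s)))) := by
        simp only [L]; module
      rw [this, e1, e2, P2.intDiff_left_mix hsI _ _ hQ1, P2.intDiff_left_mix hsI _ _ hQ2,
        ← smul_add, smul_comm (1 / 2 : ℝ) (1 - s), smul_smul, inv_mul_cancel₀ h1s.ne', one_smul]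
    rw [e, norm_smul]
    have b1 : ‖intDiff ν₁ ν₂ (fun y => δ2F (ν s) x y - δ2F (ν s) x' y)‖ ≤ K * ‖x - x'‖ * w :=
      norm_intDiff_push_le m hX hX' fun y y' => hK s hsI x x' y y'
    have b2 : ‖intDiff ν₁ ν₂ (fun y => δ2F (ν s) y x - δ2F (ν s) y x')‖ ≤ K * ‖x - x'‖ * w :=
      norm_intDiff_push_le m hX hX' fun y y' => by
        have := hK s hsI y y' x x'
        rw [show (δ2F (ν s) y x - δ2F (ν s) y' x) - (δ2F (ν s) y x' - δ2F (ν s) y' x') =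
          (δ2F (ν s) y x - δ2F (ν s) y x') - (δ2F (ν s) y' x - δ2F (ν s) y' x') by abel] at this
        linarith
    have b3 := norm_add_le (intDiff ν₁ ν₂ (fun y => δ2F (ν s) x y - δ2F (ν s) x' y))
      (intDiff ν₁ ν₂ (fun y => δ2F (ν s) y x - δ2F (ν s) y x'))
    rw [Real.norm_eq_abs, abs_of_pos (by norm_num)]
    linarith
  have key := norm_image_sub_le_of_norm_deriv_right_le_segment hg.continuousOn hderiv hbound 1
    ⟨zero_le_one, le_rfl⟩
  have h1 : ν 1 = ν₁ := P2.ext_real fun S _ => by rw [P2.mix_real ⟨zero_le_one, le_rfl⟩]; ring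
  have h0 : ν 0 = ν₂ := P2.ext_real fun S _ => by rw [P2.mix_real ⟨le_rfl, zero_le_one⟩]; ring
  simpa [g, h1, h0] using key

end MFTC

/-! ### Lipschitz estimates for the first derivatives of a coefficient. -/

namespace MFTC

variable {d a : ℕ} {V : Type*} [NormedAddCommGroup V] [NormedSpace ℝ V]

/-- The second order derivatives are bounded by `K` at the points `(x, μ) ∈ S`. -/
structure SecondDerivsBdd (D : Derivs d a V) (K : ℝ) (S : Set (Euc d × P2 d)) : Prop where
  nonneg : 0 ≤ K
  dxx : ∀ x μ α, (x, μ) ∈ S → ‖D.dxx x μ α‖ ≤ K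
  dax : ∀ x μ α, (x, μ) ∈ S → ‖D.dax x μ α‖ ≤ K
  dxm : ∀ x μ α y, (x, μ) ∈ S → ‖D.dxm x μ α y‖ ≤ K
  dam : ∀ x μ α y, (x, μ) ∈ S → ‖D.dam x μ α y‖ ≤ K
  dym : ∀ x μ α y, (x, μ) ∈ S → ‖D.dym x μ α y‖ ≤ K
  dmm : ∀ x μ α y z, (x, μ) ∈ S → ‖D.dmm x μ α y z‖ ≤ K

/-- `S` contains the segments joining `(x, μ)`, `(x', μ)` and `(x', μ')`, the latter one together
with a neighbourhood in the space variable. -/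
structure PathIn (S : Set (Euc d × P2 d)) (x x' : Euc d) (μ μ' : P2 d) : Prop where
  left : ∀ ξ ∈ segment ℝ x x', (ξ, μ) ∈ S
  right : ∃ ρ > 0, ∀ z ∈ Metric.ball x' ρ, ∀ θ ∈ Icc (0 : ℝ) 1, (z, P2.mix θ μ μ') ∈ S

theorem PathIn.mix_mem {S : Set (Euc d × P2 d)} {x x' : Euc d} {μ μ' : P2 d}
    (h : PathIn S x x' μ μ') {θ : ℝ} (hθ : θ ∈ Icc (0 : ℝ) 1) : (x', P2.mix θ μ μ') ∈ S := by
  obtain ⟨ρ, hρ, h⟩ := h.right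
  exact h x' (Metric.mem_ball_self hρ) θ hθ

theorem PathIn.end_mem {S : Set (Euc d × P2 d)} {x x' : Euc d} {μ μ' : P2 d}
    (h : PathIn S x x' μ μ') : (x', μ') ∈ S := by
  have : P2.mix 0 μ μ' = μ' := P2.ext_real fun s _ => by
    rw [P2.mix_real ⟨le_rfl, zero_le_one⟩]; ring
  exact this ▸ h.mix_mem ⟨le_rfl, zero_le_one⟩

theorem norm_sub_le_of_hasFDerivAt {E W : Type*} [NormedAddCommGroup E] [NormedSpace ℝ E]
    [NormedAddCommGroup W] [NormedSpace ℝ W] {φ : E → W} {φ' : E → E →L[ℝ] W} {K : ℝ}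
    (h : ∀ x, HasFDerivAt φ (φ' x) x) {x y : E} (hK : ∀ z ∈ segment ℝ x y, ‖φ' z‖ ≤ K) :
    ‖φ x - φ y‖ ≤ K * ‖x - y‖ :=
  (convex_segment x y).norm_image_sub_le_of_norm_hasFDerivWithin_le
    (fun z _ => (h z).hasFDerivWithinAt) hK (right_mem_segment ℝ x y) (left_mem_segment ℝ x y)

section Lipschitz

variable {Φ : Euc d → P2 d → Euc a → V} {D : Derivs d a V} {K : ℝ} {S : Set (Euc d × P2 d)}

theorem HasDerivs.dx_lip_alpha (h : HasDerivs Φ D) (hS : SecondDerivsBdd D K S) {x : Euc d}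
    {μ : P2 d} (hx : (x, μ) ∈ S) (α α' : Euc a) : ‖D.dx x μ α - D.dx x μ α'‖ ≤ K * ‖α - α'‖ :=
  norm_sub_le_of_hasFDerivAt (h.dax x μ) fun _ _ => hS.dax _ _ _ hx

theorem HasDerivs.dm_lip_alpha (h : HasDerivs Φ D) (hS : SecondDerivsBdd D K S) {x : Euc d}
    {μ : P2 d} (hx : (x, μ) ∈ S) (α α' : Euc a) (y : Euc d) :
    ‖D.dm x μ α y - D.dm x μ α' y‖ ≤ K * ‖α - α'‖ :=
  norm_sub_le_of_hasFDerivAt (fun α => h.dam x μ α y) fun _ _ => hS.dam _ _ _ _ hx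

theorem HasDerivs.dm_lip_y (h : HasDerivs Φ D) (hS : SecondDerivsBdd D K S) {x : Euc d}
    {μ : P2 d} (hx : (x, μ) ∈ S) (α : Euc a) (y y' : Euc d) :
    ‖D.dm x μ α y - D.dm x μ α y'‖ ≤ K * ‖y - y'‖ :=
  norm_sub_le_of_hasFDerivAt (h.dym x μ α) fun _ _ => hS.dym _ _ _ _ hx

theorem HasDerivs.dm_lip_x (h : HasDerivs Φ D) (hS : SecondDerivsBdd D K S) {x x' : Euc d}
    {μ : P2 d} (hx : ∀ ξ ∈ segment ℝ x x', (ξ, μ) ∈ S) (α : Euc a) (y : Euc d) :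
    ‖D.dm x μ α y - D.dm x' μ α y‖ ≤ K * ‖x - x'‖ :=
  norm_sub_le_of_hasFDerivAt (fun x => h.dxm x μ α y) fun _ hz => hS.dxm _ _ _ _ (hx _ hz)

variable {m : P2 d} {X X' : Euc d → Euc d}

/-- A difference of derivatives at two base points is the derivative of a difference of functions,
so it suffices to bound rectangular increments of `Φ`. These may be evaluated in the other order,
with `∂_α∂_x Φ` and `∂_α∂_μ Φ`, and no symmetry of mixed derivatives is needed. The same device is
used for `dx` and `dm`. -/
theorem HasDerivs.da_lip (h : HasDerivs Φ D) (hS : SecondDerivsBdd D K S)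
    (hX : MemLp X 2 m.meas) (hX' : MemLp X' 2 m.meas) {x x' : Euc d}
    (hp : PathIn S x x' (m.push X) (m.push X')) (α : Euc a) :
    ‖D.da x (m.push X) α - D.da x' (m.push X') α‖ ≤
      K * (‖x - x'‖ + ∫ y, ‖X y - X' y‖ ∂m.meas) := by
  have hw : 0 ≤ ∫ y, ‖X y - X' y‖ ∂m.meas := integral_nonneg fun _ => norm_nonneg _
  have hK := hS.nonneg
  have h1 : ‖D.da x (m.push X) α - D.da x' (m.push X) α‖ ≤ K * ‖x - x'‖ := by
    refine ((h.da x (m.push X) α).sub (h.da x' (m.push X) α)).le_of_lip' (by positivity)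
      (Eventually.of_forall fun β => ?_)
    have := norm_sub_le_of_hasFDerivAt (K := K * ‖β - α‖) (x := x) (y := x')
      (fun z => (h.dx z (m.push X) β).sub (h.dx z (m.push X) α))
      fun z hz => h.dx_lip_alpha hS (hp.left z hz) β α
    calc _ = _ := by congr 1; simp only [Pi.sub_apply]; abel
      _ ≤ _ := this
      _ = _ := by ring
  have h2 : ‖D.da x' (m.push X) α - D.da x' (m.push X') α‖ ≤
      K * ∫ y, ‖X y - X' y‖ ∂m.meas := by
    refine ((h.da x' (m.push X) α).sub (h.da x' (m.push X') α)).le_of_lip' (by positivity)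
      (Eventually.of_forall fun β => ?_)
    have := norm_increment_sub_le (h.lin x' β).first (h.lin x' α).first m hX hX'
      (K := K * ‖β - α‖) fun θ hθ y y' => norm_sub_le_of_hasFDerivAt
        (fun z => (h.dm x' _ β z).sub (h.dm x' _ α z))
        fun z _ => h.dm_lip_alpha hS (hp.mix_mem hθ) β α z
    calc _ = _ := by congr 1; simp only [Pi.sub_apply]; abel
      _ ≤ _ := this
      _ = _ := by ring
  have := norm_sub_le_norm_sub_add_norm_sub (D.da x (m.push X) α) (D.da x' (m.push X) α)
    (D.da x' (m.push X') α)
  linarith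

theorem HasDerivs.dx_lip (h : HasDerivs Φ D) (hS : SecondDerivsBdd D K S)
    (hX : MemLp X 2 m.meas) (hX' : MemLp X' 2 m.meas) {x x' : Euc d}
    (hp : PathIn S x x' (m.push X) (m.push X')) (α α' : Euc a) :
    ‖D.dx x (m.push X) α - D.dx x' (m.push X') α'‖ ≤
      K * (‖x - x'‖ + ∫ y, ‖X y - X' y‖ ∂m.meas + ‖α - α'‖) := by
  have hw : 0 ≤ ∫ y, ‖X y - X' y‖ ∂m.meas := integral_nonneg fun _ => norm_nonneg _
  have hK := hS.nonneg
  have h1 : ‖D.dx x (m.push X) α - D.dx x' (m.push X) α‖ ≤ K * ‖x - x'‖ :=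
    norm_sub_le_of_hasFDerivAt (fun z => h.dxx z (m.push X) α)
      fun z hz => hS.dxx _ _ _ (hp.left z hz)
  have h2 : ‖D.dx x' (m.push X) α - D.dx x' (m.push X') α‖ ≤
      K * ∫ y, ‖X y - X' y‖ ∂m.meas := by
    -- Differentiating in `x` at `x'` while the measure moves needs the bounds also at points near
    -- `x'`; this is the purpose of the neighbourhood in `PathIn`.
    obtain ⟨ρ, hρ, hball⟩ := hp.right
    refine ((h.dx x' (m.push X) α).sub (h.dx x' (m.push X') α)).le_of_lip' (by positivity) ?_
    filter_upwards [Metric.ball_mem_nhds x' hρ] with z hz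
    have := norm_increment_sub_le (h.lin z α).first (h.lin x' α).first m hX hX'
      (K := K * ‖z - x'‖) fun θ hθ y y' => norm_sub_le_of_hasFDerivAt
        (fun y => (h.dm z _ α y).sub (h.dm x' _ α y))
        fun y _ => h.dm_lip_x hS (fun ξ hξ => hball ξ
          ((convex_ball x' ρ).segment_subset hz (Metric.mem_ball_self hρ) hξ) θ hθ) α y
    calc _ = _ := by congr 1; simp only [Pi.sub_apply]; abel
      _ ≤ _ := this
      _ = _ := by ring
  have h3 := h.dx_lip_alpha hS hp.end_mem α α'
  have e1 := norm_sub_le_norm_sub_add_norm_sub (D.dx x (m.push X) α) (D.dx x' (m.push X) α)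
    (D.dx x' (m.push X') α')
  have e2 := norm_sub_le_norm_sub_add_norm_sub (D.dx x' (m.push X) α) (D.dx x' (m.push X') α)
    (D.dx x' (m.push X') α')
  linarith

theorem HasDerivs.dm_lip [CompleteSpace V] (h : HasDerivs Φ D) (hS : SecondDerivsBdd D K S)
    (hX : MemLp X 2 m.meas) (hX' : MemLp X' 2 m.meas) {x x' : Euc d}
    (hp : PathIn S x x' (m.push X) (m.push X')) (α α' : Euc a) (y y' : Euc d) :
    ‖D.dm x (m.push X) α y - D.dm x' (m.push X') α' y'‖ ≤
      K * (‖x - x'‖ + ∫ y, ‖X y - X' y‖ ∂m.meas + ‖α - α'‖ + ‖y - y'‖) := by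
  have hw : 0 ≤ ∫ y, ‖X y - X' y‖ ∂m.meas := integral_nonneg fun _ => norm_nonneg _
  have hK := hS.nonneg
  have h1 := h.dm_lip_x hS hp.left α y
  have h2 : ‖D.dm x' (m.push X) α y - D.dm x' (m.push X') α y‖ ≤
      K * ∫ y, ‖X y - X' y‖ ∂m.meas := by
    -- `dm` is the space derivative of `lin`, so its variation in `μ` is read off from the mixed
    -- increments of `lin` in space and measure, and these from two integrations of `dmm`.
    refine ((h.dm x' (m.push X) α y).sub (h.dm x' (m.push X') α y)).le_of_lip' (by positivity)
      (Eventually.of_forall fun z => ?_)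
    have := (h.lin x' α).norm_increment_le m hX hX' (K := K) (fun θ hθ z z' u u' =>
      norm_sub_le_of_hasFDerivAt
        (fun u => (h.dlin2 x' _ α z u).sub (h.dlin2 x' _ α z' u))
        fun u _ => norm_sub_le_of_hasFDerivAt (fun z => h.dmm x' _ α z u)
          fun z _ => hS.dmm _ _ _ _ _ (hp.mix_mem hθ)) z y
    calc _ = _ := by congr 1; simp only [Pi.sub_apply]; abel
      _ ≤ _ := this
      _ = _ := by ring
  have h3 := h.dm_lip_alpha hS hp.end_mem α α' y
  have h4 := h.dm_lip_y hS hp.end_mem α' y y'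
  have e1 := norm_sub_le_norm_sub_add_norm_sub (D.dm x (m.push X) α y) (D.dm x' (m.push X) α y)
    (D.dm x' (m.push X') α' y')
  have e2 := norm_sub_le_norm_sub_add_norm_sub (D.dm x' (m.push X) α y) (D.dm x' (m.push X') α y)
    (D.dm x' (m.push X') α' y')
  have e3 := norm_sub_le_norm_sub_add_norm_sub (D.dm x' (m.push X') α y) (D.dm x' (m.push X') α' y)
    (D.dm x' (m.push X') α' y')
  linarith

theorem HasDerivs.lip (h : HasDerivs Φ D) (hx : ∀ x μ α, ‖D.dx x μ α‖ ≤ K)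
    (ha : ∀ x μ α, ‖D.da x μ α‖ ≤ K) (hm : ∀ x μ α y, ‖D.dm x μ α y‖ ≤ K)
    (hX : MemLp X 2 m.meas) (hX' : MemLp X' 2 m.meas) (x x' : Euc d) (α α' : Euc a) :
    ‖Φ x (m.push X) α - Φ x' (m.push X') α'‖ ≤
      K * (‖x - x'‖ + ∫ y, ‖X y - X' y‖ ∂m.meas + ‖α - α'‖) := by
  have h1 := norm_sub_le_of_hasFDerivAt (x := x) (y := x') (fun z => h.dx z (m.push X) α)
    fun z _ => hx _ _ _
  have h2 := (h.lin x' α).first.norm_sub_le m hX hX' (K := K)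
    fun θ _ y y' => norm_sub_le_of_hasFDerivAt (fun z => h.dm x' _ α z) fun z _ => hm _ _ _ _
  have h3 := norm_sub_le_of_hasFDerivAt (x := α) (y := α') (fun z => h.da x' (m.push X') z)
    fun z _ => ha _ _ _
  have e1 := norm_sub_le_norm_sub_add_norm_sub (Φ x (m.push X) α) (Φ x' (m.push X) α)
    (Φ x' (m.push X') α')
  have e2 := norm_sub_le_norm_sub_add_norm_sub (Φ x' (m.push X) α) (Φ x' (m.push X') α)
    (Φ x' (m.push X') α')
  linarith

end Lipschitz

theorem PathIn.univ (x x' : Euc d) (μ μ' : P2 d) : PathIn univ x x' μ μ' :=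
  ⟨fun _ _ => mem_univ _, 1, one_pos, fun _ _ _ _ => mem_univ _⟩

theorem P2.norm1_push_sub_le {m : P2 d} {X X' : Euc d → Euc d} (hX : MemLp X 2 m.meas)
    (hX' : MemLp X' 2 m.meas) :
    (m.push X).norm1 ≤ (m.push X').norm1 + ∫ y, ‖X y - X' y‖ ∂m.meas := by
  have i := hX.integrable one_le_two
  have i' := hX'.integrable one_le_two
  rw [m.norm1_push hX, m.norm1_push hX', ← integral_add (g := fun y => ‖X y - X' y‖) i'.norm
    (i.sub i').norm]
  refine integral_mono i.norm (i'.norm.add (i.sub i').norm) fun y => ?_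
  simpa using norm_add_le (X' y) (X y - X' y)

/-- The region where `1 + |x| + ‖μ‖₁` is at least `c`. -/
def farRegion (d : ℕ) (c : ℝ) : Set (Euc d × P2 d) := {q | c ≤ 1 + ‖q.1‖ + q.2.norm1}

theorem PathIn.farRegion {m : P2 d} {X X' : Euc d → Euc d} (hX : MemLp X 2 m.meas)
    (hX' : MemLp X' 2 m.meas) {x x' : Euc d} {r : ℝ} (hr : 0 < r)
    (hrx : r ≤ 1 + ‖x‖ + (m.push X).norm1)
    (hclose : ‖x - x'‖ + ∫ y, ‖X y - X' y‖ ∂m.meas ≤ r / 2) :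
    PathIn (MFTC.farRegion d (r / 4)) x x' (m.push X) (m.push X') := by
  have hw : 0 ≤ ∫ y, ‖X y - X' y‖ ∂m.meas := integral_nonneg fun _ => norm_nonneg _
  -- Of the weight `r`, moving along the path costs at most `r / 2` and the ball around `x'` at most
  -- `r / 4`, so `r / 4` is left.
  have hn := P2.norm1_push_sub_le hX hX'
  refine ⟨fun ξ hξ => ?_, r / 4, by positivity, fun z hz θ hθ => ?_⟩
  · show r / 4 ≤ 1 + ‖ξ‖ + (m.push X).norm1
    have h1 : ‖x - ξ‖ ≤ ‖x - x'‖ := by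
      have := (convex_closedBall x ‖x - x'‖).segment_subset (Metric.mem_closedBall_self (by simp))
        (by rw [Metric.mem_closedBall, dist_eq_norm, norm_sub_rev]) hξ
      rwa [Metric.mem_closedBall, dist_eq_norm, norm_sub_rev] at this
    have h2 : ‖x‖ ≤ ‖ξ‖ + ‖x - ξ‖ := by simpa using norm_add_le ξ (x - ξ)
    linarith
  · show r / 4 ≤ 1 + ‖z‖ + (P2.mix θ (m.push X) (m.push X')).norm1
    rw [P2.norm1_mix hθ]
    rw [Metric.mem_ball, dist_eq_norm, norm_sub_rev] at hz
    have h1 : ‖x‖ ≤ ‖x'‖ + ‖x - x'‖ := by simpa using norm_add_le x' (x - x')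
    have h2 : ‖x'‖ ≤ ‖z‖ + ‖x' - z‖ := by simpa using norm_add_le z (x' - z)
    have h3 : (1 - θ) * (m.push X).norm1 ≤ (1 - θ) * ((m.push X').norm1 +
        ∫ y, ‖X y - X' y‖ ∂m.meas) := mul_le_mul_of_nonneg_left hn (by linarith [hθ.2])
    have h4 : (1 - θ) * ∫ y, ‖X y - X' y‖ ∂m.meas ≤ ∫ y, ‖X y - X' y‖ ∂m.meas := by
      nlinarith [hθ.1]
    linarith

/-! ### Weighted Lipschitz estimates for the derivatives of the drift. -/

section Drift

variable {f : Euc d → P2 d → Euc a → Euc d} {D : Derivs d a (Euc d)} {lamf Lamf lbarf Lipf : ℝ}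

theorem AssumptionA1.secondDerivsBdd (h : AssumptionA1 f D lamf Lamf lbarf Lipf) {c : ℝ}
    (hc : 0 < c) : SecondDerivsBdd D (lbarf / c) (farRegion d c) := by
  have key : ∀ {v w : ℝ}, 0 ≤ v → c ≤ w → v * w ≤ lbarf → v ≤ lbarf / c := fun hv hw h => by
    rw [le_div_iff₀ hc]
    exact (mul_le_mul_of_nonneg_left hw hv).trans h
  exact ⟨div_nonneg h.lbarf_pos.le hc.le,
    fun x μ α hS => key (norm_nonneg (D.dxx x μ α)) hS (h.bdd_dxx x μ α),
    fun x μ α hS => key (norm_nonneg (D.dax x μ α)) hS (h.bdd_dax x μ α),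
    fun x μ α y hS => key (norm_nonneg (D.dxm x μ α y)) hS (h.bdd_dxm x μ α y),
    fun x μ α y hS => key (norm_nonneg (D.dam x μ α y)) hS (h.bdd_dam x μ α y),
    fun x μ α y hS => key (norm_nonneg (D.dym x μ α y)) hS (h.bdd_dym x μ α y),
    fun x μ α y z hS => key (norm_nonneg (D.dmm x μ α y z)) hS (h.bdd_dmm x μ α y z)⟩

/-- Either two points are at distance comparable to `r`, and boundedness suffices, or a Lipschitz
estimate with constant of order `1 / r` holds. -/
theorem mul_le_of_near_or_far {v r Λ l δ e : ℝ} (hr : 0 < r) (hΛ : 0 ≤ Λ) (hl : 0 ≤ l)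
    (hδ : 0 ≤ δ) (he : 0 ≤ e) (hfar : v ≤ 2 * Λ)
    (hnear : δ ≤ r / 2 → v ≤ l / (r / 4) * (δ + e)) : v * r ≤ 4 * (l + Λ) * (δ + e) := by
  rcases le_or_gt δ (r / 2) with h | h
  · calc v * r ≤ l / (r / 4) * (δ + e) * r := by gcongr; exact hnear h
      _ = 4 * l * (δ + e) := by field_simp
      _ ≤ 4 * (l + Λ) * (δ + e) := by gcongr; linarith
  · calc v * r ≤ 2 * Λ * r := by gcongr
      _ ≤ 2 * Λ * (2 * δ) := by gcongr; linarith
      _ = 4 * Λ * δ := by ring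
      _ ≤ 4 * (l + Λ) * (δ + e) := by gcongr <;> linarith

variable {m : P2 d} {X X' : Euc d → Euc d}

/-- The second derivatives decay like the inverse of the weight, but a path between distant points
may cross the region where the weight is small. For such points the distance is comparable to the
weight, and the bound `Λ_f` on the first derivatives is enough. -/
theorem AssumptionA1.da_lip (h : AssumptionA1 f D lamf Lamf lbarf Lipf)
    (hX : MemLp X 2 m.meas) (hX' : MemLp X' 2 m.meas) (x x' : Euc d) (α : Euc a) :
    ‖D.da x (m.push X) α - D.da x' (m.push X') α‖ * (1 + ‖x‖ + (m.push X).norm1) ≤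
      4 * (lbarf + Lamf) * (‖x - x'‖ + ∫ y, ‖X y - X' y‖ ∂m.meas) := by
  have hn := (m.push X).norm1_nonneg
  have hw : 0 ≤ ∫ y, ‖X y - X' y‖ ∂m.meas := integral_nonneg fun _ => norm_nonneg _
  have := mul_le_of_near_or_far (v := ‖D.da x (m.push X) α - D.da x' (m.push X') α‖)
    (r := 1 + ‖x‖ + (m.push X).norm1) (δ := ‖x - x'‖ + ∫ y, ‖X y - X' y‖ ∂m.meas) (e := 0)
    (by positivity) h.Lamf_pos.le h.lbarf_pos.le (by positivity) le_rfl
    (by linarith [norm_sub_le (D.da x (m.push X) α) (D.da x' (m.push X') α),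
      h.bdd_da x (m.push X) α, h.bdd_da x' (m.push X') α])
    fun hc => by
      rw [add_zero]
      exact h.derivs.da_lip (h.secondDerivsBdd (by positivity)) hX hX'
        (PathIn.farRegion hX hX' (by positivity) le_rfl hc) α
  simpa using this

theorem AssumptionA1.dx_lip (h : AssumptionA1 f D lamf Lamf lbarf Lipf)
    (hX : MemLp X 2 m.meas) (hX' : MemLp X' 2 m.meas) (x x' : Euc d) (α α' : Euc a) :
    ‖D.dx x (m.push X) α - D.dx x' (m.push X') α'‖ * (1 + ‖x‖ + (m.push X).norm1) ≤
      4 * (lbarf + Lamf) * (‖x - x'‖ + ∫ y, ‖X y - X' y‖ ∂m.meas + ‖α - α'‖) := by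
  have hn := (m.push X).norm1_nonneg
  have hw : 0 ≤ ∫ y, ‖X y - X' y‖ ∂m.meas := integral_nonneg fun _ => norm_nonneg _
  exact mul_le_of_near_or_far (by positivity) h.Lamf_pos.le h.lbarf_pos.le (by positivity)
    (norm_nonneg _)
    (by linarith [norm_sub_le (D.dx x (m.push X) α) (D.dx x' (m.push X') α'),
      h.bdd_dx x (m.push X) α, h.bdd_dx x' (m.push X') α'])
    fun hc => h.derivs.dx_lip (h.secondDerivsBdd (by positivity)) hX hX'
      (PathIn.farRegion hX hX' (by positivity) le_rfl hc) α α'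

theorem AssumptionA1.dm_lip (h : AssumptionA1 f D lamf Lamf lbarf Lipf)
    (hX : MemLp X 2 m.meas) (hX' : MemLp X' 2 m.meas) (x x' : Euc d) (α α' : Euc a)
    (y y' : Euc d) :
    ‖D.dm x (m.push X) α y - D.dm x' (m.push X') α' y'‖ * (1 + ‖x‖ + (m.push X).norm1) ≤
      4 * (lbarf + Lamf) *
        (‖x - x'‖ + ∫ y, ‖X y - X' y‖ ∂m.meas + (‖α - α'‖ + ‖y - y'‖)) := by
  have hn := (m.push X).norm1_nonneg
  have hw : 0 ≤ ∫ y, ‖X y - X' y‖ ∂m.meas := integral_nonneg fun _ => norm_nonneg _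
  exact mul_le_of_near_or_far (by positivity) h.Lamf_pos.le h.lbarf_pos.le (by positivity)
    (by positivity)
    (by linarith [norm_sub_le (D.dm x (m.push X) α y) (D.dm x' (m.push X') α' y'),
      h.bdd_dm x (m.push X) α y, h.bdd_dm x' (m.push X') α' y'])
    fun hc => by
      rw [← add_assoc]
      exact h.derivs.dm_lip (h.secondDerivsBdd (by positivity)) hX hX'
        (PathIn.farRegion hX hX' (by positivity) le_rfl hc) α α' y y'

end Drift

theorem AssumptionA2.secondDerivsBdd {g : Euc d → P2 d → Euc a → ℝ} {D : Derivs d a ℝ}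
    {lamg Lamg lbarg lg K : ℝ} (h : AssumptionA2 g D lamg Lamg lbarg lg) (h1 : Lamg ≤ K)
    (h2 : lbarg ≤ K) : SecondDerivsBdd D K univ :=
  ⟨h.Lamg_pos.le.trans h1, fun _ _ _ _ => (h.bdd_dxx _ _ _).trans h1,
    fun _ _ _ _ => (h.bdd_dax _ _ _).trans h2, fun _ _ _ _ _ => (h.bdd_dxm _ _ _ _).trans h1,
    fun _ _ _ _ _ => (h.bdd_dam _ _ _ _).trans h2, fun _ _ _ _ _ => (h.bdd_dym _ _ _ _).trans h1,
    fun _ _ _ _ _ _ => (h.bdd_dmm _ _ _ _ _).trans h1⟩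

end MFTC

/-! ### Lipschitz continuity of the terminal function. -/

namespace MFTC

variable {d a : ℕ}

section LDerivative

variable {V : Type*} [NormedAddCommGroup V] [NormedSpace ℝ V]

theorem P2.law_meas {Ω : Type*} [MeasurableSpace Ω] (P : Measure Ω) [IsProbabilityMeasure P]
    {Y : Ω → Euc d} (hY : MemLp Y 2 P) : (P2.law P Y).meas = P.map Y := by
  have h : P2.law P Y = _ := dif_pos hY
  rw [h]
  rfl

/-- An `L`-differentiable function with bounded `L`-derivative is Lipschitz with respect to the
`L¹`-distance of couplings. -/
theorem IsLDeriv.norm_sub_le {F : P2 d → V} {dF : P2 d → Euc d → Euc d →L[ℝ] V}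
    (h : IsLDeriv F dF) {K : ℝ} (hK : ∀ μ y, ‖dF μ y‖ ≤ K) (m : P2 d) {X X' : Euc d → Euc d}
    (hX : MemLp X 2 m.meas) (hX' : MemLp X' 2 m.meas) :
    ‖F (m.push X) - F (m.push X')‖ ≤ K * ∫ y, ‖X y - X' y‖ ∂m.meas := by
  have hXX : AEMeasurable (fun y => (X y, X' y)) m.meas :=
    hX.1.aemeasurable.prodMk hX'.1.aemeasurable
  have := Measure.isProbabilityMeasure_map hXX
  -- `L`-differentiability concerns random vectors on `[0,1]`, so the joint law of `(X, X')` is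
  -- realized there; keeping the joint law preserves `∫ |X - X'| dm`.
  obtain ⟨Z, hZ, hmap⟩ := Measure.exists_measurable_map_eq (m.meas.map fun y => (X y, X' y))
  have m1 : volume.map (fun ω => (Z ω).1) = m.meas.map X := by
    rw [show (fun ω => (Z ω).1) = Prod.fst ∘ Z from rfl, ← Measure.map_map measurable_fst hZ, hmap,
      AEMeasurable.map_map_of_aemeasurable measurable_fst.aemeasurable hXX]
    rfl
  have m2 : volume.map (fun ω => (Z ω).2) = m.meas.map X' := by
    rw [show (fun ω => (Z ω).2) = Prod.snd ∘ Z from rfl, ← Measure.map_map measurable_snd hZ, hmap,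
      AEMeasurable.map_map_of_aemeasurable measurable_snd.aemeasurable hXX]
    rfl
  have l1 : MemLp (fun ω => (Z ω).1) 2 volume := by
    refine (memLp_map_measure_iff (g := id) aestronglyMeasurable_id hZ.fst.aemeasurable).1 ?_
    rw [m1]
    exact (memLp_map_measure_iff aestronglyMeasurable_id hX.1.aemeasurable).2 hX
  have l2 : MemLp (fun ω => (Z ω).2) 2 volume := by
    refine (memLp_map_measure_iff (g := id) aestronglyMeasurable_id hZ.snd.aemeasurable).1 ?_
    rw [m2]
    exact (memLp_map_measure_iff aestronglyMeasurable_id hX'.1.aemeasurable).2 hX'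
  set Y : Lp (Euc d) 2 (volume : Measure unitInterval) := l1.toLp _
  set Y' : Lp (Euc d) 2 (volume : Measure unitInterval) := l2.toLp _
  have e1 : P2.law volume Y = m.push X := Subtype.ext <| by
    refine (P2.law_meas volume (Lp.memLp Y)).trans ?_
    rw [Measure.map_congr l1.coeFn_toLp, m1]
    exact (m.push_meas hX).symm
  have e2 : P2.law volume Y' = m.push X' := Subtype.ext <| by
    refine (P2.law_meas volume (Lp.memLp Y')).trans ?_
    rw [Measure.map_congr l2.coeFn_toLp, m2]
    exact (m.push_meas hX').symm
  have hw : ∫ ω, ‖(Y - Y') ω‖ = ∫ y, ‖X y - X' y‖ ∂m.meas := by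
    have s1 : ∫ ω, ‖(Y - Y') ω‖ = ∫ ω, ‖(Z ω).1 - (Z ω).2‖ := by
      refine integral_congr_ae ?_
      filter_upwards [Lp.coeFn_sub Y Y', l1.coeFn_toLp, l2.coeFn_toLp] with ω h1 h2 h3
      rw [h1, Pi.sub_apply, h2, h3]
    have hc : Continuous fun q : Euc d × Euc d => ‖q.1 - q.2‖ := by fun_prop
    rw [s1, ← integral_map (φ := Z) (f := fun q => ‖q.1 - q.2‖) hZ.aemeasurable
      hc.aestronglyMeasurable, hmap, integral_map hXX hc.aestronglyMeasurable]
  choose D hD hDH using h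
  have hpath : ∀ θ : ℝ, HasDerivAt (fun θ : ℝ => Y' + θ • (Y - Y')) (Y - Y') θ := fun θ => by
    simpa using ((hasDerivAt_id θ).smul_const (Y - Y')).const_add Y'
  -- Mean value inequality along the segment from `Y'` to `Y` in `L²`. The representation of the
  -- derivative as an expectation, with a bounded kernel, yields the `L¹` norm of `Y - Y'`.
  have key := norm_image_sub_le_of_norm_deriv_le_segment_01'
    (f := fun θ : ℝ => F (P2.law volume (Y' + θ • (Y - Y') :
      Lp (Euc d) 2 (volume : Measure unitInterval))))
    (f' := fun θ => D (Y' + θ • (Y - Y')) (Y - Y')) (C := K * ∫ y, ‖X y - X' y‖ ∂m.meas)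
    (fun θ _ => ((hD _).comp_hasDerivAt θ (hpath θ)).hasDerivWithinAt)
    (fun θ _ => by
      rw [hDH, ← hw, ← integral_const_mul]
      refine norm_integral_le_of_norm_le ?_ (Eventually.of_forall fun ω =>
        (ContinuousLinearMap.le_opNorm _ _).trans (mul_le_mul_of_nonneg_right (hK _ _)
          (norm_nonneg _)))
      exact ((Lp.memLp (Y - Y')).integrable one_le_two).norm.const_mul K)
  simpa [e1, e2] using key

theorem AssumptionP.lip {p : Euc d → P2 d → Euc d} {px : Euc d → P2 d → Euc d →L[ℝ] Euc d}
    {pm : Euc d → P2 d → Euc d → Euc d →L[ℝ] Euc d} {Lp Lbarp : ℝ}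
    (h : AssumptionP p px pm Lp Lbarp) {m : P2 d} {X X' : Euc d → Euc d}
    (hX : MemLp X 2 m.meas) (hX' : MemLp X' 2 m.meas) (x x' : Euc d) :
    ‖p x (m.push X) - p x' (m.push X')‖ ≤ Lp * (‖x - x'‖ + ∫ y, ‖X y - X' y‖ ∂m.meas) := by
  have h1 := norm_sub_le_of_hasFDerivAt (x := x) (y := x') (fun z => h.dx z (m.push X))
    fun z _ => h.bdd_dx z _
  have h2 := (h.dm x').norm_sub_le (h.bdd_dm x') m hX hX'
  have := norm_sub_le_norm_sub_add_norm_sub (p x (m.push X)) (p x' (m.push X)) (p x' (m.push X'))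
  linarith

end LDerivative

/-! ### Growth and Lipschitz continuity of the optimal control. -/

section Control

/-- The coefficients satisfy the standing assumptions and all the constants are controlled by
`K`. -/
structure ControlledBy (f : Euc d → P2 d → Euc a → Euc d) (Df : Derivs d a (Euc d))
    (g : Euc d → P2 d → Euc a → ℝ) (Dg : Derivs d a ℝ)
    (lamf Lamf lbarf Lipf lamg Lamg lbarg lg Lbarp K : ℝ) : Prop where
  a1 : AssumptionA1 f Df lamf Lamf lbarf Lipf
  a2 : AssumptionA2 g Dg lamg Lamg lbarg lg
  Lbarp_pos : 0 < Lbarp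
  daa_small : ∀ x μ α, ‖Df.daa x μ α‖ * (1 + ‖x‖ + μ.norm1) ≤ 1 / (40 * Lbarp) * lamg
  one_le : 1 ≤ K
  Lbarp_le : Lbarp ≤ K
  Lbarp_inv_le : 1 ≤ K * Lbarp
  Lamf_le : Lamf ≤ K
  lbarf_le : lbarf ≤ K
  Lamg_le : Lamg ≤ K
  lbarg_le : lbarg ≤ K
  lamg_inv_le : 1 ≤ K * lamg
  f_zero : ‖f 0 (P2.dirac 0) 0‖ ≤ K
  dm_zero : ‖Dg.dm 0 (P2.dirac 0) 0 0‖ ≤ K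
  dx_zero : ‖Dg.dx 0 (P2.dirac 0) 0‖ ≤ K
  da_zero : ‖Dg.da 0 (P2.dirac 0) 0‖ ≤ K

theorem norm_grad {n : ℕ} (l : Euc n →L[ℝ] ℝ) : ‖grad l‖ = ‖l‖ :=
  (InnerProductSpace.toDual ℝ (Euc n)).symm.norm_map l

theorem norm_grad_sub {n : ℕ} (l l' : Euc n →L[ℝ] ℝ) : ‖grad l - grad l'‖ = ‖l - l'‖ := by
  rw [← norm_grad (l - l')]
  simp only [grad, map_sub]

theorem norm_adjoint_apply_le {n k : ℕ} (A : Euc n →L[ℝ] Euc k) (z : Euc k) :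
    ‖ContinuousLinearMap.adjoint A z‖ ≤ ‖A‖ * ‖z‖ := by
  rw [← ContinuousLinearMap.adjoint.norm_map A]
  exact ContinuousLinearMap.le_opNorm _ _

theorem norm_adjoint_sub_le {n k : ℕ} (A B : Euc n →L[ℝ] Euc k) (z z' : Euc k) :
    ‖ContinuousLinearMap.adjoint A z - ContinuousLinearMap.adjoint B z'‖ ≤
      ‖A - B‖ * ‖z‖ + ‖B‖ * ‖z - z'‖ := by
  have e : ContinuousLinearMap.adjoint A z - ContinuousLinearMap.adjoint B z' =
      ContinuousLinearMap.adjoint (A - B) z + ContinuousLinearMap.adjoint B (z - z') := by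
    simp only [map_sub, sub_apply]
    abel
  rw [e]
  exact (norm_add_le _ _).trans (add_le_add (norm_adjoint_apply_le _ _) (norm_adjoint_apply_le _ _))

theorem FirstOrderCondition.apply {Df : Derivs d a (Euc d)} {Dg : Derivs d a ℝ} {x : Euc d}
    {μ : P2 d} {z : Euc d} {α : Euc a} (h : FirstOrderCondition Df Dg x μ z α) (v : Euc a) :
    inner ℝ z (Df.da x μ α v) + Dg.da x μ α v = 0 := by
  have h1 : inner ℝ (ContinuousLinearMap.adjoint (Df.da x μ α) z + grad (Dg.da x μ α)) v =
      (0 : ℝ) := by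
    rw [show _ = (0 : Euc a) from h, inner_zero_left]
  rwa [inner_add_left, ContinuousLinearMap.adjoint_inner_left, grad,
    InnerProductSpace.toDual_symm_apply] at h1

/-- Strong convexity in the control yields strong monotonicity of the derivative. -/
theorem AssumptionA2.strong_monotone {g : Euc d → P2 d → Euc a → ℝ} {D : Derivs d a ℝ}
    {lamg Lamg lbarg lg : ℝ} (h : AssumptionA2 g D lamg Lamg lbarg lg) (x : Euc d) (μ : P2 d)
    (α α' : Euc a) :
    lamg * ‖α - α'‖ ^ 2 ≤ D.da x μ α (α - α') - D.da x μ α' (α - α') := by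
  set ξ := α - α'
  have hd : ∀ θ : ℝ, HasDerivAt (fun θ : ℝ => D.da x μ (α' + θ • ξ) ξ)
      (D.daa x μ (α' + θ • ξ) ξ ξ) θ := fun θ => by
    have hp : HasDerivAt (fun θ : ℝ => α' + θ • ξ) ξ θ := by
      simpa using ((hasDerivAt_id θ).smul_const ξ).const_add α'
    have := (h.derivs.daa x μ (α' + θ • ξ)).comp_hasDerivAt θ hp
    simpa using this.clm_apply (hasDerivAt_const θ ξ)
  obtain ⟨c, -, hc⟩ := exists_hasDerivAt_eq_slope _ _ (zero_lt_one' ℝ)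
    (fun θ _ => (hd θ).continuousAt.continuousWithinAt) fun θ _ => hd θ
  have hcv := h.convex_alpha x μ (α' + c • ξ) ξ
  rw [hc] at hcv
  simpa [ξ] using hcv

variable {f : Euc d → P2 d → Euc a → Euc d} {Df : Derivs d a (Euc d)}
  {g : Euc d → P2 d → Euc a → ℝ} {Dg : Derivs d a ℝ}
  {lamf Lamf lbarf Lipf lamg Lamg lbarg lg Lbarp K : ℝ}

theorem ControlledBy.bddg (h : ControlledBy f Df g Dg lamf Lamf lbarf Lipf lamg Lamg lbarg lg
    Lbarp K) : SecondDerivsBdd Dg K univ := h.a2.secondDerivsBdd h.Lamg_le h.lbarg_le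

theorem integral_norm_sub_zero (μ : P2 d) : ∫ y, ‖y - 0‖ ∂μ.meas = μ.norm1 := by simp [P2.norm1]

theorem le_of_mul_sq_le {l D B K : ℝ} (hK : 0 ≤ K) (hD : 0 ≤ D) (hB : 0 ≤ B)
    (h1 : 1 ≤ K * l) (h : l * D ^ 2 ≤ B * D) : D ≤ K * B := by
  rcases hD.eq_or_lt with rfl | hpos
  · positivity
  · have h2 : l * D ≤ B := by nlinarith
    nlinarith

/-- Strong monotonicity of `∂_α g` between `α` and `0`, combined with the first order condition
tested on `α`. Boundedness of `∂_α f` suffices, so no cone condition is involved. -/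
theorem ControlledBy.alpha_growth (h : ControlledBy f Df g Dg lamf Lamf lbarf Lipf lamg Lamg lbarg
    lg Lbarp K) {x : Euc d} {μ : P2 d} {z : Euc d} {α : Euc a}
    (hα : FirstOrderCondition Df Dg x μ z α) :
    ‖α‖ ≤ 2 * K ^ 2 * (1 + ‖x‖ + μ.norm1 + ‖z‖) := by
  have hK := h.one_le
  have hn := μ.norm1_nonneg
  have h0 : ‖Dg.da x μ 0‖ ≤ K + K * (‖x‖ + μ.norm1) := by
    -- `μ` and `δ₀` are the push-forwards of `μ` by the identity and by zero, at `L¹` distance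
    -- `‖μ‖₁`; this turns Lipschitz bounds into growth bounds.
    have := h.a2.derivs.da_lip h.bddg (m := μ) (X := fun x => x) (X' := fun _ => 0) (x := x)
      (x' := 0) μ.memLp (memLp_const 0) (PathIn.univ _ _ _ _) 0
    rw [P2.push_id, P2.push_zero, integral_norm_sub_zero, sub_zero] at this
    have e := norm_sub_norm_le (Dg.da x μ 0) (Dg.da 0 (P2.dirac 0) 0)
    linarith [h.da_zero]
  have hm := h.a2.strong_monotone x μ α 0
  simp only [sub_zero] at hm
  have hfoc := hα.apply α
  have b1 : -inner ℝ z (Df.da x μ α α) ≤ ‖z‖ * (K * ‖α‖) := by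
    refine (neg_le_abs _).trans ((abs_real_inner_le_norm _ _).trans ?_)
    gcongr
    exact ((Df.da x μ α).le_opNorm α).trans
      (by gcongr; exact (h.a1.bdd_da x μ α).trans h.Lamf_le)
  have b2 : -(Dg.da x μ 0 α) ≤ (K + K * (‖x‖ + μ.norm1)) * ‖α‖ :=
    (neg_le_abs _).trans (((Dg.da x μ 0).le_opNorm α).trans (by gcongr))
  have hfin := le_of_mul_sq_le (K := K) (l := lamg) (D := ‖α‖)
    (B := K * ‖z‖ + (K + K * (‖x‖ + μ.norm1))) (by positivity) (norm_nonneg _) (by positivity)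
    h.lamg_inv_le (by linarith)
  calc ‖α‖ ≤ _ := hfin
    _ = K ^ 2 * (1 + ‖x‖ + μ.norm1 + ‖z‖) := by ring
    _ ≤ 2 * K ^ 2 * (1 + ‖x‖ + μ.norm1 + ‖z‖) := by gcongr; nlinarith

/-- Here `r` is the weight `1 + |x| + ‖μ‖₁` and `ζ` the size of `z`: the weighted Lipschitz
estimates for `f` absorb the linear growth of `z` in the cone. -/
theorem ControlledBy.mul_le_of_cone (h : ControlledBy f Df g Dg lamf Lamf lbarf Lipf lamg Lamg
    lbarg lg Lbarp K) {v s r ζ : ℝ} (hv : 0 ≤ v) (hs : 0 ≤ s) (hr : 0 ≤ r) (hζ : ζ ≤ 2 * Lbarp * r)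
    (hvr : v * r ≤ 4 * (lbarf + Lamf) * s) : v * ζ ≤ 16 * K ^ 2 * s := by
  have hK := h.one_le
  have hLp := h.Lbarp_pos
  have h1 : v * r ≤ 4 * (K + K) * s := hvr.trans (by gcongr; exacts [h.lbarf_le, h.Lamf_le])
  calc v * ζ ≤ v * (2 * Lbarp * r) := by gcongr
    _ = 2 * Lbarp * (v * r) := by ring
    _ ≤ 2 * K * (4 * (K + K) * s) :=
        mul_le_mul (by linarith [h.Lbarp_le]) h1 (by positivity) (by positivity)
    _ = 16 * K ^ 2 * s := by ring

variable {m : P2 d} {X X' : Euc d → Euc d}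

/-- Subtract the two first order conditions, tested on `Δ = α - α'`, and telescope so that only `z`,
never `z'`, multiplies differences of `∂_α f`; so one point in the cone is enough. Strong
monotonicity of `∂_α g` gives `λ_g |Δ|²` against terms linear in `|Δ|`. -/
theorem ControlledBy.alpha_lip (h : ControlledBy f Df g Dg lamf Lamf lbarf Lipf lamg Lamg lbarg
    lg Lbarp K) (hX : MemLp X 2 m.meas) (hX' : MemLp X' 2 m.meas) {x x' z z' : Euc d}
    {α α' : Euc a} (hz : ‖z‖ ≤ 2 * Lbarp * (1 + ‖x‖ + (m.push X).norm1))
    (hα : FirstOrderCondition Df Dg x (m.push X) z α)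
    (hα' : FirstOrderCondition Df Dg x' (m.push X') z' α') :
    ‖α - α'‖ ≤ 20 * K ^ 3 * (‖x - x'‖ + ∫ y, ‖X y - X' y‖ ∂m.meas + ‖z - z'‖) := by
  have hK := h.one_le
  have hw : 0 ≤ ∫ y, ‖X y - X' y‖ ∂m.meas := integral_nonneg fun _ => norm_nonneg _
  have hn := (m.push X).norm1_nonneg
  set μ := m.push X
  set μ' := m.push X'
  set w := ∫ y, ‖X y - X' y‖ ∂m.meas
  set Δ := α - α'
  set r := 1 + ‖x‖ + μ.norm1
  have hr : 0 < r := by positivity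
  have hLp := h.Lbarp_pos
  have hlam := h.a2.lamg_pos
  have hm := h.a2.strong_monotone x μ α α'
  have f1 := hα.apply Δ
  have f2 := hα'.apply Δ
  -- The only other term quadratic in `Δ`. The cone factor `2 L̄_p` times the smallness `λ_g / (40
  -- L̄_p)` of `∂_α∂_α f` leaves `λ_g / 20`, so `19/20` of the convexity survives.
  have t1 : -inner ℝ z ((Df.da x μ α - Df.da x μ α') Δ) ≤ lamg / 20 * ‖Δ‖ ^ 2 := by
    have hd : ‖Df.da x μ α - Df.da x μ α'‖ ≤ 1 / (40 * Lbarp) * lamg / r * ‖Δ‖ :=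
      norm_sub_le_of_hasFDerivAt (h.a1.derivs.daa x μ) fun β _ =>
        (le_div_iff₀ hr).2 (h.daa_small x μ β)
    calc _ ≤ ‖z‖ * (‖Df.da x μ α - Df.da x μ α'‖ * ‖Δ‖) :=
          (neg_le_abs _).trans ((abs_real_inner_le_norm _ _).trans
            (mul_le_mul_of_nonneg_left (ContinuousLinearMap.le_opNorm _ _) (norm_nonneg _)))
      _ ≤ (2 * Lbarp * r) * ((1 / (40 * Lbarp) * lamg / r * ‖Δ‖) * ‖Δ‖) := by gcongr
      _ = lamg / 20 * ‖Δ‖ ^ 2 := by field_simp; ring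
  have t2 : -inner ℝ z ((Df.da x μ α' - Df.da x' μ' α') Δ) ≤ 16 * K ^ 2 * (‖x - x'‖ + w) * ‖Δ‖ := by
    have hd := h.a1.da_lip hX hX' x x' α'
    calc _ ≤ ‖z‖ * (‖Df.da x μ α' - Df.da x' μ' α'‖ * ‖Δ‖) :=
          (neg_le_abs _).trans ((abs_real_inner_le_norm _ _).trans
            (mul_le_mul_of_nonneg_left (ContinuousLinearMap.le_opNorm _ _) (norm_nonneg _)))
      _ = (‖Df.da x μ α' - Df.da x' μ' α'‖ * ‖z‖) * ‖Δ‖ := by ring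
      _ ≤ _ := mul_le_mul_of_nonneg_right (h.mul_le_of_cone (norm_nonneg _) (by positivity) hr.le
          hz hd) (norm_nonneg _)
  have t3 : -inner ℝ (z - z') (Df.da x' μ' α' Δ) ≤ K * ‖z - z'‖ * ‖Δ‖ := by
    calc _ ≤ ‖z - z'‖ * (‖Df.da x' μ' α'‖ * ‖Δ‖) :=
          (neg_le_abs _).trans ((abs_real_inner_le_norm _ _).trans
            (mul_le_mul_of_nonneg_left (ContinuousLinearMap.le_opNorm _ _) (norm_nonneg _)))
      _ ≤ ‖z - z'‖ * (K * ‖Δ‖) := by gcongr; exact (h.a1.bdd_da _ _ _).trans h.Lamf_le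
      _ = _ := by ring
  have t4 : -((Dg.da x μ α' - Dg.da x' μ' α') Δ) ≤ K * (‖x - x'‖ + w) * ‖Δ‖ :=
    calc _ ≤ ‖Dg.da x μ α' - Dg.da x' μ' α'‖ * ‖Δ‖ :=
          (neg_le_abs _).trans ((Dg.da x μ α' - Dg.da x' μ' α').le_opNorm Δ)
      _ ≤ _ := mul_le_mul_of_nonneg_right
          (h.a2.derivs.da_lip h.bddg hX hX' (PathIn.univ _ _ _ _) α') (norm_nonneg _)
  simp only [sub_apply, inner_sub_right, inner_sub_left] at t1 t2 t3 t4
  have hKK : 1 ≤ K * (20 / 19 * (19 / 20 * lamg)) := by linarith [h.lamg_inv_le]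
  have hfin := le_of_mul_sq_le (K := K * (20 / 19)) (l := 19 / 20 * lamg) (D := ‖Δ‖)
    (B := 16 * K ^ 2 * (‖x - x'‖ + w) + K * ‖z - z'‖ + K * (‖x - x'‖ + w)) (by positivity)
    (norm_nonneg _) (by positivity) (by linarith) (by linarith)
  have hK2 : K ≤ K ^ 2 := by nlinarith
  calc ‖Δ‖ ≤ _ := hfin
    _ ≤ K * (20 / 19) * (16 * K ^ 2 * (‖x - x'‖ + w) + K ^ 2 * ‖z - z'‖ +
        K ^ 2 * (‖x - x'‖ + w)) := by gcongr
    _ = K ^ 3 * (340 / 19 * (‖x - x'‖ + w) + 20 / 19 * ‖z - z'‖) := by ring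
    _ ≤ K ^ 3 * (20 * (‖x - x'‖ + w + ‖z - z'‖)) := by
        gcongr
        linarith [norm_nonneg (x - x'), norm_nonneg (z - z')]
    _ = _ := by ring

end Control

end MFTC

/-! ### Growth and Lipschitz bounds for the right-hand sides of the system. -/

namespace MFTC

variable {d a : ℕ}

section Rates

/-- The integrand of the nonlocal term of the backward equation. -/
def interaction (Df : Derivs d a (Euc d)) (Dg : Derivs d a ℝ) (α : Euc d → P2 d → Euc d → Euc a)
    (m : P2 d) (X Z : Euc d → Euc d) (x y : Euc d) : Euc d :=
  ContinuousLinearMap.adjoint (Df.dm (X y) (m.push X) (α (X y) (m.push X) (Z y)) (X x)) (Z y) +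
    grad (Dg.dm (X y) (m.push X) (α (X y) (m.push X) (Z y)) (X x))

/-- The right-hand side of the forward equation. -/
def forwardRate (f : Euc d → P2 d → Euc a → Euc d) (α : Euc d → P2 d → Euc d → Euc a)
    (m : P2 d) (X Z : Euc d → Euc d) (x : Euc d) : Euc d :=
  f (X x) (m.push X) (α (X x) (m.push X) (Z x))

/-- The right-hand side of the backward equation. -/
def backwardRate (Df : Derivs d a (Euc d)) (Dg : Derivs d a ℝ) (α : Euc d → P2 d → Euc d → Euc a)
    (m : P2 d) (X Z : Euc d → Euc d) (x : Euc d) : Euc d :=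
  - ContinuousLinearMap.adjoint (Df.dx (X x) (m.push X) (α (X x) (m.push X) (Z x))) (Z x)
    - grad (Dg.dx (X x) (m.push X) (α (X x) (m.push X) (Z x)))
    - ∫ y, interaction Df Dg α m X Z x y ∂m.meas

/-- The conditions that a solution pair satisfies at a fixed time. -/
structure IsAdmissible (Df : Derivs d a (Euc d)) (Dg : Derivs d a ℝ)
    (α : Euc d → P2 d → Euc d → Euc a) (m : P2 d) (X Z : Euc d → Euc d) : Prop where
  memLp : MemLp X 2 m.meas
  integrable_Z : Integrable Z m.meas
  optimal : ∀ x, FirstOrderCondition Df Dg (X x) (m.push X) (Z x) (α (X x) (m.push X) (Z x))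
  integrable : ∀ x, Integrable (interaction Df Dg α m X Z x) m.meas

variable {f : Euc d → P2 d → Euc a → Euc d} {Df : Derivs d a (Euc d)}
  {g : Euc d → P2 d → Euc a → ℝ} {Dg : Derivs d a ℝ} {α : Euc d → P2 d → Euc d → Euc a}
  {lamf Lamf lbarf Lipf lamg Lamg lbarg lg Lbarp K : ℝ} {m : P2 d} {X Z X' Z' : Euc d → Euc d}

theorem IsAdmissible.integrable_X (h : IsAdmissible Df Dg α m X Z) : Integrable X m.meas :=
  h.memLp.integrable one_le_two

theorem IsAdmissible.integrable_pair (h : IsAdmissible Df Dg α m X Z) :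
    Integrable (fun y => (X y, Z y)) m.meas := h.integrable_X.prodMk h.integrable_Z

section Growth

variable (h : ControlledBy f Df g Dg lamf Lamf lbarf Lipf lamg Lamg lbarg lg Lbarp K)
  {x z : Euc d} {μ : P2 d} {β : Euc a} (hβ : FirstOrderCondition Df Dg x μ z β)

include h hβ

theorem ControlledBy.f_growth : ‖f x μ β‖ ≤ 3 * K ^ 3 * (1 + ‖x‖ + μ.norm1 + ‖z‖) := by
  have hK := h.one_le
  have hn := μ.norm1_nonneg
  have hα := h.alpha_growth hβ
  have hl := h.a1.derivs.lip (K := K) (m := μ) (X := fun x => x) (X' := fun _ => 0)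
    (fun _ _ _ => (h.a1.bdd_dx _ _ _).trans h.Lamf_le)
    (fun _ _ _ => (h.a1.bdd_da _ _ _).trans h.Lamf_le)
    (fun _ _ _ _ => (h.a1.bdd_dm _ _ _ _).trans h.Lamf_le) μ.memLp (memLp_const 0) x 0 β 0
  rw [P2.push_id, P2.push_zero, integral_norm_sub_zero, sub_zero, sub_zero] at hl
  have e := norm_sub_norm_le (f x μ β) (f 0 (P2.dirac 0) 0)
  have hf := h.f_zero
  set R := 1 + ‖x‖ + μ.norm1 + ‖z‖ with hR
  have hR1 : 0 ≤ R := by positivity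
  calc ‖f x μ β‖ ≤ K * (1 + ‖x‖ + μ.norm1 + ‖β‖) := by linarith
    _ ≤ K * (R + 2 * K ^ 2 * R) := by gcongr; linarith [norm_nonneg z]
    _ ≤ K * (K ^ 2 * R + 2 * K ^ 2 * R) := by gcongr; nlinarith [one_le_pow₀ (n := 2) hK]
    _ = 3 * K ^ 3 * R := by ring

theorem ControlledBy.gx_growth : ‖Dg.dx x μ β‖ ≤ 3 * K ^ 3 * (1 + ‖x‖ + μ.norm1 + ‖z‖) := by
  have hK := h.one_le
  have hn := μ.norm1_nonneg
  have hα := h.alpha_growth hβ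
  have hl := h.a2.derivs.dx_lip h.bddg (m := μ) (X := fun x => x) (X' := fun _ => 0)
    μ.memLp (memLp_const 0) (PathIn.univ x 0 _ _) β 0
  rw [P2.push_id, P2.push_zero, integral_norm_sub_zero, sub_zero, sub_zero] at hl
  have e := norm_sub_norm_le (Dg.dx x μ β) (Dg.dx 0 (P2.dirac 0) 0)
  have hf := h.dx_zero
  set R := 1 + ‖x‖ + μ.norm1 + ‖z‖ with hR
  have hR1 : 0 ≤ R := by positivity
  calc ‖Dg.dx x μ β‖ ≤ K * (1 + ‖x‖ + μ.norm1 + ‖β‖) := by linarith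
    _ ≤ K * (R + 2 * K ^ 2 * R) := by gcongr; linarith [norm_nonneg z]
    _ ≤ K * (K ^ 2 * R + 2 * K ^ 2 * R) := by gcongr; nlinarith [one_le_pow₀ (n := 2) hK]
    _ = 3 * K ^ 3 * R := by ring

theorem ControlledBy.gm_growth (y : Euc d) :
    ‖Dg.dm x μ β y‖ ≤ 3 * K ^ 3 * (1 + ‖x‖ + μ.norm1 + ‖z‖ + ‖y‖) := by
  have hK := h.one_le
  have hn := μ.norm1_nonneg
  have hα := h.alpha_growth hβ
  have hl := h.a2.derivs.dm_lip h.bddg (m := μ) (X := fun x => x) (X' := fun _ => 0)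
    μ.memLp (memLp_const 0) (PathIn.univ x 0 _ _) β 0 y 0
  rw [P2.push_id, P2.push_zero, integral_norm_sub_zero, sub_zero, sub_zero, sub_zero] at hl
  have e := norm_sub_norm_le (Dg.dm x μ β y) (Dg.dm 0 (P2.dirac 0) 0 0)
  have hf := h.dm_zero
  set R := 1 + ‖x‖ + μ.norm1 + ‖z‖ with hR
  have hR1 : 0 ≤ R := by positivity
  have hR2 : 0 ≤ R + ‖y‖ := by positivity
  calc ‖Dg.dm x μ β y‖ ≤ K * (1 + ‖x‖ + μ.norm1 + ‖y‖ + ‖β‖) := by linarith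
    _ ≤ K * ((R + ‖y‖) + 2 * K ^ 2 * (R + ‖y‖)) := by
        gcongr
        · linarith [norm_nonneg z]
        · exact hα.trans (by gcongr; linarith [norm_nonneg y])
    _ ≤ K * (K ^ 2 * (R + ‖y‖) + 2 * K ^ 2 * (R + ‖y‖)) := by
        gcongr; nlinarith [one_le_pow₀ (n := 2) hK]
    _ = 3 * K ^ 3 * (R + ‖y‖) := by ring

end Growth

theorem mul_norm_le_cube {K v z R : ℝ} (hK : 1 ≤ K) (hv : v ≤ K) (hz : 0 ≤ z) (hzR : z ≤ R) :
    v * z ≤ K ^ 3 * R := by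
  have : K ≤ K ^ 3 := le_self_pow₀ hK (by norm_num)
  calc v * z ≤ K ^ 3 * z := by gcongr; linarith
    _ ≤ K ^ 3 * R := by gcongr

theorem norm_integral_le_of_affine_bound (m : P2 d) {φ : Euc d → Euc d} {ψ : Euc d → ℝ} {C A : ℝ}
    (hψ : Integrable ψ m.meas) (hφ : ∀ y, ‖φ y‖ ≤ C * (A + 2 * ψ y)) :
    ‖∫ y, φ y ∂m.meas‖ ≤ C * (A + 2 * ∫ y, ψ y ∂m.meas) := by
  have hi : Integrable (fun y => A + 2 * ψ y) m.meas :=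
    (integrable_const A).add (hψ.const_mul 2)
  refine (norm_integral_le_of_norm_le (hi.const_mul C) (Eventually.of_forall hφ)).trans_eq ?_
  rw [integral_const_mul, integral_add (integrable_const A) (hψ.const_mul 2), integral_const_mul]
  simp

variable (h : ControlledBy f Df g Dg lamf Lamf lbarf Lipf lamg Lamg lbarg lg Lbarp K)

include h

/-- The first derivatives of `f` are bounded, so `Z` enters linearly and the cone is not needed. It
cannot be assumed here, since this bound serves to prove it. -/
theorem ControlledBy.rate_growth (hX : IsAdmissible Df Dg α m X Z) (x : Euc d) :
    ‖(forwardRate f α m X Z x, backwardRate Df Dg α m X Z x)‖ ≤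
      16 * K ^ 3 * (1 + ‖(X x, Z x)‖ + ∫ y, ‖(X y, Z y)‖ ∂m.meas) := by
  have hK := h.one_le
  have hK3 : 0 ≤ K ^ 3 := by positivity
  set n := ∫ y, ‖(X y, Z y)‖ ∂m.meas with hn
  have hM : (m.push X).norm1 ≤ n := by
    rw [m.norm1_push hX.memLp]
    exact integral_mono hX.integrable_X.norm hX.integrable_pair.norm fun y => norm_fst_le (X y, Z y)
  have hM0 := (m.push X).norm1_nonneg
  set M := (m.push X).norm1
  have h1 : ‖X x‖ ≤ ‖(X x, Z x)‖ := norm_fst_le (X x, Z x)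
  have h2 : ‖Z x‖ ≤ ‖(X x, Z x)‖ := norm_snd_le (X x, Z x)
  have hn0 : 0 ≤ n := hM0.trans hM
  set u := ‖(X x, Z x)‖
  have hx := hX.optimal x
  have hR : 1 + ‖X x‖ + M + ‖Z x‖ ≤ 1 + 2 * u + n := by linarith
  have b1 := (h.f_growth hx).trans (mul_le_mul_of_nonneg_left hR (by positivity))
  have b2 := (h.gx_growth hx).trans (mul_le_mul_of_nonneg_left hR (by positivity))
  have b3 : ‖ContinuousLinearMap.adjoint (Df.dx (X x) (m.push X)
      (α (X x) (m.push X) (Z x))) (Z x)‖ ≤ K ^ 3 * u :=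
    (norm_adjoint_apply_le _ _).trans (mul_norm_le_cube hK
      ((h.a1.bdd_dx _ _ _).trans h.Lamf_le) (norm_nonneg _) h2)
  have b4 : ‖∫ y, interaction Df Dg α m X Z x y ∂m.meas‖ ≤ 4 * K ^ 3 * (1 + u + 3 * n) := by
    have hpt : ∀ y, ‖interaction Df Dg α m X Z x y‖ ≤
        4 * K ^ 3 * ((1 + u + n) + 2 * ‖(X y, Z y)‖) := by
      intro y
      have hy1 : ‖X y‖ ≤ ‖(X y, Z y)‖ := norm_fst_le (X y, Z y)
      have hy2 : ‖Z y‖ ≤ ‖(X y, Z y)‖ := norm_snd_le (X y, Z y)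
      have c1 : ‖ContinuousLinearMap.adjoint (Df.dm (X y) (m.push X)
          (α (X y) (m.push X) (Z y)) (X x)) (Z y)‖ ≤
          K ^ 3 * ((1 + u + n) + 2 * ‖(X y, Z y)‖) :=
        (norm_adjoint_apply_le _ _).trans (mul_norm_le_cube hK
          ((h.a1.bdd_dm _ _ _ _).trans h.Lamf_le) (norm_nonneg _)
          (by linarith [norm_nonneg (X x, Z x), norm_nonneg (Z y)]))
      have c2 := h.gm_growth (hX.optimal y) (X x)
      have c3 : 3 * K ^ 3 * (1 + ‖X y‖ + M + ‖Z y‖ + ‖X x‖) ≤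
          3 * K ^ 3 * ((1 + u + n) + 2 * ‖(X y, Z y)‖) := by
        gcongr ?_ * ?_; linarith
      refine (norm_add_le _ _).trans ?_
      rw [norm_grad]
      linarith
    refine (norm_integral_le_of_affine_bound m hX.integrable_pair.norm hpt).trans_eq ?_
    rw [← hn]
    ring
  have hu0 : 0 ≤ u := norm_nonneg _
  refine norm_prod_le_iff.2 ⟨b1.trans ?_, ?_⟩
  · have : 3 * (1 + 2 * u + n) ≤ 16 * (1 + u + n) := by linarith
    nlinarith
  · have e : ‖backwardRate Df Dg α m X Z x‖ ≤ K ^ 3 * u + 3 * K ^ 3 * (1 + 2 * u + n) +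
        4 * K ^ 3 * (1 + u + 3 * n) := by
      refine (norm_sub_le _ _).trans (add_le_add ((norm_sub_le _ _).trans ?_) b4)
      rw [norm_neg, norm_grad]
      exact add_le_add b3 b2
    refine e.trans ?_
    have : u + 3 * (1 + 2 * u + n) + 4 * (1 + u + 3 * n) ≤ 16 * (1 + u + n) := by linarith
    nlinarith

/-- The products of derivatives of `f` with `Z` are split so that differences of derivatives meet
`Z` (in the cone) and bounded derivatives meet `Z - Z'`; the remaining terms are Lipschitz in state,
law and control, and the control is eliminated by `ControlledBy.alpha_lip`. -/
theorem ControlledBy.rate_lip (hX : IsAdmissible Df Dg α m X Z)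
    (hX' : IsAdmissible Df Dg α m X' Z')
    (hcone : ∀ x, ‖Z x‖ ≤ 2 * Lbarp * (1 + ‖X x‖ + (m.push X).norm1)) (x : Euc d) :
    ‖(forwardRate f α m X Z x - forwardRate f α m X' Z' x,
        backwardRate Df Dg α m X Z x - backwardRate Df Dg α m X' Z' x)‖ ≤
      1500 * K ^ 5 * (‖(X x - X' x, Z x - Z' x)‖ +
        ∫ y, ‖(X y - X' y, Z y - Z' y)‖ ∂m.meas) := by
  have hK := h.one_le
  have hK0 : 0 ≤ K := by linarith
  have hM0 := (m.push X).norm1_nonneg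
  set A : Euc d → Euc a := fun y => α (X y) (m.push X) (Z y)
  set A' : Euc d → Euc a := fun y => α (X' y) (m.push X') (Z' y)
  set w := ∫ y, ‖X y - X' y‖ ∂m.meas with hw
  have hw0 : 0 ≤ w := integral_nonneg fun _ => norm_nonneg _
  set n := ∫ y, ‖(X y - X' y, Z y - Z' y)‖ ∂m.meas with hn
  have iX : Integrable (fun y => X y - X' y) m.meas := hX.integrable_X.sub hX'.integrable_X
  have iZ : Integrable (fun y => Z y - Z' y) m.meas := hX.integrable_Z.sub hX'.integrable_Z
  have iU : Integrable (fun y => (X y - X' y, Z y - Z' y)) m.meas := iX.prodMk iZ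
  have hwn : w ≤ n := integral_mono iX.norm iU.norm fun y => norm_fst_le (X y - X' y, Z y - Z' y)
  set S : Euc d → ℝ := fun y => ‖X y - X' y‖ + w + ‖Z y - Z' y‖ with hS
  have hS0 : ∀ y, 0 ≤ S y := fun y => by positivity
  have hSU : ∀ y, S y ≤ 2 * ‖(X y - X' y, Z y - Z' y)‖ + n := fun y => by
    have h1 : ‖X y - X' y‖ ≤ _ := norm_fst_le (X y - X' y, Z y - Z' y)
    have h2 : ‖Z y - Z' y‖ ≤ _ := norm_snd_le (X y - X' y, Z y - Z' y)
    simp only [hS]; linarith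
  have hA : ∀ y, ‖X y - X' y‖ + w + ‖A y - A' y‖ ≤ 21 * K ^ 3 * S y := fun y => by
    have h1 := h.alpha_lip hX.memLp hX'.memLp (hcone y) (hX.optimal y) (hX'.optimal y)
    have h2 : ‖X y - X' y‖ + w ≤ K ^ 3 * S y := by
      have : S y ≤ K ^ 3 * S y := le_mul_of_one_le_left (hS0 y) (one_le_pow₀ hK)
      have : ‖X y - X' y‖ + w ≤ S y := le_add_of_nonneg_right (norm_nonneg _)
      linarith
    have h3 : ‖A y - A' y‖ ≤ 20 * K ^ 3 * S y := h1
    linarith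
  have hK45 : K ^ 4 ≤ K ^ 5 := pow_le_pow_right₀ hK (by norm_num)
  have hK15 : K ≤ K ^ 5 := le_self_pow₀ hK (by norm_num)
  have hr : ∀ y, 0 ≤ 1 + ‖X y‖ + (m.push X).norm1 := fun y => by positivity
  -- the drift
  have b1 : ‖forwardRate f α m X Z x - forwardRate f α m X' Z' x‖ ≤ 21 * K ^ 5 * S x := by
    have := h.a1.derivs.lip (K := K) (fun _ _ _ => (h.a1.bdd_dx _ _ _).trans h.Lamf_le)
      (fun _ _ _ => (h.a1.bdd_da _ _ _).trans h.Lamf_le)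
      (fun _ _ _ _ => (h.a1.bdd_dm _ _ _ _).trans h.Lamf_le) hX.memLp hX'.memLp (X x) (X' x)
      (A x) (A' x)
    calc _ ≤ K * (‖X x - X' x‖ + w + ‖A x - A' x‖) := this
      _ ≤ K * (21 * K ^ 3 * S x) := mul_le_mul_of_nonneg_left (hA x) hK0
      _ = 21 * (K ^ 4 * S x) := by ring
      _ ≤ 21 * (K ^ 5 * S x) := by gcongr
      _ = _ := by ring
  -- the local terms of the backward equation
  have b2 : ‖ContinuousLinearMap.adjoint (Df.dx (X x) (m.push X) (A x)) (Z x) -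
      ContinuousLinearMap.adjoint (Df.dx (X' x) (m.push X') (A' x)) (Z' x)‖ ≤
      337 * K ^ 5 * S x := by
    refine (norm_adjoint_sub_le _ _ _ _).trans ?_
    have c1 := h.mul_le_of_cone (norm_nonneg _) (by positivity) (hr x) (hcone x)
      (h.a1.dx_lip hX.memLp hX'.memLp (X x) (X' x) (A x) (A' x))
    have c2 : 16 * K ^ 2 * (‖X x - X' x‖ + w + ‖A x - A' x‖) ≤ 16 * K ^ 2 * (21 * K ^ 3 * S x) :=
      mul_le_mul_of_nonneg_left (hA x) (by positivity)
    have c3 : ‖Df.dx (X' x) (m.push X') (A' x)‖ * ‖Z x - Z' x‖ ≤ K ^ 5 * S x := by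
      refine mul_le_mul (((h.a1.bdd_dx _ _ _).trans h.Lamf_le).trans hK15) ?_ (norm_nonneg _)
        (by positivity)
      simp only [hS]; linarith [norm_nonneg (X x - X' x)]
    calc _ ≤ 16 * K ^ 2 * (21 * K ^ 3 * S x) + K ^ 5 * S x := add_le_add (c1.trans c2) c3
      _ = _ := by ring
  have b3 : ‖grad (Dg.dx (X x) (m.push X) (A x)) - grad (Dg.dx (X' x) (m.push X') (A' x))‖ ≤
      21 * K ^ 5 * S x := by
    rw [norm_grad_sub]
    have := h.a2.derivs.dx_lip h.bddg hX.memLp hX'.memLp (PathIn.univ (X x) (X' x) _ _) (A x) (A' x)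
    calc _ ≤ K * (‖X x - X' x‖ + w + ‖A x - A' x‖) := this
      _ ≤ K * (21 * K ^ 3 * S x) := mul_le_mul_of_nonneg_left (hA x) hK0
      _ = 21 * (K ^ 4 * S x) := by ring
      _ ≤ 21 * (K ^ 5 * S x) := by gcongr
      _ = _ := by ring
  -- the nonlocal term
  have hpt : ∀ y, ‖interaction Df Dg α m X Z x y - interaction Df Dg α m X' Z' x y‖ ≤
      358 * K ^ 5 * ((n + ‖X x - X' x‖) + 2 * ‖(X y - X' y, Z y - Z' y)‖) := by
    intro y
    have hAy : ‖X y - X' y‖ + w + ‖A y - A' y‖ + ‖X x - X' x‖ ≤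
        21 * K ^ 3 * (S y + ‖X x - X' x‖) := by
      have : ‖X x - X' x‖ ≤ 21 * K ^ 3 * ‖X x - X' x‖ :=
        le_mul_of_one_le_left (norm_nonneg _) (by linarith [one_le_pow₀ (n := 3) hK])
      linarith [hA y]
    have hT0 : 0 ≤ S y + ‖X x - X' x‖ := add_nonneg (hS0 y) (norm_nonneg _)
    have d1 : ‖ContinuousLinearMap.adjoint (Df.dm (X y) (m.push X) (A y) (X x)) (Z y) -
        ContinuousLinearMap.adjoint (Df.dm (X' y) (m.push X') (A' y) (X' x)) (Z' y)‖ ≤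
        337 * K ^ 5 * (S y + ‖X x - X' x‖) := by
      refine (norm_adjoint_sub_le _ _ _ _).trans ?_
      have c1 := h.mul_le_of_cone (norm_nonneg _) (by positivity) (hr y) (hcone y)
        (h.a1.dm_lip hX.memLp hX'.memLp (X y) (X' y) (A y) (A' y) (X x) (X' x))
      rw [← add_assoc] at c1
      have c2 := mul_le_mul_of_nonneg_left hAy (show 0 ≤ 16 * K ^ 2 by positivity)
      have c3 : ‖Df.dm (X' y) (m.push X') (A' y) (X' x)‖ * ‖Z y - Z' y‖ ≤
          K ^ 5 * (S y + ‖X x - X' x‖) := by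
        refine mul_le_mul (((h.a1.bdd_dm _ _ _ _).trans h.Lamf_le).trans hK15) ?_ (norm_nonneg _)
          (by positivity)
        simp only [hS]; linarith [norm_nonneg (X x - X' x), norm_nonneg (X y - X' y)]
      calc _ ≤ 16 * K ^ 2 * (21 * K ^ 3 * (S y + ‖X x - X' x‖)) + K ^ 5 * (S y + ‖X x - X' x‖) :=
            add_le_add (c1.trans c2) c3
        _ = _ := by ring
    have d2 : ‖grad (Dg.dm (X y) (m.push X) (A y) (X x)) -
        grad (Dg.dm (X' y) (m.push X') (A' y) (X' x))‖ ≤ 21 * K ^ 5 * (S y + ‖X x - X' x‖) := by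
      rw [norm_grad_sub]
      have := h.a2.derivs.dm_lip h.bddg hX.memLp hX'.memLp (PathIn.univ (X y) (X' y) _ _)
        (A y) (A' y) (X x) (X' x)
      calc _ ≤ K * (‖X y - X' y‖ + w + ‖A y - A' y‖ + ‖X x - X' x‖) := this
        _ ≤ K * (21 * K ^ 3 * (S y + ‖X x - X' x‖)) := mul_le_mul_of_nonneg_left hAy hK0
        _ = 21 * (K ^ 4 * (S y + ‖X x - X' x‖)) := by ring
        _ ≤ 21 * (K ^ 5 * (S y + ‖X x - X' x‖)) := by gcongr
        _ = _ := by ring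
    calc _ ≤ 337 * K ^ 5 * (S y + ‖X x - X' x‖) + 21 * K ^ 5 * (S y + ‖X x - X' x‖) := by
          rw [interaction, interaction, add_sub_add_comm]
          exact (norm_add_le _ _).trans (add_le_add d1 d2)
      _ = 358 * K ^ 5 * (S y + ‖X x - X' x‖) := by ring
      _ ≤ _ := by gcongr ?_ * ?_; linarith [hSU y]
  have b4 : ‖∫ y, interaction Df Dg α m X Z x y ∂m.meas -
      ∫ y, interaction Df Dg α m X' Z' x y ∂m.meas‖ ≤
      358 * K ^ 5 * (‖X x - X' x‖ + 3 * n) := by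
    rw [← integral_sub (hX.integrable x) (hX'.integrable x)]
    refine (norm_integral_le_of_affine_bound m iU.norm hpt).trans_eq ?_
    rw [← hn]
    ring
  have hx1 : ‖X x - X' x‖ ≤ ‖(X x - X' x, Z x - Z' x)‖ := norm_fst_le (X x - X' x, Z x - Z' x)
  set u := ‖(X x - X' x, Z x - Z' x)‖
  have hu0 : 0 ≤ u := norm_nonneg _
  have hn0 : 0 ≤ n := hw0.trans hwn
  have hSx := hSU x
  have hK5 : 0 ≤ K ^ 5 := by positivity
  have hprod : K ^ 5 * S x ≤ K ^ 5 * (2 * u + n) := mul_le_mul_of_nonneg_left hSx hK5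
  have hprod' : K ^ 5 * ‖X x - X' x‖ ≤ K ^ 5 * u := mul_le_mul_of_nonneg_left hx1 hK5
  have hun : 0 ≤ K ^ 5 * u := mul_nonneg hK5 hu0
  have hnn : 0 ≤ K ^ 5 * n := mul_nonneg hK5 hn0
  refine norm_prod_le_iff.2 ⟨b1.trans (by linarith), ?_⟩
  have e : backwardRate Df Dg α m X Z x - backwardRate Df Dg α m X' Z' x =
      -(ContinuousLinearMap.adjoint (Df.dx (X x) (m.push X) (A x)) (Z x) -
        ContinuousLinearMap.adjoint (Df.dx (X' x) (m.push X') (A' x)) (Z' x)) -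
      (grad (Dg.dx (X x) (m.push X) (A x)) - grad (Dg.dx (X' x) (m.push X') (A' x))) -
      (∫ y, interaction Df Dg α m X Z x y ∂m.meas -
        ∫ y, interaction Df Dg α m X' Z' x y ∂m.meas) := by
    simp only [backwardRate, A, A']
    abel
  have e' : ‖backwardRate Df Dg α m X Z x - backwardRate Df Dg α m X' Z' x‖ ≤
      337 * K ^ 5 * S x + 21 * K ^ 5 * S x + 358 * K ^ 5 * (‖X x - X' x‖ + 3 * n) := by
    rw [e]
    refine (norm_sub_le _ _).trans (add_le_add ((norm_sub_le _ _).trans (add_le_add ?_ b3)) b4)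
    rw [norm_neg]
    exact b2
  -- As `S x ≤ 2u + n`, the sum is at most `358 K⁵ (3u + 4n)`, and `4 · 358 = 1432 ≤ 1500`.
  refine e'.trans ?_
  show _ ≤ 1500 * K ^ 5 * (u + n)
  linarith

end Rates

end MFTC

/-! ### The cone property and uniqueness on short intervals. -/

namespace MFTC

variable {d a : ℕ} {f : Euc d → P2 d → Euc a → Euc d} {Df : Derivs d a (Euc d)}
  {g : Euc d → P2 d → Euc a → ℝ} {Dg : Derivs d a ℝ} {p : Euc d → P2 d → Euc d}
  {α : Euc d → P2 d → Euc d → Euc a}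
  {lamf Lamf lbarf Lipf lamg Lamg lbarg lg Lbarp K t T : ℝ} {m : P2 d}
  {X Z X' Z' : ℝ → Euc d → Euc d}

theorem IsFBODESolution.admissible (h : IsFBODESolution f Df Dg p α t T m X Z) {s : ℝ}
    (hs : s ∈ Icc t T) : IsAdmissible Df Dg α m (X s) (Z s) :=
  ⟨h.memLp_X s hs, h.integrable_Z s hs, h.optimal s hs, h.integrable s hs⟩

theorem IsFBODESolution.hasDerivWithinAt (h : IsFBODESolution f Df Dg p α t T m X Z) {s : ℝ}
    (hs : s ∈ Icc t T) (x : Euc d) : HasDerivWithinAt (fun r => (X r x, Z r x))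
      (forwardRate f α m (X s) (Z s) x, backwardRate Df Dg α m (X s) (Z s) x) (Icc t T) s :=
  (h.forward s hs x).prodMk (h.backward s hs x)

variable (h : ControlledBy f Df g Dg lamf Lamf lbarf Lipf lamg Lamg lbarg lg Lbarp K)

include h

/-- On short time intervals the backward component of a solution stays in the cone. -/
theorem IsFBODESolution.mem_cone (hS : IsFBODESolution f Df Dg p α t T m X Z)
    (hp : ∀ x μ, ‖p x μ‖ ≤ Lbarp * (1 + ‖x‖ + μ.norm1)) (htT : t ≤ T)
    (hshort : 168000 * K ^ 8 * (T - t) ≤ 1) {s : ℝ} (hs : s ∈ Icc t T) (x : Euc d) :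
    ‖Z s x‖ ≤ 2 * Lbarp * (1 + ‖X s x‖ + (m.push (X s)).norm1) := by
  have hK := h.one_le
  have hLp := h.Lbarp_pos
  have hT : T ∈ Icc t T := ⟨htT, le_rfl⟩
  have hδ : 0 ≤ T - t := by linarith
  -- `η` is the oscillation factor of `norm_sub_le_of_nonlocal_bound`. Since `168000 = 4 · 1500 ·
  -- 28`, the smallness of `T - t` says `28 K³ η ≤ 1`.
  set η := 4 * ((T - t) * (1500 * K ^ 5)) with hη
  have hη0 : 0 ≤ η := by positivity
  have hη1 : η * (28 * K ^ 3) ≤ 1 := by rw [hη]; linarith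
  have hC : 16 * K ^ 3 ≤ 1500 * K ^ 5 := by
    have := pow_le_pow_right₀ hK (show 3 ≤ 5 by norm_num)
    have : 0 ≤ K ^ 3 := by positivity
    linarith
  have hη28 : 28 * η ≤ 1 := by
    have := one_le_pow₀ (n := 3) hK
    nlinarith
  have hU := norm_sub_le_of_nonlocal_bound (m := m.meas) (U := fun s x => (X s x, Z s x))
    (a := t) (b := T) (C := 1500 * K ^ 5) (κ := 1) (by positivity) zero_le_one
    (by linarith) (fun s hs => (hS.admissible hs).integrable_pair)
    (fun s hs x => hS.hasDerivWithinAt hs x)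
    (fun s hs x => (h.rate_growth (hS.admissible hs) x).trans (mul_le_mul_of_nonneg_right hC
      (add_nonneg (by positivity) (integral_nonneg fun _ => norm_nonneg _)))) s hs T hT
  simp only [← hη] at hU
  have hadT := hS.admissible hT
  have iXT := hadT.integrable_X
  have iZT := hadT.integrable_Z
  set M := (m.push (X T)).norm1 with hM
  have hM' : M = ∫ y, ‖X T y‖ ∂m.meas := m.norm1_push hadT.memLp
  have hM0 : 0 ≤ M := P2.norm1_nonneg _
  have hZT : ∀ y, ‖Z T y‖ ≤ Lbarp * (1 + ‖X T y‖ + M) := fun y => by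
    rw [hS.terminal]; exact hp _ _
  have hρint : ∫ y, (1 + ‖X T y‖ + M) ∂m.meas = 1 + 2 * M := by
    have i1 : Integrable (fun y => 1 + ‖X T y‖) m.meas := (integrable_const _).add iXT.norm
    rw [integral_add i1 (integrable_const _), integral_add (integrable_const _) iXT.norm, ← hM']
    simp
    ring
  have iρ : Integrable (fun y => 1 + ‖X T y‖ + M) m.meas :=
    ((integrable_const _).add iXT.norm).add (integrable_const _)
  have hN : ∫ y, ‖Z T y‖ ∂m.meas ≤ Lbarp * (1 + 2 * M) := by
    rw [← hρint, ← integral_const_mul]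
    exact integral_mono iZT.norm (iρ.const_mul _) hZT
  have hpair : ∀ y, ‖(X T y, Z T y)‖ ≤ ‖X T y‖ + ‖Z T y‖ := fun y =>
    norm_prod_le_iff.2 ⟨le_add_of_nonneg_right (norm_nonneg _),
      le_add_of_nonneg_left (norm_nonneg _)⟩
  have hn : ∫ y, ‖(X T y, Z T y)‖ ∂m.meas ≤ M + Lbarp * (1 + 2 * M) := by
    calc _ ≤ ∫ y, (‖X T y‖ + ‖Z T y‖) ∂m.meas :=
          integral_mono hadT.integrable_pair.norm (iXT.norm.add iZT.norm) hpair
      _ = M + ∫ y, ‖Z T y‖ ∂m.meas := by rw [integral_add iXT.norm iZT.norm, hM']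
      _ ≤ _ := by linarith
  set η' := η * (1 + 3 * Lbarp) with hη'
  have hη'0 : 0 ≤ η' := by positivity
  have hdiff : ∀ y, ‖(X s y, Z s y) - (X T y, Z T y)‖ ≤ η' * (1 + ‖X T y‖ + M) := fun y => by
    refine (hU y).trans ?_
    rw [hη', mul_assoc η]
    refine mul_le_mul_of_nonneg_left ?_ hη0
    have h1 := hpair y
    have h2 := hZT y
    have h3 : 0 ≤ Lbarp * ‖X T y‖ := by positivity
    linarith [norm_nonneg (X T y)]
  have hX1 : ∀ y, ‖X T y - X s y‖ ≤ η' * (1 + ‖X T y‖ + M) := fun y => by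
    rw [norm_sub_rev]
    exact (norm_fst_le ((X s y, Z s y) - (X T y, Z T y))).trans (hdiff y)
  have hZ1 : ‖Z s x - Z T x‖ ≤ η' * (1 + ‖X T x‖ + M) :=
    (norm_snd_le ((X s x, Z s x) - (X T x, Z T x))).trans (hdiff x)
  have hMs : M ≤ (m.push (X s)).norm1 + η' * (1 + 2 * M) := by
    refine (P2.norm1_push_sub_le hadT.memLp (hS.memLp_X s hs)).trans (add_le_add le_rfl ?_)
    rw [← hρint, ← integral_const_mul]
    exact integral_mono (iXT.sub (hS.admissible hs).integrable_X).norm (iρ.const_mul _) hX1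
  have hXs : ‖X T x‖ ≤ ‖X s x‖ + ‖X T x - X s x‖ := by
    simpa using norm_add_le (X s x) (X T x - X s x)
  have hZs : ‖Z s x‖ ≤ ‖Z T x‖ + ‖Z s x - Z T x‖ := by
    simpa using norm_add_le (Z T x) (Z s x - Z T x)
  -- This is what the final comparison needs: `Z` grows by at most `η' ρ`, while the weight shrinks
  -- by at most `3 η' ρ` and is multiplied by `2 L̄_p`. The factors `1 + 3 L̄_p ≤ 4K` and `1 + 6
  -- L̄_p ≤ 7K` account for the `28`.
  have hsmall : η' * (1 + 6 * Lbarp) ≤ Lbarp := by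
    have hLK := h.Lbarp_le
    have h1 : η' * (1 + 6 * Lbarp) ≤ η * (4 * K) * (7 * K) := by
      rw [hη']; gcongr <;> linarith
    have h2 : K * (η * (4 * K) * (7 * K)) ≤ 1 := by
      calc _ = η * (28 * K ^ 3) := by ring
        _ ≤ 1 := hη1
    have h3 := h.Lbarp_inv_le
    have h4 : K * (η' * (1 + 6 * Lbarp)) ≤ K * Lbarp :=
      (mul_le_mul_of_nonneg_left h1 (by linarith)).trans (h2.trans h3)
    exact le_of_mul_le_mul_left h4 (by linarith)
  set ρ := 1 + ‖X T x‖ + M with hρ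
  have hρ0 : 0 ≤ ρ := by positivity
  -- Passing from `T` to `s` costs `η' ρ` in `|X(x)|` and at most `2 η' ρ` in the mean.
  have e1 : ρ - 3 * η' * ρ ≤ 1 + ‖X s x‖ + (m.push (X s)).norm1 := by
    have h1 := hX1 x
    have h2 : η' * (1 + 2 * M) ≤ η' * (2 * ρ) := by
      refine mul_le_mul_of_nonneg_left ?_ hη'0
      linarith [norm_nonneg (X T x)]
    linarith
  have e2 := mul_le_mul_of_nonneg_left e1 (show 0 ≤ 2 * Lbarp by linarith)
  have e3 := mul_le_mul_of_nonneg_right hsmall hρ0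
  have e4 := hZT x
  refine le_trans ?_ e2
  linarith

/-- Two solutions on a short time interval coincide. -/
theorem IsFBODESolution.unique (hS : IsFBODESolution f Df Dg p α t T m X Z)
    (hS' : IsFBODESolution f Df Dg p α t T m X' Z')
    (hp : ∀ x μ, ‖p x μ‖ ≤ Lbarp * (1 + ‖x‖ + μ.norm1))
    (hlip : ∀ {Y Y' : Euc d → Euc d}, MemLp Y 2 m.meas → MemLp Y' 2 m.meas → ∀ x x',
      ‖p x (m.push Y) - p x' (m.push Y')‖ ≤ Lbarp * (‖x - x'‖ + ∫ y, ‖Y y - Y' y‖ ∂m.meas))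
    (htT : t ≤ T) (hshort : 168000 * K ^ 8 * (T - t) ≤ 1) {s : ℝ} (hs : s ∈ Icc t T) (x : Euc d) :
    X s x = X' s x ∧ Z s x = Z' s x := by
  have hK := h.one_le
  have hT : T ∈ Icc t T := ⟨htT, le_rfl⟩
  have ht : t ∈ Icc t T := ⟨le_rfl, htT⟩
  have hδ : 0 ≤ T - t := by linarith
  set η := 4 * ((T - t) * (1500 * K ^ 5)) with hη
  have hη0 : 0 ≤ η := by positivity
  have hη1 : η * (28 * K ^ 3) ≤ 1 := by rw [hη]; linarith
  have hKη : 28 * (K * η) ≤ 1 := by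
    have h1 : K ≤ K ^ 3 := le_self_pow₀ hK (by norm_num)
    nlinarith
  have hη28 : 28 * η ≤ 1 := by nlinarith
  set U : ℝ → Euc d → Euc d × Euc d := fun s x => (X s x - X' s x, Z s x - Z' s x) with hUdef
  have iX : ∀ s ∈ Icc t T, Integrable (fun y => X s y - X' s y) m.meas := fun s hs =>
    (hS.admissible hs).integrable_X.sub (hS'.admissible hs).integrable_X
  have iU : ∀ s ∈ Icc t T, Integrable (U s) m.meas := fun s hs =>
    (iX s hs).prodMk ((hS.admissible hs).integrable_Z.sub (hS'.admissible hs).integrable_Z)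
  -- With `κ = 0` the estimate is homogeneous: vanishing of `U` and of its mean at one time
  -- propagates to all times.
  have hU := norm_sub_le_of_nonlocal_bound (m := m.meas) (U := U) (a := t) (b := T)
    (C := 1500 * K ^ 5) (κ := 0) (by positivity) le_rfl (by linarith) iU
    (fun s hs x => (hS.hasDerivWithinAt hs x).sub (hS'.hasDerivWithinAt hs x))
    (fun s hs x => by
      rw [zero_add]
      exact h.rate_lip (hS.admissible hs) (hS'.admissible hs)
        (fun y => hS.mem_cone h hp htT hshort hs y) x)
  simp only [zero_add, ← hη] at hU
  set b := ∫ y, ‖U t y‖ ∂m.meas with hb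
  have hb0 : 0 ≤ b := integral_nonneg fun _ => norm_nonneg _
  have hXt : ∀ y, X t y - X' t y = 0 := fun y => by rw [hS.initial, hS'.initial, sub_self]
  have hXT : ∀ y, ‖X T y - X' T y‖ ≤ η * (‖U t y‖ + b) := fun y => by
    have h1 : ‖(X T y - X' T y) - (X t y - X' t y)‖ ≤ η * (‖U t y‖ + b) :=
      (norm_fst_le (U T y - U t y)).trans (hU T hT t ht y)
    rwa [hXt, sub_zero] at h1
  have hZT : ∀ y, ‖(Z T y - Z' T y) - (Z t y - Z' t y)‖ ≤ η * (‖U t y‖ + b) := fun y =>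
    (norm_snd_le (U T y - U t y)).trans (hU T hT t ht y)
  have hZt : ∀ y, ‖U t y‖ = ‖Z t y - Z' t y‖ := fun y => by
    change ‖(X t y - X' t y, Z t y - Z' t y)‖ = _
    rw [hXt, Prod.norm_mk, norm_zero]
    exact max_eq_right (norm_nonneg _)
  have hint : ∫ y, (‖U t y‖ + b) ∂m.meas = 2 * b := by
    rw [integral_add (iU t ht).norm (integrable_const _), ← hb]
    simp
    ring
  have iUb : Integrable (fun y => ‖U t y‖ + b) m.meas := (iU t ht).norm.add (integrable_const _)
  have hXTint : ∫ y, ‖X T y - X' T y‖ ∂m.meas ≤ η * (2 * b) := by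
    rw [← hint, ← integral_const_mul]
    exact integral_mono (iX T hT).norm (iUb.const_mul _) hXT
  -- Go from `t` to `T` with `X`, through the terminal condition, and back to `t` with `Z`. The loop
  -- has gain at most `4 K η ≤ 1/7`.
  have key : ∀ y, ‖U t y‖ ≤ 1 / 7 * (‖U t y‖ + b) := fun y => by
    have h1 : ‖Z T y - Z' T y‖ ≤ K * (η * (‖U t y‖ + b) + η * (2 * b)) := by
      rw [hS.terminal, hS'.terminal]
      refine (hlip (hS.memLp_X T hT) (hS'.memLp_X T hT) _ _).trans ?_
      exact mul_le_mul h.Lbarp_le (add_le_add (hXT y) hXTint)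
        (add_nonneg (norm_nonneg _) (integral_nonneg fun _ => norm_nonneg _)) (by linarith)
    have h2 := hZT y
    have h3 := hZt y
    have h4 : ‖Z t y - Z' t y‖ ≤ ‖Z T y - Z' T y‖ + ‖(Z T y - Z' T y) - (Z t y - Z' t y)‖ := by
      have := norm_sub_le (Z T y - Z' T y) ((Z T y - Z' T y) - (Z t y - Z' t y))
      simpa using this
    have hu0 : 0 ≤ ‖U t y‖ := norm_nonneg _
    clear_value U b η
    have hub : 0 ≤ ‖U t y‖ + b := add_nonneg hu0 hb0
    have h5 : η * (‖U t y‖ + b) ≤ K * η * (‖U t y‖ + b) :=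
      mul_le_mul_of_nonneg_right (le_mul_of_one_le_left hη0 hK) hub
    have h6 : K * η * (4 * (‖U t y‖ + b)) ≤ 1 / 28 * (4 * (‖U t y‖ + b)) :=
      mul_le_mul_of_nonneg_right (by linarith) (by linarith)
    have h7 : 0 ≤ K * η * ‖U t y‖ := mul_nonneg (mul_nonneg (by linarith) hη0) hu0
    linarith
  -- Integrating `key` gives `b ≤ 2b/7`, so the mean vanishes; then `key` itself gives the statement
  -- at every `x`, not only almost everywhere.
  have hbz : b = 0 := by
    have : b ≤ 1 / 7 * (2 * b) := by
      rw [← hint, ← integral_const_mul]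
      exact integral_mono (iU t ht).norm (iUb.const_mul _) key
    linarith
  have hUt : ‖U t x‖ = 0 := by
    have := key x
    rw [hbz, add_zero] at this
    linarith [norm_nonneg (U t x)]
  have hUs := hU s hs t ht x
  rw [← hb, hUt, hbz, add_zero, mul_zero, norm_eq_zero.1 hUt, sub_zero] at hUs
  have hz : U s x = 0 := norm_le_zero_iff.1 hUs
  exact ⟨sub_eq_zero.1 (congrArg Prod.fst hz), sub_eq_zero.1 (congrArg Prod.snd hz)⟩

end MFTC

end

/-- Absolute values appear because the constants are fixed before their signs are known. The two
inverse terms provide upper bounds for `1 / L̄_p` and `1 / λ_g`. -/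
theorem exists_controlling_constant (Lbarp Lf Lamf lbarf Lg Lamg lbarg Lalpha : ℝ) :
    ∃ K : ℝ, 1 ≤ K ∧ |Lbarp| ≤ K ∧ |Lbarp|⁻¹ ≤ K ∧ |Lf| ≤ K ∧ |Lamf| ≤ K ∧ |lbarf| ≤ K ∧
      |Lg| ≤ K ∧ |Lamg| ≤ K ∧ |lbarg| ≤ K ∧ |Lalpha| * |Lamf|⁻¹ ≤ K := by
  have h1 : 0 ≤ |Lbarp|⁻¹ := by positivity
  have h2 : 0 ≤ |Lalpha| * |Lamf|⁻¹ := by positivity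
  refine ⟨1 + |Lbarp| + |Lbarp|⁻¹ + |Lf| + |Lamf| + |lbarf| + |Lg| + |Lamg| + |lbarg| +
    |Lalpha| * |Lamf|⁻¹, ?_, ?_, ?_, ?_, ?_, ?_, ?_, ?_, ?_, ?_⟩ <;>
  linarith [abs_nonneg Lbarp, abs_nonneg Lf, abs_nonneg Lamf, abs_nonneg lbarf, abs_nonneg Lg,
    abs_nonneg Lamg, abs_nonneg lbarg]

theorem mainTheorem10 (Lbarp Lf Lamf lbarf Lg Lamg lbarg Lalpha : ℝ) :
    ∃ ε : ℝ, 0 < ε ∧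
      ∀ (dx dα : ℕ)
        (f : MFTC.Euc dx → MFTC.P2 dx → MFTC.Euc dα → MFTC.Euc dx)
        (Df : MFTC.Derivs dx dα (MFTC.Euc dx))
        (g : MFTC.Euc dx → MFTC.P2 dx → MFTC.Euc dα → ℝ)
        (Dg : MFTC.Derivs dx dα ℝ)
        (p : MFTC.Euc dx → MFTC.P2 dx → MFTC.Euc dx)
        (px : MFTC.Euc dx → MFTC.P2 dx → MFTC.Euc dx →L[ℝ] MFTC.Euc dx)
        (pm : MFTC.Euc dx → MFTC.P2 dx → MFTC.Euc dx → MFTC.Euc dx →L[ℝ] MFTC.Euc dx)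
        (α : MFTC.Euc dx → MFTC.P2 dx → MFTC.Euc dx → MFTC.Euc dα)
        (lamf Lipf lamg lg Lp : ℝ),
        MFTC.AssumptionA1 f Df lamf Lamf lbarf Lipf →
        MFTC.AssumptionA2 g Dg lamg Lamg lbarg lg →
        MFTC.AssumptionP p px pm Lp Lbarp →
        Lp ≤ Lbarp →
        (∀ x μ a, ‖Df.daa x μ a‖ * (1 + ‖x‖ + μ.norm1) ≤ 1 / (40 * Lbarp) * lamg) →
        (∀ x μ z, (x, μ, z) ∈ MFTC.cone dx (4 * Lbarp) →
          MFTC.FirstOrderCondition Df Dg x μ z (α x μ z)) →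
        Lf = max Lamf ‖f 0 (MFTC.P2.dirac 0) 0‖ →
        Lg = max (max (max ‖Dg.dm 0 (MFTC.P2.dirac 0) 0 0‖ ‖Dg.dx 0 (MFTC.P2.dirac 0) 0‖)
          ‖Dg.da 0 (MFTC.P2.dirac 0) 0‖) (max Lamg lbarg) →
        Lalpha = max (max (20 * Lamf / (19 * lamg))
          (20 * (lbarg + 1 / 2 * (4 * Lbarp) * lbarf) / (19 * lamg)))
          ‖α 0 (MFTC.P2.dirac 0) 0‖ →
        ∀ (T t T' : ℝ), 0 ≤ t → t ≤ T' → T' ≤ T → T' - t ≤ ε →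
        ∀ (m : MFTC.P2 dx) (X Z X' Z' : ℝ → MFTC.Euc dx → MFTC.Euc dx),
          MFTC.IsFBODESolution f Df Dg p α t T' m X Z →
          MFTC.IsFBODESolution f Df Dg p α t T' m X' Z' →
          ∀ s ∈ Set.Icc t T', ∀ x, X s x = X' s x ∧ Z s x = Z' s x := by
  obtain ⟨K, hK, kp, kpi, kLf, kLamf, klbarf, kLg, kLamg, klbarg, kal⟩ :=
    exists_controlling_constant Lbarp Lf Lamf lbarf Lg Lamg lbarg Lalpha
  have hK0 : 0 < K := by linarith
  refine ⟨1 / (168000 * K ^ 8), by positivity, ?_⟩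
  intro dx dα f Df g Dg p px pm α lamf Lipf lamg lg Lp h1 h2 hP hLp hdaa _ hLf hLg hLalpha T t T'
    _ htT' _ hshort m X Z X' Z' hS hS' s hs x
  have hlamg := h2.lamg_pos
  have hLamf := h1.Lamf_pos
  have hLbarp := hP.Lbarp_pos
  have hctl : MFTC.ControlledBy f Df g Dg lamf Lamf lbarf Lipf lamg Lamg lbarg lg Lbarp K := by
    have hg : max (max (max ‖Dg.dm 0 (MFTC.P2.dirac 0) 0 0‖ ‖Dg.dx 0 (MFTC.P2.dirac 0) 0‖)
        ‖Dg.da 0 (MFTC.P2.dirac 0) 0‖) (max Lamg lbarg) ≤ K :=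
      hLg ▸ (le_abs_self Lg).trans kLg
    have hf : max Lamf ‖f 0 (MFTC.P2.dirac 0) 0‖ ≤ K := hLf ▸ (le_abs_self Lf).trans kLf
    simp only [max_le_iff] at hg hf
    refine ⟨h1, h2, hLbarp, hdaa, hK, (le_abs_self _).trans kp, ?_, (le_abs_self _).trans kLamf,
      (le_abs_self _).trans klbarf, hg.2.1, hg.2.2, ?_, hf.2, hg.1.1.1, hg.1.1.2, hg.1.2⟩
    · rw [abs_of_pos hLbarp] at kpi
      calc (1 : ℝ) = Lbarp⁻¹ * Lbarp := (inv_mul_cancel₀ hLbarp.ne').symm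
        _ ≤ K * Lbarp := by gcongr
    -- `λ_g` is not among the constants on which `ε` may depend; the first entry in the maximum
    -- defining `L_α` bounds it from below by `Λ_f / L_α`.
    · have hle : 20 * Lamf / (19 * lamg) ≤ Lalpha :=
        hLalpha ▸ (le_max_left _ _).trans (le_max_left _ _)
      have hLal : 0 ≤ Lalpha := le_trans (by positivity) hle
      rw [abs_of_nonneg hLal, abs_of_pos hLamf] at kal
      rw [div_le_iff₀ (by positivity)] at hle
      have hle' : Lamf ≤ Lalpha * lamg := by linarith
      calc (1 : ℝ) = Lamf * Lamf⁻¹ := (mul_inv_cancel₀ hLamf.ne').symm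
        _ ≤ Lalpha * lamg * Lamf⁻¹ := by gcongr
        _ = Lalpha * Lamf⁻¹ * lamg := by ring
        _ ≤ K * lamg := by gcongr
  refine hS.unique hctl hS' hP.growth (fun hY hY' x x' => ?_) htT' ?_ hs x
  · exact (hP.lip hY hY' x x').trans (mul_le_mul_of_nonneg_right hLp
      (add_nonneg (norm_nonneg _) (MeasureTheory.integral_nonneg fun _ => norm_nonneg _)))
  · rw [le_div_iff₀ (by positivity)] at hshort
    linarith
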